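/- Work over $\mathbb C$. Let $W=\mathbb C^\infty=\bigcup_n\mathbb C^n$, let $W_*$ be its restricted dual, and $GL_\infty=\bigcup_n GL_n(\mathbb C)$. A representation of $GL_\infty$ is polynomial if it is a subquotient of a (possibly infinite) direct sum of tensor powers of $\mathbb C^\infty$. Let $\varepsilon=1$ ("spin case") or $\varepsilon=-1$ ("oscillator case"). **Modules.** Let $\mathfrak a=\mathbb C^\infty\oplus \mathrm{Sym}^2(\mathbb C^\infty)$ if $\varepsilon=1$ and $\mathfrak a=\mathbb C^\infty\oplus\bigwedge^2(\mathbb C^\infty)$ if $\varepsilon=-1$, with the bracket $[(v,f),(v',f')]=(0,vv')$, respectively $(0,v\wedge v')$. Let $\mathcal U(\mathfrak a)$ be the quotient of the tensor algebra of $\mathfrak a$ by the relations $vw+\varepsilon wv=[v,w]$, $vf=fv$, $ff'=f'f$ for $v,w\in\mathbb C^\infty$ and $f,f'$ in the second summand. Let $\mathrm{Mod}_{\mathcal U(\mathfrak a)}$ be the category of $\mathcal U(\mathfrak a)$-modules with a compatible polynomial $GL_\infty$-action. For a partition $\lambda$ let $\mathbf S_\lambda$ be the module $\mathbf S_\lambda(\mathbb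 C^\infty)$ (Schur functor), on which $\mathfrak a$ acts by $0$. **Diagrams.** A diagram between finite sets $L$ and $L'$ is a triple $(U,\Gamma,f)$: a subset $U\subset L$ with a total order, a directed partial matching $\Gamma$ on $L\setminus U$ with vertex set $V(\Gamma)$, and a bijection $f\colon L\setminus(U\cup V(\Gamma))\to L'$. The downwards category has the finite sets as objects; the morphisms $L\to L'$ are the span of the diagrams modulo two kinds of relations: reversing one edge multiplies a diagram by $\varepsilon$ (so for $\varepsilon=1$ matchings are undirected), and $\Gamma+\varepsilon\Gamma'=\Gamma''$ if $\Gamma'$ arises from $\Gamma$ by switching two consecutive elements $i<j$ of $U$, and $\Gamma''$ by removing $i,j$ from $U$ and adding an edge from $i$ to $j$. The composition of $(U,\Gamma,f)$ followed by $(U',\Gamma',f')$ is $(U\cup f^{-1}(U'),\Gamma\cup f^{-1}(\Gamma'),f'f)$, with $U$ before $f^{-1}(U')$. The opposite categories are the upwards spin category $(\mathrm u\Delta)$ for $\varepsilon=1$ and the upwards oscillator category $(\mathrm u\nabla)$ for $\varepsilon=-1$; $\mathrm{Mod}_{(\mathrm u\Delta)}$, $\mathrm{Mod}_{(\mathrm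 u\nabla)}$ are the categories of $\mathbb C$-linear functors from them to vector spaces. **Representations of $\mathfrak g$.** Let $\mathbf V=W\oplus W_*\oplus\mathbb C e$, purely even if $\varepsilon=1$, and with $e$ even and $W\oplus W_*$ odd if $\varepsilon=-1$, with the (super)symmetric form such that $W$, $W_*$ are isotropic and orthogonal to $e$, $\omega(\phi,v)=\phi(v)$, $\omega(v,\phi)=\varepsilon\phi(v)$, $\omega(e,e)=1$. Let $\Delta=\bigwedge W$ (purely even) if $\varepsilon=1$ and $\nabla=\mathrm{Sym}\,W$ (with the parity of the degree) if $\varepsilon=-1$; let $X_v$ be multiplication by $v$, $Y_\phi$ contraction with (respectively differentiation along) $\phi$, $D$ multiplication by $(-1)^n$ in degree $n$. Put $t_v=X_v$, $t_\phi=Y_\phi$, $t_e=D/\sqrt2$; then $t_xt_y+(-1)^{|x||y|}t_yt_x=\omega(x,y)$. The Lie (super)algebra $\mathfrak g=\bigwedge^2\mathbf V$ (in the super sense; $\mathfrak{so}(2\infty+1)$, respectively $\mathfrak{osp}(1|2\infty)$) acts on $\mathbf V$ by $(x\wedge y)u=\omega(y,u)x-(-1)^{|x||y|}\omega(x,u)y$,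 on $\Delta$ (respectively $\nabla$) by $t_xt_y-\frac12\omega(x,y)$, and on $\mathcal K_L=\mathbf V^{\otimes L}\otimes\Delta$ (respectively $\mathbf V^{\otimes L}\otimes\nabla$) by the (super) Leibniz rule. Here tensor factors $x,y$ of $\mathbf V^{\otimes L}$ are interchanged with the sign $\varepsilon(-1)^{|x||y|}$. A diagram $(U,\Gamma,f)$ gives a map $\mathcal K_L\to\mathcal K_{L'}$: apply $t$ to the factors in $U$, in order; apply $\omega(x_j,x_i)$ for each edge from $i$ to $j$; relabel the other factors by $f$. Thus $\mathcal K$ is a functor on the downwards category. For a partition $\lambda$ of $n$ let $\mathbf M_\lambda$ be the irreducible representation of $S_n$ indexed by $\lambda$, let $T^{[n]}\subset\mathcal K_{\{1,\dots,n\}}$ be the intersection of the kernels of the $n$ maps $t_i$ (apply $t$ to the $i$-th factor), and let $\Delta_\lambda$ (respectively $\nabla_\lambda$) be $\mathrm{Hom}_{S_n}(\mathbf M_\lambda,T^{[n]})$. For a representation $N$ of the upwards category let $N\otimes\mathcal K=\mathrm{Hom}(N^\vee,\mathcal K)$ be the $\mathfrak g$-representation of natural transformations of functors on the downwards category, where $N^\vee(L)=N(L)^*$.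 (On objects of finite length, $N\mapsto N\otimes\mathcal K$ is the identification of $\mathrm{Mod}^{\mathrm f}_{(\mathrm u\Delta)}$ with the category of spin-algebraic, respectively of $\mathrm{Mod}^{\mathrm f}_{(\mathrm u\nabla)}$ with that of osc-algebraic, representations of $\mathfrak g$.) **Theorem.** (a) Let $\varepsilon=1$. The categories $\mathrm{Mod}_{\mathcal U(\mathfrak a)}$ and $\mathrm{Mod}_{(\mathrm u\Delta)}$ are abelian, and there is a $\mathbb C$-linear equivalence $E\colon\mathrm{Mod}_{\mathcal U(\mathfrak a)}\to\mathrm{Mod}_{(\mathrm u\Delta)}$ such that for every partition $\lambda$ the module $\mathbf S_\lambda$ is simple and $E(\mathbf S_\lambda)$ corresponds to $\Delta_\lambda$, that is, $E(\mathbf S_\lambda)\otimes\mathcal K\cong\Delta_\lambda$ as representations of $\mathfrak g$. (b) Let $\varepsilon=-1$. The categories $\mathrm{Mod}_{\mathcal U(\mathfrak a)}$ and $\mathrm{Mod}_{(\mathrm u\nabla)}$ are abelian, and there is a $\mathbb C$-linear equivalence $E\colon\mathrm{Mod}_{\mathcal U(\mathfrak a)}\to\mathrm{Mod}_{(\mathrm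 u\nabla)}$ such that for every partition $\lambda$ the module $\mathbf S_\lambda$ is simple and $E(\mathbf S_\lambda)\otimes\mathcal K\cong\nabla_\lambda$ as (super)representations of $\mathfrak g$. -/

import Mathlib

open CategoryTheory TensorProduct

namespace SpinOsc

noncomputable section

/-! ### Twisted Lie algebras and their modules -/

/-- The sign as a complex number. Throughout, `ε = 1` is the spinor (orthogonal) case and `ε = -1` is
the oscillator (orthosymplectic) case. -/
abbrev sg (ε : ℤˣ) : ℂ := ((ε : ℤ) : ℂ)

theorem sg_mul_self (ε : ℤˣ) : sg ε * sg ε = 1 := by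
  rcases Int.units_eq_one_or ε with h | h <;> simp [sg, h]

/-- The space `ℂ^∞`. -/
def Cinf : Type := ℕ →₀ ℂ

instance Cinf.addCommGroup : AddCommGroup Cinf := inferInstanceAs (AddCommGroup (ℕ →₀ ℂ))
instance Cinf.module : Module ℂ Cinf := inferInstanceAs (Module ℂ (ℕ →₀ ℂ))

/-- The standard basis `e_0, e_1, …` of `ℂ^∞`. -/
def bas : Module.Basis ℕ ℂ Cinf := ⟨LinearEquiv.refl ℂ (ℕ →₀ ℂ)⟩

/-- `GL_∞ = ⋃ GL_n(ℂ)`: the automorphisms `g` of `ℂ^∞` for which there is an `n` such that `g` fixes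
`e_i` for `i ≥ n` and `g v` has the same `i`-th coordinate as `v` for `i ≥ n`; that is, `g` is the
block sum of an invertible `n × n` matrix and an identity matrix. -/
def GLinf : Subgroup (Cinf ≃ₗ[ℂ] Cinf) where
  carrier := {g | ∃ n : ℕ, (∀ i ≥ n, g (bas i) = bas i) ∧
    ∀ v : Cinf, ∀ i ≥ n, bas.coord i (g v) = bas.coord i v}
  one_mem' := ⟨0, fun _ _ => rfl, fun _ _ _ => rfl⟩
  mul_mem' := by
    rintro g h ⟨n, hn, hn'⟩ ⟨m, hm, hm'⟩
    refine ⟨max n m, fun i hi => ?_, fun v i hi => ?_⟩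
    · rw [LinearEquiv.mul_apply, hm i (le_trans (le_max_right _ _) hi),
        hn i (le_trans (le_max_left _ _) hi)]
    · rw [LinearEquiv.mul_apply, hn' _ i (le_trans (le_max_left _ _) hi),
        hm' _ i (le_trans (le_max_right _ _) hi)]
  inv_mem' := by
    rintro g ⟨n, hn, hn'⟩
    refine ⟨n, fun i hi => ?_, fun v i hi => ?_⟩
    · exact (LinearEquiv.symm_apply_eq g).2 (hn i hi).symm
    · have := hn' (g.symm v) i hi
      rw [LinearEquiv.apply_symm_apply] at this
      exact this.symm

/-- The representation of `GL_∞` on the tensor power `(ℂ^∞)^{⊗ ι}`. -/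
def tensorRep (ι : Type) : Representation ℂ GLinf (⨂[ℂ] _ : ι, Cinf) where
  toFun g := PiTensorProduct.map fun _ => (g.1 : Cinf →ₗ[ℂ] Cinf)
  map_one' := PiTensorProduct.map_one
  map_mul' g h := PiTensorProduct.map_mul (fun _ => (g.1 : Cinf →ₗ[ℂ] Cinf)) fun _ => (h.1 : Cinf →ₗ[ℂ] Cinf)

/-- A representation of `GL_∞` is polynomial if it is a subquotient (the quotient by `q` of the
subrepresentation `N`) of a direct sum of tensor powers of `ℂ^∞`. -/
def IsPolynomial {V : Type} [AddCommGroup V] [Module ℂ V] (ρ : Representation ℂ GLinf V) : Prop :=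
  ∃ (I : Type) (d : I → ℕ) (N : Submodule ℂ (Π₀ i : I, ⨂[ℂ] _ : Fin (d i), Cinf))
    (hN : ∀ g : GLinf, ∀ x ∈ N,
      DFinsupp.mapRange.linearMap (fun i => tensorRep (Fin (d i)) g) x ∈ N)
    (q : N →ₗ[ℂ] V), Function.Surjective q ∧
      ∀ (g : GLinf) (x : N), q ⟨_, hN g x.1 x.2⟩ = ρ g (q x)

/-- `Sym²(ℂ^∞)` if `ε = 1` and `⋀²(ℂ^∞)` if `ε = -1`: the quotient of `ℂ^∞ ⊗ ℂ^∞` by the elements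
`v ⊗ w - ε w ⊗ v`. -/
def Sq (ε : ℤˣ) : Type :=
  (Cinf ⊗[ℂ] Cinf) ⧸
    Submodule.span ℂ (Set.range fun p : Cinf × Cinf => p.1 ⊗ₜ[ℂ] p.2 - sg ε • p.2 ⊗ₜ[ℂ] p.1)

instance Sq.addCommGroup (ε : ℤˣ) : AddCommGroup (Sq ε) := inferInstanceAs (AddCommGroup (_ ⧸ _))
instance Sq.module (ε : ℤˣ) : Module ℂ (Sq ε) := inferInstanceAs (Module ℂ (_ ⧸ _))

/-- The product `v w ∈ Sym²`, respectively `v ∧ w ∈ ⋀²`. -/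
def sqMul (ε : ℤˣ) : Cinf →ₗ[ℂ] Cinf →ₗ[ℂ] Sq ε :=
  (TensorProduct.mk ℂ Cinf Cinf).compr₂ (Submodule.mkQ _)

theorem sqMul_comm (ε : ℤˣ) (v w : Cinf) : sqMul ε v w = sg ε • sqMul ε w v := by
  have : (v ⊗ₜ[ℂ] w - sg ε • w ⊗ₜ[ℂ] v) ∈ Submodule.span ℂ (Set.range fun p : Cinf × Cinf =>
      p.1 ⊗ₜ[ℂ] p.2 - sg ε • p.2 ⊗ₜ[ℂ] p.1) := Submodule.subset_span ⟨(v, w), rfl⟩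
  exact (Submodule.Quotient.eq _).2 this

/-- Functoriality of `Sym²`, respectively `⋀²`. -/
def sqMap (ε : ℤˣ) (g : Cinf →ₗ[ℂ] Cinf) : Sq ε →ₗ[ℂ] Sq ε :=
  Submodule.liftQ _ (TensorProduct.lift ((sqMul ε).compl₁₂ g g)) <| by
    rw [Submodule.span_le]
    rintro _ ⟨p, rfl⟩
    simp [sqMul_comm ε (g p.1) (g p.2)]

@[simp] theorem sqMap_sqMul (ε : ℤˣ) (g : Cinf →ₗ[ℂ] Cinf) (v w : Cinf) :
    sqMap ε g (sqMul ε v w) = sqMul ε (g v) (g w) := rfl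

/-- The twisted Lie algebra `𝔞 = ℂ^∞ ⊕ Sym²(ℂ^∞)`, respectively `ℂ^∞ ⊕ ⋀²(ℂ^∞)`; the first summand has
degree 1 and the second has degree 2. -/
abbrev TwLie (ε : ℤˣ) : Type := Cinf × Sq ε

/-- The bracket `[(v, f), (v', f')] = (0, v v')`, respectively `(0, v ∧ v')`. -/
def bracket (ε : ℤˣ) (x y : TwLie ε) : TwLie ε := (0, sqMul ε x.1 y.1)

/-- The action of `g` on `𝔞`. -/
def twMap (ε : ℤˣ) (g : Cinf →ₗ[ℂ] Cinf) : TwLie ε →ₗ[ℂ] TwLie ε := g.prodMap (sqMap ε g)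

/-- The relations of the universal enveloping algebra of `𝔞`. For `ε = 1` they are
`x y - (-1)^{|x||y|} y x = [x, y]` for homogeneous `x, y` (the bracket is commutative in odd degree),
for `ε = -1` they are `x y - y x = [x, y]`. -/
inductive URel (ε : ℤˣ) : TensorAlgebra ℂ (TwLie ε) → TensorAlgebra ℂ (TwLie ε) → Prop
  | odd_odd (v w : Cinf) : URel ε
      (TensorAlgebra.ι ℂ (v, 0) * TensorAlgebra.ι ℂ (w, 0) +
        sg ε • (TensorAlgebra.ι ℂ (w, 0) * TensorAlgebra.ι ℂ (v, 0)))
      (TensorAlgebra.ι ℂ (bracket ε (v, 0) (w, 0)))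
  | odd_even (v : Cinf) (f : Sq ε) : URel ε
      (TensorAlgebra.ι ℂ (v, 0) * TensorAlgebra.ι ℂ (0, f) -
        TensorAlgebra.ι ℂ (0, f) * TensorAlgebra.ι ℂ (v, 0))
      (TensorAlgebra.ι ℂ (bracket ε (v, 0) (0, f)))
  | even_even (f f' : Sq ε) : URel ε
      (TensorAlgebra.ι ℂ (0, f) * TensorAlgebra.ι ℂ (0, f') -
        TensorAlgebra.ι ℂ (0, f') * TensorAlgebra.ι ℂ (0, f))
      (TensorAlgebra.ι ℂ (bracket ε (0, f) (0, f')))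

/-- The universal enveloping algebra `U(𝔞)`. -/
abbrev UEnv (ε : ℤˣ) : Type := RingQuot (URel ε)

/-- The map `𝔞 → U(𝔞)`. -/
def uι (ε : ℤˣ) : TwLie ε →ₗ[ℂ] UEnv ε :=
  (RingQuot.mkAlgHom ℂ (URel ε)).toLinearMap ∘ₗ TensorAlgebra.ι ℂ

theorem uι_def (ε : ℤˣ) (x : TwLie ε) :
    RingQuot.mkAlgHom ℂ (URel ε) (TensorAlgebra.ι ℂ x) = uι ε x := rfl

/-- The action of `g` on `U(𝔞)` by algebra automorphisms. -/
def uMap (ε : ℤˣ) (g : Cinf →ₗ[ℂ] Cinf) : UEnv ε →ₐ[ℂ] UEnv ε :=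
  RingQuot.liftAlgHom ℂ ⟨TensorAlgebra.lift ℂ (uι ε ∘ₗ twMap ε g), by
    intro x y h
    cases h with
    | odd_odd v w =>
      have := RingQuot.mkAlgHom_rel ℂ (URel.odd_odd (ε := ε) (g v) (g w))
      simpa [twMap, bracket, uι_def] using this
    | odd_even v f =>
      have := RingQuot.mkAlgHom_rel ℂ (URel.odd_even (ε := ε) (g v) (sqMap ε g f))
      simpa [twMap, bracket, uι_def] using this
    | even_even f f' =>
      have := RingQuot.mkAlgHom_rel ℂ (URel.even_even (ε := ε) (sqMap ε g f) (sqMap ε g f'))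
      simpa [twMap, bracket, uι_def] using this⟩

/-- The augmentation `U(𝔞) → ℂ`, which kills `𝔞`. -/
def uAug (ε : ℤˣ) : UEnv ε →ₐ[ℂ] ℂ :=
  RingQuot.liftAlgHom ℂ ⟨TensorAlgebra.lift ℂ 0, by
    intro x y h
    cases h <;> simp⟩

theorem uAug_uMap (ε : ℤˣ) (g : Cinf →ₗ[ℂ] Cinf) (u : UEnv ε) :
    uAug ε (uMap ε g u) = uAug ε u := by
  suffices h : (uAug ε).comp (uMap ε g) = uAug ε from DFunLike.congr_fun h u
  apply RingQuot.ringQuot_ext'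
  ext x <;> simp [uAug, uMap, uι, twMap]

/-- A `U(𝔞)`-module with a compatible polynomial action of `GL_∞`. -/
structure UMod (ε : ℤˣ) where
  carrier : Type
  [addCommGroup : AddCommGroup carrier]
  [module : Module ℂ carrier]
  ρ : Representation ℂ GLinf carrier
  polynomial : IsPolynomial ρ
  act : UEnv ε →ₐ[ℂ] Module.End ℂ carrier
  compat : ∀ (g : GLinf) (u : UEnv ε) (m : carrier),
    ρ g (act u m) = act (uMap ε g.1 u) (ρ g m)

attribute [instance] UMod.addCommGroup UMod.module

/-- The maps of modules: linear maps that commute with `U(𝔞)` and with `GL_∞`. -/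
def UMod.homs {ε : ℤˣ} (M N : UMod ε) : Submodule ℂ (M.carrier →ₗ[ℂ] N.carrier) where
  carrier := {f | (∀ u m, f (M.act u m) = N.act u (f m)) ∧ ∀ g m, f (M.ρ g m) = N.ρ g (f m)}
  add_mem' := by
    rintro f f' ⟨h1, h2⟩ ⟨h1', h2'⟩
    exact ⟨fun u m => by simp [h1, h1'], fun g m => by simp [h2, h2']⟩
  zero_mem' := ⟨fun u m => by simp, fun g m => by simp⟩
  smul_mem' := by
    rintro c f ⟨h1, h2⟩
    exact ⟨fun u m => by simp [h1], fun g m => by simp [h2]⟩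

instance UMod.category (ε : ℤˣ) : Category.{0} (UMod ε) where
  Hom M N := UMod.homs M N
  id M := ⟨LinearMap.id, fun _ _ => rfl, fun _ _ => rfl⟩
  comp f f' := ⟨f'.1 ∘ₗ f.1,
    fun u m => by simp [f.2.1 u m, f'.2.1], fun g m => by simp [f.2.2 g m, f'.2.2]⟩

instance UMod.preadditive (ε : ℤˣ) : Preadditive (UMod ε) where
  homGroup M N := inferInstanceAs (AddCommGroup (UMod.homs M N))
  add_comp _ _ _ f g h := Subtype.ext (LinearMap.comp_add f.1 g.1 h.1)
  comp_add _ _ _ f g h := Subtype.ext (LinearMap.add_comp f.1 h.1 g.1)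

instance UMod.linear (ε : ℤˣ) : Linear ℂ (UMod ε) where
  homModule M N := inferInstanceAs (Module ℂ (UMod.homs M N))
  smul_comp _ _ _ c f g := Subtype.ext (LinearMap.ext fun m => map_smul g.1 c (f.1 m))
  comp_smul _ _ _ f c g := Subtype.ext (LinearMap.smul_comp c g.1 f.1)

/-! ### Partitions -/

/-- The cells of a partition. We use them as the index set with `|μ|` elements, so that the tautological
filling of `μ` by its cells is the tableau that defines the Young symmetrizer. -/
abbrev Cell (μ : YoungDiagram) : Type := {c : ℕ × ℕ // c ∈ μ.cells}

/-- The Young symmetrizer `(∑ p) (∑ sgn(q) q)`, where `p` runs over the permutations that preserve the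
rows and `q` over the permutations that preserve the columns. -/
def youngSym (μ : YoungDiagram) : MonoidAlgebra ℂ (Equiv.Perm (Cell μ)) :=
  ∑ p : Equiv.Perm (Cell μ) with ∀ c, (p c).1.1 = c.1.1,
    ∑ q : Equiv.Perm (Cell μ) with ∀ c, (q c).1.2 = c.1.2,
      MonoidAlgebra.single (p * q) (sg (Equiv.Perm.sign q))

/-- The permutation of the tensor factors of `(ℂ^∞)^{⊗ ι}` by `σ`. -/
def permOp {ι : Type} (σ : Equiv.Perm ι) : Module.End ℂ (⨂[ℂ] _ : ι, Cinf) :=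
  (PiTensorProduct.reindex ℂ (fun _ : ι => Cinf) σ).toLinearMap

theorem permOp_tprod {ι : Type} (σ : Equiv.Perm ι) (f : ι → Cinf) :
    permOp σ (PiTensorProduct.tprod ℂ f) = PiTensorProduct.tprod ℂ (fun i => f (σ.symm i)) :=
  PiTensorProduct.reindex_tprod σ f

/-- The representation of the symmetric group on `(ℂ^∞)^{⊗ ι}`. -/
def permRep (ι : Type) : Representation ℂ (Equiv.Perm ι) (⨂[ℂ] _ : ι, Cinf) where
  toFun := permOp
  map_one' := by
    ext f
    exact permOp_tprod 1 f
  map_mul' σ τ := by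
    ext f
    rw [LinearMap.compMultilinearMap_apply, LinearMap.compMultilinearMap_apply,
      Module.End.mul_apply, permOp_tprod, permOp_tprod, permOp_tprod]
    rfl

theorem tensorRep_tprod (ι : Type) (g : GLinf) (f : ι → Cinf) :
    tensorRep ι g (PiTensorProduct.tprod ℂ f) = PiTensorProduct.tprod ℂ fun i => g.1 (f i) :=
  PiTensorProduct.map_tprod (fun _ => (g.1 : Cinf →ₗ[ℂ] Cinf)) f

theorem permRep_tensorRep (ι : Type) (σ : Equiv.Perm ι) (g : GLinf) :
    Commute (permRep ι σ) (tensorRep ι g) := by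
  change _ = _
  ext f
  rw [LinearMap.compMultilinearMap_apply, LinearMap.compMultilinearMap_apply,
    Module.End.mul_apply, Module.End.mul_apply, tensorRep_tprod]
  change permOp σ _ = tensorRep ι g (permOp σ _)
  rw [permOp_tprod, permOp_tprod, tensorRep_tprod]

/-- The action of the Young symmetrizer on `(ℂ^∞)^{⊗ |μ|}`. -/
def youngOp (μ : YoungDiagram) : Module.End ℂ (⨂[ℂ] _ : Cell μ, Cinf) :=
  (permRep (Cell μ)).asAlgebraHom (youngSym μ)

theorem youngOp_tensorRep (μ : YoungDiagram) (g : GLinf) (x : ⨂[ℂ] _ : Cell μ, Cinf) :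
    tensorRep (Cell μ) g (youngOp μ x) = youngOp μ (tensorRep (Cell μ) g x) := by
  suffices h : Commute (youngOp μ) (tensorRep (Cell μ) g) from
    (LinearMap.congr_fun h.eq x).symm
  rw [youngOp, youngSym, map_sum]
  refine Commute.sum_left _ _ _ fun p _ => ?_
  rw [map_sum]
  refine Commute.sum_left _ _ _ fun q _ => ?_
  rw [Representation.asAlgebraHom_single]
  exact (permRep_tensorRep _ _ _).smul_left _

/-- The Schur functor `S_μ(ℂ^∞)`, the image of the Young symmetrizer on `(ℂ^∞)^{⊗ |μ|}`. -/
abbrev SchurFunctor (μ : YoungDiagram) : Submodule ℂ (⨂[ℂ] _ : Cell μ, Cinf) :=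
  LinearMap.range (youngOp μ)

/-- The representation of `GL_∞` on `S_μ(ℂ^∞)`. -/
def schurRep (μ : YoungDiagram) : Representation ℂ GLinf (SchurFunctor μ) where
  toFun g := (tensorRep (Cell μ) g).restrict (by
    rintro _ ⟨x, rfl⟩
    exact ⟨tensorRep (Cell μ) g x, (youngOp_tensorRep μ g x).symm⟩)
  map_one' := by ext x; simp
  map_mul' g h := by ext x; simp

theorem schurRep_polynomial (μ : YoungDiagram) : IsPolynomial (schurRep μ) := by
  let e := Fintype.equivFin (Cell μ)
  let r := PiTensorProduct.reindex ℂ (fun _ : Fin (Fintype.card (Cell μ)) => Cinf) e.symm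
  let q := (youngOp μ).rangeRestrict ∘ₗ
    (r : (⨂[ℂ] _ : Fin (Fintype.card (Cell μ)), Cinf) →ₗ[ℂ] ⨂[ℂ] _ : Cell μ, Cinf)
  have hr : ∀ g x, r (tensorRep _ g x) = tensorRep _ g (r x) := fun g x =>
    (PiTensorProduct.map_reindex (fun _ => (g.1 : Cinf →ₗ[ℂ] Cinf)) e.symm x).symm
  refine ⟨Unit, fun _ => Fintype.card (Cell μ), ⊤, fun _ _ _ => trivial,
    q ∘ₗ DFinsupp.lapply () ∘ₗ Submodule.subtype _, ?_, ?_⟩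
  · rintro ⟨_, x, rfl⟩
    refine ⟨⟨DFinsupp.single () (r.symm x), trivial⟩, ?_⟩
    apply Subtype.ext
    change youngOp μ (r ((DFinsupp.single () (r.symm x) :
      Π₀ _ : Unit, ⨂[ℂ] _ : Fin (Fintype.card (Cell μ)), Cinf) ())) = youngOp μ x
    rw [DFinsupp.single_eq_same, LinearEquiv.apply_symm_apply]
  · intro g x
    apply Subtype.ext
    change youngOp μ (r (tensorRep _ g (x.1 ()))) = tensorRep _ g (youngOp μ (r (x.1 ())))
    rw [hr, youngOp_tensorRep]

/-- The `U(𝔞)`-module `S_μ`: the representation `S_μ(ℂ^∞)` of `GL_∞`, on which `𝔞` acts by zero. -/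
def simpleU (ε : ℤˣ) (μ : YoungDiagram) : UMod ε where
  carrier := SchurFunctor μ
  ρ := schurRep μ
  polynomial := schurRep_polynomial μ
  act := (Algebra.ofId ℂ _).comp (uAug ε)
  compat g u m := by
    simp only [AlgHom.comp_apply, uAug_uMap, Algebra.ofId_apply, Module.algebraMap_end_apply,
      map_smul]

/-! ### Diagram categories -/

/-- A (spin-, respectively osc-) Brauer diagram `(U, Γ, f)` between the finite sets `L` and `L'`:
`circ` is the subset `U` of `L` with its total order, listed increasingly; `edges` is the matching `Γ`,
an edge from `i` to `j` being the pair `(i, j)`; `inj` is the inverse of the bijection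
`f : L \ (U ∪ V(Γ)) → L'`. The condition says that every element of `L` is exactly once either a value
of `inj` (for exactly one argument), an entry of `circ`, or an endpoint of an edge.
All edges are directed; for `ε = 1` the relations below identify the diagrams that
differ only in the directions of edges, so that one gets undirected matchings. -/
structure BrauerDiagram (L' L : Type) [Fintype L'] [Fintype L] where
  inj : L' → L
  circ : List L
  edges : Multiset (L × L)
  exhaust : (Finset.univ : Finset L).val =
    (Finset.univ : Finset L').val.map inj + (circ : Multiset L) +
      edges.bind fun p => {p.1, p.2}

namespace BrauerDiagram

variable {L₁ L₂ L₃ L₄ : Type} [Fintype L₁] [Fintype L₂] [Fintype L₃] [Fintype L₄]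

@[ext] theorem hext {D D' : BrauerDiagram L₁ L₂} (h1 : D.inj = D'.inj) (h2 : D.circ = D'.circ)
    (h3 : D.edges = D'.edges) : D = D' := by
  cases D; cases D'; simp_all

/-- The diagram between `L₂` and `L₁` given by a bijection `f : L₂ → L₁`. -/
def ofEquiv (f : L₂ ≃ L₁) : BrauerDiagram L₁ L₂ where
  inj := f.symm
  circ := []
  edges := 0
  exhaust := by
    have := congrArg Finset.val (Finset.map_univ_equiv f.symm)
    simp at this ⊢

/-- The identity diagram. -/
def refl (L : Type) [Fintype L] : BrauerDiagram L L := ofEquiv (Equiv.refl L)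

open Classical in
/-- The diagram between `L` and `L \ {i}` with `U = {i}` and no edges. -/
def contract {L : Type} [Fintype L] (i : L) : BrauerDiagram {j : L // j ≠ i} L where
  inj := Subtype.val
  circ := [i]
  edges := 0
  exhaust := by
    have h : (Finset.univ : Finset L) =
        Finset.cons i ((Finset.univ : Finset {j : L // j ≠ i}).map (Function.Embedding.subtype _))
          (by simp) := by
      ext j; simp [_root_.em]
    rw [h]
    simp [← Multiset.singleton_add, add_comm]

/-- The composition `(U ∪ f⁻¹(U'), Γ ∪ f⁻¹(Γ'), f' f)`. In the ordering the elements of `U` come before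
those of `f⁻¹(U')`. Here `D'` is the diagram `(U, Γ, f)`, between `L₃` and `L₂`, and `D` is the diagram
`(U', Γ', f')`, between `L₂` and `L₁`. -/
def comp (D : BrauerDiagram L₁ L₂) (D' : BrauerDiagram L₂ L₃) : BrauerDiagram L₁ L₃ where
  inj := D'.inj ∘ D.inj
  circ := D'.circ ++ D.circ.map D'.inj
  edges := D'.edges + D.edges.map (Prod.map D'.inj D'.inj)
  exhaust := by
    rw [D'.exhaust, D.exhaust]
    simp only [Multiset.map_add, Multiset.map_map, Multiset.map_coe, Multiset.add_bind,
      Multiset.map_bind, Multiset.bind_map, ← Multiset.coe_add, Prod.map, Multiset.insert_eq_cons,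
      Multiset.map_cons, Multiset.map_singleton]
    abel

theorem refl_comp (D : BrauerDiagram L₁ L₂) : (refl L₁).comp D = D := by
  ext1 <;> simp [comp, refl, ofEquiv]

theorem comp_refl (D : BrauerDiagram L₁ L₂) : D.comp (refl L₂) = D := by
  ext1 <;> simp [comp, refl, ofEquiv]

theorem comp_assoc (D : BrauerDiagram L₁ L₂) (D' : BrauerDiagram L₂ L₃)
    (D'' : BrauerDiagram L₃ L₄) : (D.comp D').comp D'' = D.comp (D'.comp D'') := by
  ext1
  · rfl
  · simp [comp]
  · simp [comp, add_assoc, Function.comp_def, Prod.map]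

end BrauerDiagram

/-- The relations between diagrams. `reverse`: reversing one edge multiplies by `ε`. `clifford`: if `i, j`
are consecutive in `U` (with `i` before `j`), `Γ'` arises from `Γ` by switching them and `Γ''` arises
from `Γ` by removing them from `U` and adding an edge from `i` to `j`, then `Γ + ε Γ' = Γ''`
(the Clifford relation for `ε = 1`, the Weyl relation for `ε = -1`). -/
inductive DRel (ε : ℤˣ) (L' L : Type) [Fintype L'] [Fintype L] :
    (BrauerDiagram L' L →₀ ℂ) → Prop
  | reverse (D D' : BrauerDiagram L' L) (i j : L) (M : Multiset (L × L))
      (hinj : D'.inj = D.inj) (hcirc : D'.circ = D.circ)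
      (h : D.edges = (i, j) ::ₘ M) (h' : D'.edges = (j, i) ::ₘ M) :
      DRel ε L' L (Finsupp.single D 1 - sg ε • Finsupp.single D' 1)
  | clifford (D D' D'' : BrauerDiagram L' L) (A B : List L) (i j : L)
      (hinj' : D'.inj = D.inj) (hinj'' : D''.inj = D.inj)
      (h : D.circ = A ++ i :: j :: B) (h' : D'.circ = A ++ j :: i :: B) (h'' : D''.circ = A ++ B)
      (he' : D'.edges = D.edges) (he'' : D''.edges = (i, j) ::ₘ D.edges) :
      DRel ε L' L (Finsupp.single D 1 + sg ε • Finsupp.single D' 1 - Finsupp.single D'' 1)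

/-- The span of the relations. -/
def relSub (ε : ℤˣ) (L' L : Type) [Fintype L'] [Fintype L] :
    Submodule ℂ (BrauerDiagram L' L →₀ ℂ) := Submodule.span ℂ {x | DRel ε L' L x}

/-- The space of morphisms `L' → L` of the upwards category, that is, of morphisms `L → L'` of the
downwards category: the span of the diagrams between `L` and `L'` modulo the relations. -/
abbrev UpHom (ε : ℤˣ) (L' L : Type) [Fintype L'] [Fintype L] : Type :=
  (BrauerDiagram L' L →₀ ℂ) ⧸ relSub ε L' L

section comp

variable {ε : ℤˣ} {L₁ L₂ L₃ L₄ : Type} [Fintype L₁] [Fintype L₂] [Fintype L₃] [Fintype L₄]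

/-- The class of a diagram. -/
def UpHom.mk (ε : ℤˣ) (D : BrauerDiagram L₁ L₂) : UpHom ε L₁ L₂ :=
  Submodule.Quotient.mk (Finsupp.single D 1)

theorem DRel.comp_right {x : BrauerDiagram L₂ L₃ →₀ ℂ} (hx : DRel ε L₂ L₃ x)
    (D : BrauerDiagram L₁ L₂) : DRel ε L₁ L₃ (Finsupp.lmapDomain ℂ ℂ D.comp x) := by
  cases hx with
  | reverse E E' i j M hinj hcirc h h' =>
    simp only [map_sub, map_smul, Finsupp.lmapDomain_apply, Finsupp.mapDomain_single]
    refine .reverse _ _ i j (M + D.edges.map (Prod.map E.inj E.inj)) ?_ ?_ ?_ ?_ <;>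
      simp [BrauerDiagram.comp, *]
  | clifford E E' E'' A B i j hinj' hinj'' h h' h'' he' he'' =>
    simp only [map_sub, map_add, map_smul, Finsupp.lmapDomain_apply, Finsupp.mapDomain_single]
    refine .clifford _ _ _ A (B ++ D.circ.map E.inj) i j ?_ ?_ ?_ ?_ ?_ ?_ ?_ <;>
      simp [BrauerDiagram.comp, *]

theorem DRel.comp_left {x : BrauerDiagram L₁ L₂ →₀ ℂ} (hx : DRel ε L₁ L₂ x)
    (D : BrauerDiagram L₂ L₃) :
    DRel ε L₁ L₃ (Finsupp.lmapDomain ℂ ℂ (fun E : BrauerDiagram L₁ L₂ => E.comp D) x) := by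
  cases hx with
  | reverse E E' i j M hinj hcirc h h' =>
    simp only [map_sub, map_smul, Finsupp.lmapDomain_apply, Finsupp.mapDomain_single]
    refine .reverse _ _ (D.inj i) (D.inj j) (D.edges + M.map (Prod.map D.inj D.inj)) ?_ ?_ ?_ ?_ <;>
      simp [BrauerDiagram.comp, *]
  | clifford E E' E'' A B i j hinj' hinj'' h h' h'' he' he'' =>
    simp only [map_sub, map_add, map_smul, Finsupp.lmapDomain_apply, Finsupp.mapDomain_single]
    refine .clifford _ _ _ (D.circ ++ A.map D.inj) (B.map D.inj) (D.inj i) (D.inj j)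
      ?_ ?_ ?_ ?_ ?_ ?_ ?_ <;>
      simp [BrauerDiagram.comp, *]

/-- Composition, on the free space in the first variable. -/
def compFree (ε : ℤˣ) (L₁ L₂ L₃ : Type) [Fintype L₁] [Fintype L₂] [Fintype L₃] :
    (BrauerDiagram L₁ L₂ →₀ ℂ) →ₗ[ℂ] UpHom ε L₂ L₃ →ₗ[ℂ] UpHom ε L₁ L₃ :=
  Finsupp.linearCombination ℂ fun D =>
    Submodule.mapQ _ _ (Finsupp.lmapDomain ℂ ℂ D.comp) <| by
      rw [relSub, Submodule.span_le]
      exact fun x hx => Submodule.subset_span (DRel.comp_right hx D)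

theorem compFree_mk (x : BrauerDiagram L₁ L₂ →₀ ℂ) (D : BrauerDiagram L₂ L₃) :
    compFree ε L₁ L₂ L₃ x (UpHom.mk ε D) =
      Submodule.Quotient.mk (Finsupp.lmapDomain ℂ ℂ (fun E => E.comp D) x) := by
  induction x using Finsupp.induction_linear with
  | zero => simp
  | add f g hf hg => rw [map_add, LinearMap.add_apply, hf, hg, map_add]; rfl
  | single E c =>
    simp only [compFree, Finsupp.linearCombination_single, LinearMap.smul_apply, UpHom.mk,
      Submodule.mapQ_apply, Finsupp.lmapDomain_apply, Finsupp.mapDomain_single]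
    rw [← Submodule.Quotient.mk_smul, Finsupp.smul_single, smul_eq_mul, mul_one]

theorem UpHom.hom_ext {V : Type} [AddCommGroup V] [Module ℂ V] {f g : UpHom ε L₁ L₂ →ₗ[ℂ] V}
    (h : ∀ D, f (UpHom.mk ε D) = g (UpHom.mk ε D)) : f = g := by
  apply Submodule.linearMap_qext
  apply Finsupp.lhom_ext'
  intro D
  ext
  exact h D

/-- Composition as a bilinear map. -/
def UpHom.comp (ε : ℤˣ) (L₁ L₂ L₃ : Type) [Fintype L₁] [Fintype L₂] [Fintype L₃] :
    UpHom ε L₁ L₂ →ₗ[ℂ] UpHom ε L₂ L₃ →ₗ[ℂ] UpHom ε L₁ L₃ :=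
  Submodule.liftQ _ (compFree ε L₁ L₂ L₃) <| by
    rw [relSub, Submodule.span_le]
    intro x hx
    rw [SetLike.mem_coe, LinearMap.mem_ker]
    apply UpHom.hom_ext
    intro D
    rw [compFree_mk, LinearMap.zero_apply, Submodule.Quotient.mk_eq_zero]
    exact Submodule.subset_span (DRel.comp_left hx D)

@[simp] theorem UpHom.comp_mk (D : BrauerDiagram L₁ L₂) (D' : BrauerDiagram L₂ L₃) :
    UpHom.comp ε L₁ L₂ L₃ (UpHom.mk ε D) (UpHom.mk ε D') = UpHom.mk ε (D.comp D') := by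
  refine (compFree_mk _ _).trans ?_
  simp [UpHom.mk]

theorem UpHom.id_comp (f : UpHom ε L₁ L₂) :
    UpHom.comp ε L₁ L₁ L₂ (UpHom.mk ε (.refl L₁)) f = f := by
  suffices h : UpHom.comp ε L₁ L₁ L₂ (UpHom.mk ε (.refl L₁)) = LinearMap.id from
    LinearMap.congr_fun h f
  exact UpHom.hom_ext fun D => by simp [BrauerDiagram.refl_comp]

theorem UpHom.comp_id (f : UpHom ε L₁ L₂) :
    UpHom.comp ε L₁ L₂ L₂ f (UpHom.mk ε (.refl L₂)) = f := by
  suffices h : (UpHom.comp ε L₁ L₂ L₂).flip (UpHom.mk ε (.refl L₂)) = LinearMap.id from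
    LinearMap.congr_fun h f
  exact UpHom.hom_ext fun D => by simp [BrauerDiagram.comp_refl]

theorem UpHom.assoc (f : UpHom ε L₁ L₂) (g : UpHom ε L₂ L₃) (h : UpHom ε L₃ L₄) :
    UpHom.comp ε L₁ L₃ L₄ (UpHom.comp ε L₁ L₂ L₃ f g) h =
      UpHom.comp ε L₁ L₂ L₄ f (UpHom.comp ε L₂ L₃ L₄ g h) := by
  suffices key : (UpHom.comp ε L₁ L₂ L₃).compr₂ (UpHom.comp ε L₁ L₃ L₄) =
      ((LinearMap.llcomp ℂ (UpHom ε L₃ L₄) (UpHom ε L₂ L₄) (UpHom ε L₁ L₄)).flip ∘ₗ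
        UpHom.comp ε L₂ L₃ L₄).flip ∘ₗ UpHom.comp ε L₁ L₂ L₄ from
    LinearMap.congr_fun (LinearMap.congr_fun (LinearMap.congr_fun key f) g) h
  refine UpHom.hom_ext fun D => UpHom.hom_ext fun D' => UpHom.hom_ext fun D'' => ?_
  simp [BrauerDiagram.comp_assoc]

end comp

/-- The upwards spin category (`ε = 1`), respectively the upwards oscillator category (`ε = -1`).
Its objects are the finite sets. -/
structure UpCat (ε : ℤˣ) where
  carrier : Type
  [fintype : Fintype carrier]

attribute [instance] UpCat.fintype

instance UpCat.category (ε : ℤˣ) : Category.{0} (UpCat ε) where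
  Hom X Y := UpHom ε X.carrier Y.carrier
  id X := UpHom.mk ε (.refl X.carrier)
  comp f g := UpHom.comp ε _ _ _ f g
  id_comp := UpHom.id_comp
  comp_id := UpHom.comp_id
  assoc := UpHom.assoc

instance UpCat.preadditive (ε : ℤˣ) : Preadditive (UpCat ε) where
  homGroup X Y := inferInstanceAs (AddCommGroup (UpHom ε X.carrier Y.carrier))
  add_comp X Y Z f g h := LinearMap.map_add₂ (UpHom.comp ε X.carrier Y.carrier Z.carrier) f g h
  comp_add X Y Z f g h := (UpHom.comp ε X.carrier Y.carrier Z.carrier f).map_add g h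

instance UpCat.linear (ε : ℤˣ) : Linear ℂ (UpCat ε) where
  homModule X Y := inferInstanceAs (Module ℂ (UpHom ε X.carrier Y.carrier))
  smul_comp X Y Z c f g := LinearMap.map_smul₂ (UpHom.comp ε X.carrier Y.carrier Z.carrier) c f g
  comp_smul X Y Z f c g := (UpHom.comp ε X.carrier Y.carrier Z.carrier f).map_smul c g

/-- The morphism given by a diagram. -/
def UpCat.diagram {ε : ℤˣ} {X Y : UpCat ε} (D : BrauerDiagram X.carrier Y.carrier) : X ⟶ Y :=
  UpHom.mk ε D

/-- The category of representations of the upwards category: `ℂ`-linear functors to vector spaces. -/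
abbrev UpMod (ε : ℤˣ) : Type 1 :=
  ObjectProperty.FullSubcategory fun F : UpCat ε ⥤ ModuleCat.{0} ℂ => F.Additive ∧ F.Linear ℂ


/-! ### The standard representation and the Fock spaces -/

/-- The basis of the standard representation `𝐕 = W ⊕ W_* ⊕ ℂe`, with `W = ℂ^∞`: the basis `w i` of `W`,
the dual basis `ws i` of the restricted dual `W_*`, and the vector `e`. -/
inductive VB : Type
  | w (i : ℕ)
  | ws (i : ℕ)
  | e

/-- The parity sign `(-1)^{|x|}`: for `ε = 1` everything is even, for `ε = -1` the vector `e` is even and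
`W ⊕ W_*` is odd. -/
def par (ε : ℤˣ) : VB → ℂ
  | .e => 1
  | _ => sg ε

/-- The Koszul sign `(-1)^{|x||y|}`. -/
def koszul (ε : ℤˣ) : VB → VB → ℂ
  | .e, _ => 1
  | _, .e => 1
  | _, _ => sg ε

/-- The (super)symmetric form on `𝐕`: `ω(φ, v) = φ(v)`, `ω(v, φ) = ε φ(v)`, `ω(e, e) = 1`. -/
def form (ε : ℤˣ) : VB → VB → ℂ
  | .w i, .ws j => if i = j then sg ε else 0
  | .ws i, .w j => if i = j then 1 else 0
  | .e, .e => 1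
  | _, _ => 0

theorem koszul_mul_self (ε : ℤˣ) (x y : VB) : koszul ε x y * koszul ε x y = 1 := by
  cases x <;> cases y <;> simp [koszul, sg_mul_self]

theorem koszul_comm (ε : ℤˣ) (x y : VB) : koszul ε y x = koszul ε x y := by
  cases x <;> cases y <;> rfl

theorem form_symm (ε : ℤˣ) (x y : VB) : form ε y x = koszul ε x y * form ε x y := by
  cases x <;> cases y <;> simp [koszul, form, sg_mul_self, eq_comm]

/-- A super vector space with an even action `t` of `𝐕` that satisfies the Clifford relation
`t_x t_y + (-1)^{|x||y|} t_y t_x = ω(x, y)`; `parity` is the operator `(-1)^{|m|}`. The two instances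
that are used are `spinFock` and `oscFock` below. -/
structure FockModule (ε : ℤˣ) where
  carrier : Type
  [addCommGroup : AddCommGroup carrier]
  [module : Module ℂ carrier]
  t : VB → Module.End ℂ carrier
  parity : Module.End ℂ carrier
  clifford : ∀ x y, t x * t y + koszul ε x y • (t y * t x) = form ε x y • 1
  parity_t : ∀ x, parity * t x = par ε x • (t x * parity)

attribute [instance] FockModule.addCommGroup FockModule.module

/-- The number `1/√2`. -/
def rtHalf : ℂ := ((Real.sqrt 2 : ℝ) : ℂ)⁻¹

theorem rtHalf_mul : rtHalf * rtHalf + rtHalf * rtHalf = 1 := by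
  have h : ((Real.sqrt 2 : ℝ) : ℂ) * ((Real.sqrt 2 : ℝ) : ℂ) = 2 := by
    rw [← Complex.ofReal_mul, Real.mul_self_sqrt (by norm_num)]; norm_num
  rw [rtHalf, ← mul_inv, h]; norm_num

/-- The operator `X_v`, `v = e_i`, on `⋀ W`: multiplication by `v`. -/
def spinX (i : ℕ) : Module.End ℂ (ExteriorAlgebra ℂ Cinf) :=
  LinearMap.mulLeft ℂ (ExteriorAlgebra.ι ℂ (bas i))

/-- The operator `Y_φ`, `φ = e_i^*`, on `⋀ W`: contraction with `φ`. -/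
def spinY (i : ℕ) : Module.End ℂ (ExteriorAlgebra ℂ Cinf) :=
  CliffordAlgebra.contractLeft (bas.coord i)

/-- The operator `D` on `⋀ W`: multiplication by `(-1)^n` in degree `n`. -/
def spinD : Module.End ℂ (ExteriorAlgebra ℂ Cinf) :=
  (CliffordAlgebra.involute (Q := (0 : QuadraticForm ℂ Cinf))).toLinearMap

theorem spinX_spinX (i j : ℕ) : spinX i * spinX j + spinX j * spinX i = 0 := by
  refine LinearMap.ext fun m => ?_
  change ExteriorAlgebra.ι ℂ (bas i) * (ExteriorAlgebra.ι ℂ (bas j) * m) +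
    ExteriorAlgebra.ι ℂ (bas j) * (ExteriorAlgebra.ι ℂ (bas i) * m) = 0
  rw [← mul_assoc, ← mul_assoc, ← add_mul, ExteriorAlgebra.ι_add_mul_swap, zero_mul]

theorem spinY_spinY (i j : ℕ) : spinY i * spinY j + spinY j * spinY i = 0 :=
  LinearMap.ext fun m => by
    change CliffordAlgebra.contractLeft (bas.coord i) (CliffordAlgebra.contractLeft (bas.coord j) m)
      + CliffordAlgebra.contractLeft (bas.coord j) (CliffordAlgebra.contractLeft (bas.coord i) m)
      = 0
    rw [CliffordAlgebra.contractLeft_comm, neg_add_cancel]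

theorem spinX_spinY (i j : ℕ) :
    spinX i * spinY j + spinY j * spinX i = (if i = j then (1 : ℂ) else 0) • 1 :=
  LinearMap.ext fun m => by
    change ExteriorAlgebra.ι ℂ (bas i) * CliffordAlgebra.contractLeft (bas.coord j) m +
      CliffordAlgebra.contractLeft (bas.coord j) (CliffordAlgebra.ι 0 (bas i) * m) =
      (if i = j then (1 : ℂ) else 0) • m
    rw [CliffordAlgebra.contractLeft_ι_mul, Module.Basis.coord_apply, Module.Basis.repr_self,
      Finsupp.single_apply]
    exact add_sub_cancel _ _

theorem spinD_spinX (i : ℕ) : spinD * spinX i = -(spinX i * spinD) :=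
  LinearMap.ext fun m => by
    change CliffordAlgebra.involute (CliffordAlgebra.ι 0 (bas i) * m) =
      -(CliffordAlgebra.ι 0 (bas i) * CliffordAlgebra.involute m)
    rw [map_mul, CliffordAlgebra.involute_ι, neg_mul]

theorem spinD_spinY (i : ℕ) : spinD * spinY i = -(spinY i * spinD) :=
  LinearMap.ext fun m => by
    change CliffordAlgebra.involute (CliffordAlgebra.contractLeft (bas.coord i) m) =
      -(CliffordAlgebra.contractLeft (bas.coord i) (CliffordAlgebra.involute m))
    induction m using CliffordAlgebra.left_induction with
    | algebraMap r => simp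
    | add x y hx hy => simp only [map_add, hx, hy, neg_add]
    | ι_mul x v hx =>
      simp only [CliffordAlgebra.contractLeft_ι_mul, map_mul, map_sub, map_smul, map_neg,
        CliffordAlgebra.involute_ι, hx, neg_mul, mul_neg]
      abel

theorem spinD_spinD : spinD * spinD = 1 :=
  LinearMap.ext fun m => CliffordAlgebra.involute_involute m

/-- The map `𝐕 ⊗ Δ → Δ`. -/
def spinT : VB → Module.End ℂ (ExteriorAlgebra ℂ Cinf)
  | .w i => spinX i
  | .ws i => spinY i
  | .e => rtHalf • spinD

/-- The spinor representation `Δ = ⋀ W`, purely even, with `v ↦ X_v`, `φ ↦ Y_φ`, `e ↦ D/√2`. -/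
def spinFock : FockModule 1 where
  carrier := ExteriorAlgebra ℂ Cinf
  t := spinT
  parity := 1
  clifford := by
    have h1 : sg 1 = 1 := by simp [sg]
    intro x y
    cases x with
    | w i =>
      cases y with
      | w j => simpa [spinT, koszul, form, h1] using spinX_spinX i j
      | ws j => simpa [spinT, koszul, form, h1] using spinX_spinY i j
      | e => simp [spinT, koszul, form, spinD_spinX]
    | ws i =>
      cases y with
      | w j => simpa [spinT, koszul, form, h1, add_comm, eq_comm] using spinX_spinY j i
      | ws j => simpa [spinT, koszul, form, h1] using spinY_spinY i j
      | e => simp [spinT, koszul, form, spinD_spinY]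
    | e =>
      cases y with
      | w j => simp [spinT, koszul, form, spinD_spinX]
      | ws j => simp [spinT, koszul, form, spinD_spinY]
      | e => simp [spinT, koszul, form, spinD_spinD, smul_smul, ← add_smul, rtHalf_mul]
  parity_t := by
    intro x
    cases x <;> simp [par, sg]

/-- The symmetric algebra `∇ = Sym W`, as the polynomial ring on the basis of `W`. -/
def OscSpace : Type := MvPolynomial ℕ ℂ

instance OscSpace.addCommGroup : AddCommGroup OscSpace := inferInstanceAs (AddCommGroup (MvPolynomial ℕ ℂ))
instance OscSpace.module : Module ℂ OscSpace := inferInstanceAs (Module ℂ (MvPolynomial ℕ ℂ))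

/-- The operator `X_v`, `v = e_i`, on `Sym W`: multiplication by `v`. -/
def oscX (i : ℕ) : Module.End ℂ OscSpace :=
  LinearMap.mulLeft ℂ (MvPolynomial.X i : MvPolynomial ℕ ℂ)

/-- The operator `Y_φ`, `φ = e_i^*`, on `Sym W`: the derivative along `φ`. -/
def oscY (i : ℕ) : Module.End ℂ OscSpace :=
  (MvPolynomial.pderiv i : Derivation ℂ (MvPolynomial ℕ ℂ) (MvPolynomial ℕ ℂ)).toLinearMap

/-- Multiplication by `(-1)^n` in degree `n`, as an algebra homomorphism. -/
def oscSign : MvPolynomial ℕ ℂ →ₐ[ℂ] MvPolynomial ℕ ℂ :=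
  MvPolynomial.aeval fun i => -MvPolynomial.X i

/-- The operator `D` on `Sym W`: multiplication by `(-1)^n` in degree `n`. -/
def oscD : Module.End ℂ OscSpace := oscSign.toLinearMap

@[simp] theorem oscSign_X (i : ℕ) : oscSign (MvPolynomial.X i) = -MvPolynomial.X i :=
  MvPolynomial.aeval_X _ i

theorem oscX_oscX (i j : ℕ) : oscX i * oscX j = oscX j * oscX i :=
  LinearMap.ext fun m : MvPolynomial ℕ ℂ =>
    mul_left_comm (MvPolynomial.X i) (MvPolynomial.X j) m

theorem pderiv_X_mul (i j : ℕ) (m : MvPolynomial ℕ ℂ) :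
    MvPolynomial.pderiv i (MvPolynomial.X j * m) =
      MvPolynomial.X j * MvPolynomial.pderiv i m + (if i = j then (1 : ℂ) else 0) • m := by
  rw [Derivation.leibniz, MvPolynomial.pderiv_X]
  by_cases h : i = j
  · subst h; simp
  · simp [h, Ne.symm h]

theorem oscY_oscX (i j : ℕ) :
    oscY i * oscX j = oscX j * oscY i + (if i = j then (1 : ℂ) else 0) • 1 :=
  LinearMap.ext fun m => pderiv_X_mul i j m

theorem pderiv_pderiv (i j : ℕ) (m : MvPolynomial ℕ ℂ) :
    MvPolynomial.pderiv i (MvPolynomial.pderiv j m) =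
      MvPolynomial.pderiv j (MvPolynomial.pderiv i m) := by
  induction m using MvPolynomial.induction_on with
  | C a => simp
  | add p q hp hq => simp [hp, hq]
  | mul_X p n hp =>
    rw [mul_comm, pderiv_X_mul, pderiv_X_mul, map_add, map_add, pderiv_X_mul, pderiv_X_mul, hp]
    simp only [Derivation.map_smul]
    abel

theorem oscY_oscY (i j : ℕ) : oscY i * oscY j = oscY j * oscY i :=
  LinearMap.ext fun m => pderiv_pderiv i j m

theorem oscD_oscX (i : ℕ) : oscD * oscX i = -(oscX i * oscD) :=
  LinearMap.ext fun m : MvPolynomial ℕ ℂ => by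
    have h : oscSign (MvPolynomial.X i * m) = -(MvPolynomial.X i * oscSign m) := by
      rw [map_mul, oscSign_X, neg_mul]
    exact h

theorem oscSign_pderiv (i : ℕ) (m : MvPolynomial ℕ ℂ) :
    oscSign (MvPolynomial.pderiv i m) = -MvPolynomial.pderiv i (oscSign m) := by
  induction m using MvPolynomial.induction_on with
  | C a => simp [MvPolynomial.algHom_C]
  | add p q hp hq => simp only [map_add, hp, hq, neg_add]
  | mul_X p n hp =>
    rw [mul_comm, pderiv_X_mul, map_add, map_mul, map_mul, map_smul, hp, oscSign_X, neg_mul,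
      neg_mul, map_neg, pderiv_X_mul]
    simp only [mul_neg, neg_neg, neg_add]

theorem oscD_oscY (i : ℕ) : oscD * oscY i = -(oscY i * oscD) :=
  LinearMap.ext fun m => oscSign_pderiv i m

theorem oscSign_oscSign (m : MvPolynomial ℕ ℂ) : oscSign (oscSign m) = m := by
  have h : oscSign.comp oscSign = AlgHom.id ℂ _ := by
    apply MvPolynomial.algHom_ext
    simp
  exact DFunLike.congr_fun h m

theorem oscD_oscD : oscD * oscD = 1 := LinearMap.ext fun m => oscSign_oscSign m

/-- The map `𝐕 ⊗ ∇ → ∇`. -/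
def oscT : VB → Module.End ℂ OscSpace
  | .w i => oscX i
  | .ws i => oscY i
  | .e => rtHalf • oscD

/-- The oscillator representation `∇ = Sym W`, with the parity given by the degree, and with
`v ↦ X_v`, `φ ↦ Y_φ`, `e ↦ D/√2`. -/
def oscFock : FockModule (-1) where
  carrier := OscSpace
  t := oscT
  parity := oscD
  clifford := by
    have h1 : sg (-1) = -1 := by simp [sg]
    intro x y
    cases x with
    | w i =>
      cases y with
      | w j => simp [oscT, koszul, form, h1, oscX_oscX i j]
      | ws j =>
        simp only [oscT, koszul, form, h1, oscY_oscX, eq_comm (a := j)]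
        split_ifs <;> simp
      | e => simp [oscT, koszul, form, oscD_oscX]
    | ws i =>
      cases y with
      | w j => simp [oscT, koszul, form, h1, oscY_oscX]
      | ws j => simp [oscT, koszul, form, h1, oscY_oscY i j]
      | e => simp [oscT, koszul, form, oscD_oscY]
    | e =>
      cases y with
      | w j => simp [oscT, koszul, form, oscD_oscX]
      | ws j => simp [oscT, koszul, form, oscD_oscY]
      | e => simp [oscT, koszul, form, oscD_oscD, smul_smul, ← add_smul, rtHalf_mul]
  parity_t := by
    have h1 : sg (-1) = -1 := by simp [sg]
    intro x
    cases x <;> simp [par, h1, oscT, oscD_oscX, oscD_oscY]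
/-! ### The kernel -/

section kernel

variable {ε : ℤˣ} (F : FockModule ε)

/-- The space `𝐕^{⊗ L} ⊗ Δ` (respectively `𝐕^{⊗ L} ⊗ ∇`): `Finsupp.single c m` is the tensor
`(⨂_{i ∈ L} c_i) ⊗ m`, the factors being taken in the order of `enum L`. -/
abbrev Ker (L : Type) : Type := (L → VB) →₀ F.carrier

open Classical in
/-- The sign by which the tensor product of the `c_i` in the order `l` differs from that in the order
`l'`: switching two adjacent factors `x, y` multiplies by `ε (-1)^{|x||y|}`. In the spinor case the
sign is 1. In the oscillator case the symmetry is the negative of the usual one of super vector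
spaces; this is what the relations of the oscillator category require. -/
def reorderSign (ε : ℤˣ) {L : Type} [Fintype L] (c : L → VB) (l l' : List L) : ℂ :=
  ∏ p : L × L with l.idxOf p.1 < l.idxOf p.2 ∧ l'.idxOf p.2 < l'.idxOf p.1,
    sg ε * koszul ε (c p.1) (c p.2)

/-- An auxiliary enumeration of a finite set, used to write down tensor products over that set. -/
def enum (L : Type) [Fintype L] : List L := (Finset.univ : Finset L).toList

/-- The order into which the tensor factors are brought by a diagram: first the factors in the range of
`inj`, then the pairs `x_j ⊗ x_i` for the edges from `i` to `j`, then the factors in `U`, the first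
element of `U` being next to the factor `Δ`. -/
def BrauerDiagram.word {L' L : Type} [Fintype L'] [Fintype L] (D : BrauerDiagram L' L) : List L :=
  (enum L').map D.inj ++ (D.edges.toList.flatMap fun p => [p.2, p.1]) ++ D.circ.reverse

/-- The map `𝐕^{⊗ L} ⊗ Δ → 𝐕^{⊗ L'} ⊗ Δ` given by a diagram between `L` and `L'`: the map
`𝐕 ⊗ Δ → Δ` is applied to the factors indexed by `U` in order, the form is applied to the factors
indexed by the edges, and the remaining factors are relabelled by the bijection. -/
def kerMap {L' L : Type} [Fintype L'] [Fintype L] (D : BrauerDiagram L' L) :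
    Ker F L →ₗ[ℂ] Ker F L' :=
  Finsupp.lsum ℂ fun c : L → VB =>
    (reorderSign ε c (enum L) D.word * (D.edges.map fun p => form ε (c p.2) (c p.1)).prod) •
      (Finsupp.lsingle (c ∘ D.inj) ∘ₗ (D.circ.map fun i => F.t (c i)).reverse.prod)

/-- The Lie (super)algebra `𝔤 = ⋀²(𝐕)` in the super sense, the quotient of `𝐕 ⊗ 𝐕` by the elements
`x ⊗ y + (-1)^{|x||y|} y ⊗ x`. It is `𝔰𝔬(2∞+1)` for `ε = 1` and `𝔬𝔰𝔭(1|2∞)` for `ε = -1`. -/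
def Lie2 (ε : ℤˣ) : Type :=
  (VB × VB →₀ ℂ) ⧸ Submodule.span ℂ (Set.range fun p : VB × VB =>
    (Finsupp.single p 1 + koszul ε p.1 p.2 • Finsupp.single p.swap 1 : VB × VB →₀ ℂ))

instance Lie2.addCommGroup (ε : ℤˣ) : AddCommGroup (Lie2 ε) := inferInstanceAs (AddCommGroup (_ ⧸ _))
instance Lie2.module (ε : ℤˣ) : Module ℂ (Lie2 ε) := inferInstanceAs (Module ℂ (_ ⧸ _))

open Classical in
/-- The action of `x ∧ y ∈ 𝔤` on `𝐕^{⊗ L} ⊗ Δ`. On `𝐕` it is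
`u ↦ ω(y, u) x - (-1)^{|x||y|} ω(x, u) y`, on `Δ` it is `t_x t_y - ω(x, y)/2`, and on the tensor
product it is given by the (super) Leibniz rule. -/
def wedgeOp {L : Type} [Fintype L] (x y : VB) : Module.End ℂ (Ker F L) :=
  Finsupp.lsum ℂ fun c : L → VB =>
    ∑ i : L, (∏ j : L with (enum L).idxOf j < (enum L).idxOf i,
        koszul ε x (c j) * koszul ε y (c j)) •
      (form ε y (c i) • Finsupp.lsingle (Function.update c i x) -
        (koszul ε x y * form ε x (c i)) • Finsupp.lsingle (Function.update c i y)) +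
    (∏ j : L, koszul ε x (c j) * koszul ε y (c j)) •
      (Finsupp.lsingle c ∘ₗ (F.t x * F.t y - (form ε x y / 2) • 1))

theorem fock_swap (x y : VB) :
    (F.t x * F.t y - (form ε x y / 2) • 1) +
      koszul ε x y • (F.t y * F.t x - (form ε y x / 2) • (1 : Module.End ℂ F.carrier)) = 0 := by
  have h := F.clifford x y
  have h2 : koszul ε x y * (form ε y x / 2) = form ε x y / 2 := by
    rw [form_symm ε x y, ← mul_div_assoc, ← mul_assoc, koszul_mul_self, one_mul]
  rw [smul_sub, smul_smul, h2, sub_add_sub_comm, h, ← add_smul, add_halves, sub_self]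

theorem wedgeOp_swap {L : Type} [Fintype L] (x y : VB) :
    wedgeOp F (L := L) x y + koszul ε x y • wedgeOp F (L := L) y x = 0 := by
  classical
  apply Finsupp.lhom_ext'
  intro c
  refine LinearMap.ext fun m => ?_
  have h1 : ∀ i, (koszul ε y (c i) * koszul ε x (c i)) = koszul ε x (c i) * koszul ε y (c i) :=
    fun i => mul_comm _ _
  have h2 := LinearMap.congr_fun (fock_swap F x y) m
  simp only [LinearMap.add_apply, LinearMap.smul_apply, LinearMap.sub_apply,
    LinearMap.zero_apply] at h2
  simp only [wedgeOp, LinearMap.comp_apply, LinearMap.add_apply, LinearMap.smul_apply,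
    Finsupp.lsingle_apply, Finsupp.lsum_single, LinearMap.sum_apply, LinearMap.sub_apply, h1,
    koszul_comm ε x y, LinearMap.zero_apply, smul_add, Finset.smul_sum]
  rw [add_add_add_comm, ← Finset.sum_add_distrib, smul_comm (koszul ε x y), ← smul_add,
    Finsupp.smul_single, ← Finsupp.single_add, h2, Finsupp.single_zero, smul_zero, add_zero]
  refine Finset.sum_eq_zero fun i _ => ?_
  rw [smul_comm (koszul ε x y), ← smul_add, smul_sub, smul_smul, smul_smul, ← mul_assoc,
    koszul_mul_self, one_mul]
  simp

/-- The action of `𝔤` on `𝐕^{⊗ L} ⊗ Δ`. -/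
def lieOp (L : Type) [Fintype L] : Lie2 ε →ₗ[ℂ] Module.End ℂ (Ker F L) :=
  Submodule.liftQ _ (Finsupp.linearCombination ℂ fun p : VB × VB => wedgeOp F p.1 p.2) <| by
    rw [Submodule.span_le]
    rintro _ ⟨p, rfl⟩
    simpa using wedgeOp_swap F p.1 p.2

/-- The operator `(-1)^{|m|}` on `𝐕^{⊗ L} ⊗ Δ`. -/
def parityOp (L : Type) [Fintype L] : Module.End ℂ (Ker F L) :=
  Finsupp.lsum ℂ fun c : L → VB => (∏ i, par ε (c i)) • (Finsupp.lsingle c ∘ₗ F.parity)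

/-- The irreducible representation `M_μ` of the symmetric group, the left ideal of the group algebra
generated by the Young symmetrizer. -/
abbrev Specht (μ : YoungDiagram) : Ideal (MonoidAlgebra ℂ (Equiv.Perm (Cell μ))) :=
  Ideal.span {youngSym μ}

open Classical in
/-- The subspace `T^{[L]}` of `𝐕^{⊗ L} ⊗ Δ`, the intersection of the kernels of the maps `t_i`. -/
def primitive (L : Type) [Fintype L] : Submodule ℂ (Ker F L) :=
  ⨅ i : L, LinearMap.ker (kerMap F (BrauerDiagram.contract i))

/-- The representation `Δ_μ` (respectively `∇_μ`) of `𝔤`: the space `Hom_{S_n}(M_μ, T^{[n]})`, `n = |μ|`,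
with the action of `𝔤` on the values. -/
def simpleSpin (μ : YoungDiagram) : Submodule ℂ (Specht μ →ₗ[ℂ] Ker F (Cell μ)) where
  carrier := {φ | (∀ x, φ x ∈ primitive F (Cell μ)) ∧
    ∀ (σ : Equiv.Perm (Cell μ)) (x : Specht μ),
      φ (MonoidAlgebra.single σ (1 : ℂ) • x) = kerMap F (.ofEquiv σ) (φ x)}
  add_mem' := by
    rintro φ ψ ⟨h1, h2⟩ ⟨h1', h2'⟩
    exact ⟨fun x => Submodule.add_mem _ (h1 x) (h1' x), fun σ x => by simp [h2, h2']⟩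
  zero_mem' := ⟨fun x => Submodule.zero_mem _, fun σ x => by simp⟩
  smul_mem' := by
    rintro a φ ⟨h1, h2⟩
    exact ⟨fun x => Submodule.smul_mem _ a (h1 x), fun σ x => by simp [h2]⟩

/-- Families of linear maps from the dual of `N(L)` to `𝐕^{⊗ L} ⊗ Δ`, for all finite sets `L`. -/
def Families (N : UpMod ε) : Type 1 :=
  ∀ L : UpCat ε, Module.Dual ℂ (N.obj.obj L) →ₗ[ℂ] Ker F L.carrier

instance Families.addCommGroup (N : UpMod ε) : AddCommGroup (Families F N) := inferInstanceAs (AddCommGroup (∀ _, _))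
instance Families.module (N : UpMod ε) : Module ℂ (Families F N) := inferInstanceAs (Module ℂ (∀ _, _))

/-- The representation `N ⊗ 𝒦` of `𝔤` that is attached to a representation `N` of the upwards category by
the kernel `𝒦 : L ↦ 𝐕^{⊗ L} ⊗ Δ`. It is the space `Hom(N^∨, 𝒦)` of natural transformations of
functors on the downwards category, where `N^∨(L)` is the dual space of `N(L)`. -/
def specialize (N : UpMod ε) : Submodule ℂ (Families F N) where
  carrier := {φ | ∀ (L' L : UpCat ε) (D : BrauerDiagram L'.carrier L.carrier),
    kerMap F D ∘ₗ φ L = φ L' ∘ₗ (N.obj.map (UpCat.diagram D)).hom.dualMap}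
  add_mem' := by
    intro φ ψ h h' L' L D
    have := congrArg₂ (· + ·) (h L' L D) (h' L' L D)
    exact (LinearMap.comp_add _ _ _).trans (this.trans (LinearMap.add_comp _ _ _).symm)
  zero_mem' := fun L' L D => (LinearMap.comp_zero _).trans (LinearMap.zero_comp _).symm
  smul_mem' := by
    intro a φ h L' L D
    have := congrArg (a • ·) (h L' L D)
    exact (LinearMap.comp_smul _ _ _).trans (this.trans (LinearMap.smul_comp _ _ _).symm)

/-- Apply operators to the values of a family. -/
def Families.post {N : UpMod ε} (T : ∀ L : UpCat ε, Module.End ℂ (Ker F L.carrier))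
   (φ : Families F N) : Families F N := fun L => T L ∘ₗ φ L

/-- An isomorphism `N ⊗ 𝒦 ≅ Δ_μ` (respectively `∇_μ`) of representations of `𝔤`: a bijective linear map
that commutes with `𝔤` and with the parity (which is trivial in the spinor case). In particular both
spaces are stable under these operators. -/
structure SuperIso (N : UpMod ε) (μ : YoungDiagram) where
  toEquiv : specialize F N ≃ₗ[ℂ] simpleSpin F μ
  lie : ∀ (a : Lie2 ε) (φ : specialize F N),
    ∃ h : φ.1.post F (fun L => lieOp F L.carrier a) ∈ specialize F N,
      (toEquiv ⟨_, h⟩).1 = lieOp F (Cell μ) a ∘ₗ (toEquiv φ).1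
  parity : ∀ φ : specialize F N,
    ∃ h : φ.1.post F (fun L => parityOp F L.carrier) ∈ specialize F N,
      (toEquiv ⟨_, h⟩).1 = parityOp F (Cell μ) ∘ₗ (toEquiv φ).1

end kernel

end

end SpinOsc

open SpinOsc

/-!
For a finite set `L` and a `U(𝔞)`-module `M` let `E(M)(L)` be the space of `GL_∞`-equivariant maps `(ℂ^∞)^{⊗
L} → M`. A diagram `(U, Γ, f)` acts on such maps: `φ` goes to the map that sends `⨂ w_i` to the product of
the central elements `w_i w_j` (for the edges from `i` to `j`) and the odd elements `w_i` (for `i ∈ U`, in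
order), applied to the value of `φ` on the remaining tensor factors. The relations between diagrams are the
defining relations of `U(𝔞)`, so `E` is a functor to representations of the upwards category
(`multiplicityFunctor`). It is the equivalence of the theorem, uniformly in `ε`.

The polynomial representation theory that is needed is obtained by polarization, without any classification.
Interpolation and inclusion-exclusion show that the operators `∑_σ ⨂_a (v ↦ ⟨e_{j (σ a)}^*, v⟩ w_{σ a})` on
tensor powers agree, on tensors of bounded degree in boundedly many basis vectors, with elements of the
group algebra of `GL_∞` (`exists_groupAlgebra_polarization`). Every tensor is a combination of its images
under these operators, and the image of a fixed tensor depends linearly and equivariantly on `⨂ w_k`. Hence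
a polynomial representation is spanned by the images of the equivariant maps from tensor powers
(`IsPolynomial.span_eq_top`), and `E` is full and faithful. A quasi-inverse is the coend `⨁_n N([n]) ⊗_{S_n}
(ℂ^∞)^{⊗ n}`, on which `ℂ^∞` acts by insertion of a tensor factor (`coendMod`); polarization identifies its
equivariant maps from `(ℂ^∞)^{⊗ L}` with `N(L)` (`coendUnit_bijective`). Linear functors to vector spaces
are closed under subobjects, quotients and finite products among all functors, so they form an abelian
category, and this is transported to `U(𝔞)`-modules along `E`.

Equivariant endomorphisms of `(ℂ^∞)^{⊗ n}` come from the group algebra of `S_n`, and there are no nonzero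
equivariant maps between different tensor powers. Together with the two basic properties of the Young
symmetrizer `c`, that `c x c` is always a multiple of `c` and that `c²` is a nonzero multiple of `c`, this
shows that `S_μ` is simple (`simpleU_simple`) and, by the trace form of the group algebra, that the dual of
`E(S_μ)(L)` is `M_μ` for `|L| = |μ|` (`spechtDual`); it vanishes for other `L`. A natural transformation
`E(S_μ)^∨ → 𝒦` is therefore an `S_n`-equivariant map from `M_μ` to `𝒦([n])` whose values are killed by all
diagrams that are not bijections. By the Clifford relation (`kerMap_cutEdge`) it suffices that the values
are killed by all `t_i`, that is, lie in `T^{[n]}` (`kerMap_eq_zero_of_mem_primitive`). This gives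
`superIso`. The operators of `𝔤` preserve these conditions, because they commute with relabellings and with
the maps `t_i` (`kerMap_lieOp`).
-/

open CategoryTheory TensorProduct

namespace SpinOsc

noncomputable section

/-! ### Interpolation -/

/-- The coefficient of `X ^ k` of a polynomial of degree at most `D` is a linear combination of its values at
`1, …, D + 1`. The value at `0` is avoided, because the elements of `GL_∞` below are only invertible for `t ≠ 0`. -/
theorem exists_coeff_extraction (D k : ℕ) :
    ∃ a : ℕ → ℂ, ∀ l ≤ D,
      ∑ s ∈ Finset.range (D + 1), a s * ((s : ℂ) + 1) ^ l = if l = k then 1 else 0 := by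
  refine ⟨fun s => (Lagrange.basis (Finset.range (D + 1)) (fun s : ℕ => (s : ℂ) + 1) s).coeff k,
    fun l hl => ?_⟩
  have hinj : Set.InjOn (fun s : ℕ => (s : ℂ) + 1) (Finset.range (D + 1)) := by
    intro a _ b _ h
    simpa using h
  have h := Lagrange.eq_interpolate hinj (f := (Polynomial.X ^ l : Polynomial ℂ)) (by
    rw [Polynomial.degree_X_pow, Finset.card_range]
    exact_mod_cast Nat.lt_succ_of_le hl)
  have h2 := congrArg (fun p => Polynomial.coeff p k) h
  simp only [Polynomial.coeff_X_pow, Lagrange.interpolate_apply, Polynomial.finsetSum_coeff,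
    Polynomial.coeff_C_mul, Polynomial.eval_pow, Polynomial.eval_X] at h2
  rw [show (if l = k then (1 : ℂ) else 0) = if k = l then 1 else 0 by simp [eq_comm], h2]
  exact Finset.sum_congr rfl fun s _ => mul_comm _ _

/-! ### Enough elements of `GL_∞` -/

theorem bas_coord_bas (i j : ℕ) : bas.coord i (bas j) = if j = i then 1 else 0 := by
  rw [Module.Basis.coord_apply, Module.Basis.repr_self, Finsupp.single_apply]

theorem mem_GLinf_of_block {h : Cinf ≃ₗ[ℂ] Cinf} (K : ℕ) (h1 : ∀ i ≥ K, h (bas i) = bas i)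
    (h2 : ∀ j < K, ∀ i ≥ K, bas.coord i (h (bas j)) = 0) : h ∈ GLinf := by
  refine ⟨K, h1, fun v i hi => ?_⟩
  suffices H : bas.coord i ∘ₗ h.toLinearMap = bas.coord i from LinearMap.congr_fun H v
  refine bas.ext fun j => ?_
  by_cases hj : j < K
  · rw [LinearMap.comp_apply]
    refine (h2 j hj i hi).trans ?_
    rw [bas_coord_bas, if_neg (by omega)]
  · rw [LinearMap.comp_apply]
    exact congrArg _ (h1 j (by omega))

/-- The map that sends `e_k` to `t e_k + G (k - n)` for `n ≤ k < n + m` and fixes the other basis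
vectors. -/
def shearMap (m n : ℕ) (t : ℂ) (G : ℕ → Cinf) : Cinf →ₗ[ℂ] Cinf :=
  bas.constr ℂ fun k => if n ≤ k ∧ k < n + m then t • bas k + G (k - n) else bas k

theorem shearMap_bas (m n : ℕ) (t : ℂ) (G : ℕ → Cinf) (k : ℕ) :
    shearMap m n t G (bas k) = if n ≤ k ∧ k < n + m then t • bas k + G (k - n) else bas k :=
  bas.constr_basis ℂ _ k

/-- The span of `e_0, …, e_{n-1}`. -/
def lowSpan (n : ℕ) : Submodule ℂ Cinf := Submodule.span ℂ (bas '' Set.Iio n)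

theorem shearMap_low (m n : ℕ) (t : ℂ) (G : ℕ → Cinf) {v : Cinf} (hv : v ∈ lowSpan n) :
    shearMap m n t G v = v := by
  induction hv using Submodule.span_induction with
  | mem x hx =>
    obtain ⟨i, hi, rfl⟩ := hx
    rw [shearMap_bas, if_neg]
    simp only [Set.mem_Iio] at hi
    omega
  | zero => simp
  | add x y _ _ hx hy => rw [map_add, hx, hy]
  | smul a x _ hx => rw [map_smul, hx]

theorem shearMap_comp (m n : ℕ) (t s : ℂ) (hts : t * s = 1) (G : ℕ → Cinf)
    (hG : ∀ i < m, G i ∈ lowSpan n) :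
    shearMap m n t G ∘ₗ shearMap m n s (fun i => -s • G i) = LinearMap.id := by
  refine bas.ext fun k => ?_
  rw [LinearMap.comp_apply, shearMap_bas]
  split_ifs with h
  · rw [map_add, map_smul, shearMap_bas, if_pos h, map_smul, shearMap_low _ _ _ _ (hG _ (by omega)),
      smul_add, smul_smul, mul_comm, hts]
    simp
  · rw [shearMap_bas, if_neg h]; rfl

/-- `shearMap` as an automorphism. -/
def shearEquiv (m n : ℕ) (t : ℂ) (ht : t ≠ 0) (G : ℕ → Cinf) (hG : ∀ i < m, G i ∈ lowSpan n) :
    Cinf ≃ₗ[ℂ] Cinf :=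
  LinearEquiv.ofLinearMap (shearMap m n t G) (shearMap m n t⁻¹ (fun i => -t⁻¹ • G i))
    (shearMap_comp m n t t⁻¹ (mul_inv_cancel₀ ht) G hG) (by
      have := shearMap_comp m n t⁻¹ t (inv_mul_cancel₀ ht) (fun i => -t⁻¹ • G i)
        (fun i hi => Submodule.smul_mem _ _ (hG i hi))
      simpa [smul_smul, ht] using this)

theorem lowSpan_coord {n : ℕ} {v : Cinf} (hv : v ∈ lowSpan n) {i : ℕ} (hi : n ≤ i) :
    bas.coord i v = 0 := by
  induction hv using Submodule.span_induction with
  | mem x hx =>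
    obtain ⟨j, hj, rfl⟩ := hx
    simp only [Set.mem_Iio] at hj
    rw [bas_coord_bas, if_neg (by omega)]
  | zero => simp
  | add x y _ _ hx hy => rw [map_add, hx, hy, add_zero]
  | smul a x _ hx => rw [map_smul, hx, smul_zero]

theorem exists_lowSpan (v : Cinf) : ∃ n, v ∈ lowSpan n := by
  have hmono : ∀ {a b : ℕ}, a ≤ b → lowSpan a ≤ lowSpan b := fun h =>
    Submodule.span_mono (Set.image_mono (Set.Iio_subset_Iio h))
  have hv : v ∈ Submodule.span ℂ (Set.range bas) := bas.mem_span v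
  induction hv using Submodule.span_induction with
  | mem x hx =>
    obtain ⟨i, rfl⟩ := hx
    exact ⟨i + 1, Submodule.subset_span ⟨i, Nat.lt_succ_self i, rfl⟩⟩
  | zero => exact ⟨0, Submodule.zero_mem _⟩
  | add x y _ _ hx hy =>
    obtain ⟨a, ha⟩ := hx
    obtain ⟨b, hb⟩ := hy
    exact ⟨max a b, Submodule.add_mem _ (hmono (le_max_left _ _) ha) (hmono (le_max_right _ _) hb)⟩
  | smul c x _ hx => exact hx.imp fun a ha => Submodule.smul_mem _ c ha

/-- The involution of `ℕ` that exchanges `i` and `i + n` for `i < m`. -/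
def blockSwap (m n : ℕ) (h : m ≤ n) : Equiv.Perm ℕ :=
  Function.Involutive.toPerm
    (fun i => if i < m then i + n else if n ≤ i ∧ i < n + m then i - n else i) (by
      intro i
      dsimp only
      split_ifs <;> omega)

/-- On `e_0, …, e_{m-1}` every linear map `G` has perturbations `G + t u`, with `u` fixed and `t ≠ 0`
arbitrary, that are restrictions of elements of `GL_∞`. -/
theorem exists_GLinf_perturbation (m : ℕ) (G : ℕ → Cinf) :
    ∃ u : ℕ → Cinf, ∀ t : ℂ, t ≠ 0 → ∃ h : GLinf, ∀ i < m, h.1 (bas i) = t • u i + G i := by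
  obtain ⟨n, hmn, hn⟩ : ∃ n, m ≤ n ∧ ∀ i < m, G i ∈ lowSpan n := by
    choose k hk using fun i => exists_lowSpan (G i)
    refine ⟨m + ∑ i ∈ Finset.range m, k i, Nat.le_add_right _ _, fun i hi => ?_⟩
    have h1 : k i ≤ ∑ i ∈ Finset.range m, k i :=
      Finset.single_le_sum (f := k) (fun _ _ => Nat.zero_le _) (Finset.mem_range.2 hi)
    exact Submodule.span_mono (Set.image_mono (Set.Iio_subset_Iio (by omega))) (hk i)
  -- The blocks `e_0, …, e_{m-1}` and `e_n, …, e_{n+m-1}` are exchanged, and then `e_{i+n}` goes to `t e_{i+n} + G i`.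
  -- The latter map is invertible, because the values of `G` lie in the span of `e_0, …, e_{n-1}`, which it fixes.
  refine ⟨fun i => bas (i + n), fun t ht => ?_⟩
  have hs : ∀ i, blockSwap m n hmn i =
      if i < m then i + n else if n ≤ i ∧ i < n + m then i - n else i := fun i => rfl
  have he : ∀ k, shearEquiv m n t ht G hn (bas k) =
      if n ≤ k ∧ k < n + m then t • bas k + G (k - n) else bas k := shearMap_bas m n t G
  have h1 : shearEquiv m n t ht G hn ∈ GLinf := by
    refine mem_GLinf_of_block (n + m) (fun i hi => ?_) (fun j hj i hi => ?_)
    · rw [he, if_neg (by omega)]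
    · rw [he]
      split_ifs with h
      · rw [map_add, map_smul, bas_coord_bas, if_neg (by omega),
          lowSpan_coord (hn (j - n) (by omega)) (by omega)]
        simp
      · rw [bas_coord_bas, if_neg (by omega)]
  have h2 : bas.equiv bas (blockSwap m n hmn) ∈ GLinf := by
    refine mem_GLinf_of_block (n + m) (fun i hi => ?_) (fun j hj i hi => ?_)
    · rw [Module.Basis.equiv_apply, hs, if_neg (by omega), if_neg (by omega)]
    · rw [Module.Basis.equiv_apply, hs, bas_coord_bas, if_neg]
      split_ifs <;> omega
  refine ⟨⟨_, h1⟩ * ⟨_, h2⟩, fun i hi => ?_⟩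
  change shearEquiv m n t ht G hn (bas.equiv bas (blockSwap m n hmn) (bas i)) = _
  rw [Module.Basis.equiv_apply, hs, if_pos hi, he, if_pos (by omega), Nat.add_sub_cancel]

/-! ### The group algebra of `GL_∞` on tensor powers -/

/-- The basis vector `⨂ e_{f a}` of a tensor power of `ℂ^∞`. -/
abbrev tbas {ι : Type} (f : ι → ℕ) : ⨂[ℂ] _ : ι, Cinf :=
  PiTensorProduct.tprod ℂ fun a => bas (f a)

/-- On tensors of bounded degree in boundedly many basis vectors every linear map `G : ℂ^∞ → ℂ^∞` acts like
an element of the group algebra of `GL_∞`. -/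
theorem exists_groupAlgebra_map (D m : ℕ) (G : ℕ → Cinf) :
    ∃ θ : MonoidAlgebra ℂ GLinf, ∀ (ι : Type) [Fintype ι], Fintype.card ι ≤ D →
      ∀ f : ι → ℕ, (∀ a, f a < m) → (tensorRep ι).asAlgebraHom θ (tbas f) =
        PiTensorProduct.tprod ℂ fun a => G (f a) := by
  classical
  -- The action of `G + t u` is a polynomial in `t` with constant term the action of `G`.
  obtain ⟨u, hu⟩ := exists_GLinf_perturbation m G
  obtain ⟨a, ha⟩ := exists_coeff_extraction D 0
  have hne : ∀ s : ℕ, ((s : ℂ) + 1) ≠ 0 := fun s => by exact_mod_cast Nat.succ_ne_zero s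
  choose h hh using fun s : ℕ => hu ((s : ℂ) + 1) (hne s)
  refine ⟨∑ s ∈ Finset.range (D + 1), MonoidAlgebra.single (h s) (a s), fun ι _ hι f hf => ?_⟩
  have key : ∀ s : ℕ, tensorRep ι (h s) (tbas f) = ∑ S : Finset ι, ((s : ℂ) + 1) ^ S.card •
      PiTensorProduct.tprod ℂ (S.piecewise (fun a => u (f a)) (fun a => G (f a))) := by
    intro s
    rw [tensorRep_tprod]
    have : (fun i => (h s).1 (bas (f i))) =
        (fun i => ((s : ℂ) + 1) • u (f i)) + fun i => G (f i) := by
      ext1 i; exact hh s _ (hf i)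
    rw [this, MultilinearMap.map_add_univ]
    refine Finset.sum_congr rfl fun S _ => ?_
    rw [← Finset.prod_const, ← MultilinearMap.map_piecewise_smul]
    congr 1
    ext1 i
    by_cases hi : i ∈ S <;> simp [hi]
  rw [map_sum, LinearMap.sum_apply]
  simp only [Representation.asAlgebraHom_single, LinearMap.smul_apply, key, Finset.smul_sum,
    smul_smul]
  rw [Finset.sum_comm]
  simp only [← Finset.sum_smul]
  rw [Finset.sum_eq_single ∅]
  · rw [ha _ (by simp), if_pos (by simp), one_smul, Finset.piecewise_empty]
  · intro S _ hS
    rw [ha _ ((Finset.card_le_univ S).trans hι), if_neg (by simpa using hS), zero_smul]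
  · simp

/-- The homogeneous component of degree `d` is extracted by interpolation between the multiples of `G`. -/
theorem exists_groupAlgebra_map_of_degree (D m d : ℕ) (G : ℕ → Cinf) :
    ∃ θ : MonoidAlgebra ℂ GLinf, ∀ (ι : Type) [Fintype ι], Fintype.card ι ≤ D →
      ∀ f : ι → ℕ, (∀ a, f a < m) → (tensorRep ι).asAlgebraHom θ (tbas f) =
        if Fintype.card ι = d then PiTensorProduct.tprod ℂ fun a => G (f a) else 0 := by
  obtain ⟨a, ha⟩ := exists_coeff_extraction D d
  choose θ hθ using fun s : ℕ => exists_groupAlgebra_map D m fun i => ((s : ℂ) + 1) • G i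
  refine ⟨∑ s ∈ Finset.range (D + 1), a s • θ s, fun ι _ hι f hf => ?_⟩
  rw [map_sum, LinearMap.sum_apply]
  have : ∀ s : ℕ, (tensorRep ι).asAlgebraHom (a s • θ s) (tbas f) =
      (a s * ((s : ℂ) + 1) ^ Fintype.card ι) • PiTensorProduct.tprod ℂ fun a => G (f a) := by
    intro s
    rw [map_smul, LinearMap.smul_apply, hθ s ι hι f hf,
      MultilinearMap.map_smul_univ _ (fun _ => (s : ℂ) + 1), smul_smul]
    simp
  rw [Finset.sum_congr rfl fun s _ => this s, ← Finset.sum_smul, ha _ hι]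
  split_ifs <;> simp

/-- The polarization identity behind the theory of polynomial representations: the sum over all
bijections `σ : ι ≃ J` of the tensor products of the rank one maps `v ↦ ⟨e_{j (σ a)}^*, v⟩ w (σ a)` is
realized by an element of the group algebra of `GL_∞`, uniformly in `ι`. -/
theorem exists_groupAlgebra_polarization (D m : ℕ) (J : Type) [Fintype J] [DecidableEq J]
    (j : J → ℕ) (w : J → Cinf) :
    ∃ θ : MonoidAlgebra ℂ GLinf, ∀ (ι : Type) [Fintype ι] [DecidableEq ι], Fintype.card ι ≤ D →
      ∀ f : ι → ℕ, (∀ a, f a < m) → (tensorRep ι).asAlgebraHom θ (tbas f) =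
        ∑ σ : ι ≃ J, if f = j ∘ σ then PiTensorProduct.tprod ℂ fun a => w (σ a) else 0 := by
  -- The sum over all bijections is obtained from the sum over all maps `r : ι → J` by inclusion-exclusion over
  -- the set `S` of elements that the range of `r` avoids.
  choose θ hθ using fun S : Finset J => exists_groupAlgebra_map_of_degree D m (Fintype.card J)
    fun i => ∑ k ∈ Sᶜ, if i = j k then w k else 0
  refine ⟨∑ S : Finset J, ((-1 : ℤ) ^ S.card : ℂ) • θ S, fun ι _ _ hι f hf => ?_⟩
  simp only [map_sum, LinearMap.sum_apply, map_smul, LinearMap.smul_apply, hθ _ ι hι f hf]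
  by_cases hc : Fintype.card ι = Fintype.card J
  swap
  · have : IsEmpty (ι ≃ J) := ⟨fun σ => hc (Fintype.card_congr σ)⟩
    simp [hc]
  simp only [if_pos hc]
  let T : (ι → J) → ⨂[ℂ] _ : ι, Cinf := fun r =>
    PiTensorProduct.tprod ℂ fun a => if f a = j (r a) then w (r a) else 0
  have h1 : ∀ S : Finset J, (PiTensorProduct.tprod ℂ fun a => ∑ k ∈ Sᶜ,
      if f a = j k then w k else 0) =
      ∑ r : ι → J, if S ⊆ (Finset.univ.image r)ᶜ then T r else 0 := by
    intro S
    rw [MultilinearMap.map_sum_finset, ← Finset.sum_filter]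
    refine Finset.sum_congr ?_ fun _ _ => rfl
    ext r
    simp only [Fintype.mem_piFinset, Finset.mem_filter, Finset.mem_univ, true_and,
      Finset.subset_iff, Finset.mem_compl, Finset.mem_image, not_exists]
    exact ⟨fun h x hx a ha => h a (ha ▸ hx), fun h a ha => h ha a rfl⟩
  simp only [h1, Finset.smul_sum, smul_ite, smul_zero]
  rw [Finset.sum_comm]
  have h2 : ∀ r : ι → J, (∑ S : Finset J, if S ⊆ (Finset.univ.image r)ᶜ then
      ((-1 : ℤ) ^ S.card : ℂ) • T r else 0) = if Function.Bijective r then T r else 0 := by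
    intro r
    rw [← Finset.sum_filter]
    have : (Finset.univ.filter fun S : Finset J => S ⊆ (Finset.univ.image r)ᶜ) =
        ((Finset.univ.image r)ᶜ).powerset := by
      ext S; simp
    rw [this, ← Finset.sum_smul]
    have h3 := congrArg (Int.cast (R := ℂ))
      (Finset.sum_powerset_neg_one_pow_card (x := (Finset.univ.image r)ᶜ))
    push_cast at h3 ⊢
    rw [h3, ite_smul, one_smul, zero_smul]
    refine if_congr ?_ rfl rfl
    rw [Finset.compl_eq_empty_iff, Fintype.bijective_iff_surjective_and_card, Finset.eq_univ_iff_forall]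
    simp [Function.Surjective, hc]
  rw [Finset.sum_congr rfl fun r _ => h2 r, ← Finset.sum_filter]
  refine (Finset.sum_bij (fun (σ : ι ≃ J) _ => (σ : ι → J)) ?_ ?_ ?_ ?_).symm
  · intro σ _
    simp
  · intro σ _ τ _ h
    exact DFunLike.coe_injective h
  · intro r hr
    exact ⟨Equiv.ofBijective r (by simpa using hr), Finset.mem_univ _, rfl⟩
  · intro σ _
    split_ifs with h
    · subst h
      simp [T]
    · obtain ⟨a, ha⟩ := Function.ne_iff.1 h
      exact (MultilinearMap.map_coord_zero _ a (if_neg ha)).symm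

/-! ### Polarization operators -/

/-- The coordinate of a tensor at the basis vector `tbas f`. -/
def tcoord {ι : Type} [Finite ι] (f : ι → ℕ) : (⨂[ℂ] _ : ι, Cinf) →ₗ[ℂ] ℂ :=
  (Basis.piTensorProduct fun _ : ι => bas).coord f

theorem tcoord_tbas {ι : Type} [Finite ι] (f g : ι → ℕ) [Decidable (g = f)] :
    tcoord f (tbas g) = if g = f then 1 else 0 := by
  have : tbas g = (Basis.piTensorProduct fun _ : ι => bas) g :=
    (Basis.piTensorProduct_apply (fun _ : ι => bas) g).symm
  rw [tcoord, this, Module.Basis.coord_apply, Module.Basis.repr_self, Finsupp.single_apply]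

theorem tensor_ext {ι : Type} [Finite ι] {V : Type*} [AddCommGroup V] [Module ℂ V]
    {f g : (⨂[ℂ] _ : ι, Cinf) →ₗ[ℂ] V} (h : ∀ p : ι → ℕ, f (tbas p) = g (tbas p)) : f = g :=
  (Basis.piTensorProduct fun _ : ι => bas).ext fun p => by
    rw [Basis.piTensorProduct_apply]; exact h p

/-- Relabelling of the factors of a tensor along a bijection. -/
abbrev relabel {ι κ : Type} (e : ι ≃ κ) : (⨂[ℂ] _ : ι, Cinf) ≃ₗ[ℂ] ⨂[ℂ] _ : κ, Cinf :=
  PiTensorProduct.reindex ℂ (fun _ : ι => Cinf) e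

theorem relabel_tprod {ι κ : Type} (e : ι ≃ κ) (w : ι → Cinf) :
    relabel e (PiTensorProduct.tprod ℂ w) = PiTensorProduct.tprod ℂ fun k => w (e.symm k) :=
  PiTensorProduct.reindex_tprod e w

theorem relabel_tensorRep {ι κ : Type} (e : ι ≃ κ) (g : GLinf) (x : ⨂[ℂ] _ : ι, Cinf) :
    relabel e (tensorRep ι g x) = tensorRep κ g (relabel e x) :=
  (PiTensorProduct.map_reindex (fun _ => (g.1 : Cinf →ₗ[ℂ] Cinf)) e x).symm

/-- The operator `∑_σ ⨂_a (v ↦ ⟨e_{j (σ a)}^*, v⟩ w_{σ a})` on a tensor power indexed by `ι`, where `σ` runs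
over the bijections `ι ≃ J`, as a linear function of the tensor `w` indexed by `J`. -/
def polOp {ι J : Type} [Fintype ι] [Fintype J] [DecidableEq ι] [DecidableEq J] (j : J → ℕ) :
    (⨂[ℂ] _ : ι, Cinf) →ₗ[ℂ] (⨂[ℂ] _ : J, Cinf) →ₗ[ℂ] ⨂[ℂ] _ : ι, Cinf :=
  ∑ σ : ι ≃ J, (tcoord (j ∘ σ)).smulRight (relabel σ.symm).toLinearMap

theorem polOp_apply {ι J : Type} [Fintype ι] [Fintype J] [DecidableEq ι] [DecidableEq J]
    (j : J → ℕ) (x : ⨂[ℂ] _ : ι, Cinf) (w : ⨂[ℂ] _ : J, Cinf) :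
    polOp j x w = ∑ σ : ι ≃ J, tcoord (j ∘ σ) x • relabel σ.symm w := by
  simp [polOp, LinearMap.sum_apply]

theorem polOp_tensorRep {ι J : Type} [Fintype ι] [Fintype J] [DecidableEq ι] [DecidableEq J]
    (j : J → ℕ) (x : ⨂[ℂ] _ : ι, Cinf) (w : ⨂[ℂ] _ : J, Cinf) (g : GLinf) :
    polOp j x (tensorRep J g w) = tensorRep ι g (polOp j x w) := by
  simp only [polOp_apply, map_sum, map_smul, relabel_tensorRep]

theorem polOp_tbas_tprod {ι J : Type} [Fintype ι] [Fintype J] [DecidableEq ι] [DecidableEq J]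
    (j : J → ℕ) (f : ι → ℕ) (w : J → Cinf) :
    polOp j (tbas f) (PiTensorProduct.tprod ℂ w) =
      ∑ σ : ι ≃ J, if f = j ∘ σ then PiTensorProduct.tprod ℂ fun a => w (σ a) else 0 := by
  rw [polOp_apply]
  refine Finset.sum_congr rfl fun σ _ => ?_
  rw [tcoord_tbas, relabel_tprod]
  split_ifs <;> simp

/-- If `j` is injective, then the polarization operator maps `tbas j` to an arbitrary tensor. -/
theorem polOp_tbas_self {J : Type} [Fintype J] [DecidableEq J]
    (j : J → ℕ) (hj : Function.Injective j) (w : ⨂[ℂ] _ : J, Cinf) :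
    polOp j (tbas j) w = w := by
  rw [polOp_apply, Finset.sum_eq_single 1]
  · rw [tcoord_tbas, if_pos (by ext; simp), one_smul]
    exact LinearEquiv.congr_fun (PiTensorProduct.reindex_refl (R := ℂ) (s := fun _ : J => Cinf)) w
  · intro σ _ hσ
    rw [tcoord_tbas, if_neg, zero_smul]
    intro h
    apply hσ
    ext a
    exact (hj (congrFun h a)).symm
  · simp

/-- The polarization operators recover each basis tensor of degree `n`, up to the factor `n!`. -/
theorem sum_polOp_tbas {ι : Type} [Fintype ι] [DecidableEq ι] (m n : ℕ) (f : ι → ℕ)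
    (hf : ∀ a, f a < m) :
    ∑ j : Fin n → Fin m, polOp (fun k => (j k : ℕ)) (tbas f) (tbas fun k => (j k : ℕ)) =
      if Fintype.card ι = n then (n.factorial : ℂ) • tbas f else 0 := by
  have h1 : ∀ j : Fin n → Fin m,
      polOp (fun k => (j k : ℕ)) (tbas f) (tbas fun k => (j k : ℕ)) =
      ∑ σ : ι ≃ Fin n, if j = (fun k => (⟨f (σ.symm k), hf _⟩ : Fin m)) then tbas f else 0 := by
    intro j
    rw [polOp_tbas_tprod]
    refine Finset.sum_congr rfl fun σ _ => ?_
    have : (f = (fun k => (j k : ℕ)) ∘ σ) ↔ j = (fun k => (⟨f (σ.symm k), hf _⟩ : Fin m)) := by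
      constructor
      · rintro h
        ext k
        simp [congrFun h]
      · rintro rfl
        ext a
        simp
    by_cases h : f = (fun k => (j k : ℕ)) ∘ σ
    · rw [if_pos h, if_pos (this.1 h)]
      conv_rhs => rw [h]
      rfl
    · rw [if_neg h, if_neg (mt this.2 h)]
  rw [Finset.sum_congr rfl fun j _ => h1 j, Finset.sum_comm]
  simp only [Finset.sum_ite_eq', Finset.mem_univ, if_true, Finset.sum_const, Finset.card_univ]
  split_ifs with h
  · rw [Fintype.card_equiv (Fintype.equivFinOfCardEq h), h, Nat.cast_smul_eq_nsmul]
  · have : IsEmpty (ι ≃ Fin n) := ⟨fun σ => h (by simpa using Fintype.card_congr σ)⟩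
    simp

/-! ### Direct sums of tensor powers -/

section DirectSum

variable {I : Type} (d : I → ℕ)

/-- A direct sum of tensor powers of `ℂ^∞`. -/
abbrev TSum : Type := Π₀ i : I, ⨂[ℂ] _ : Fin (d i), Cinf

/-- The representation of `GL_∞` on a direct sum of tensor powers. -/
def tsumRep : Representation ℂ GLinf (TSum d) where
  toFun g := DFinsupp.mapRange.linearMap fun i => tensorRep (Fin (d i)) g
  map_one' := by
    ext x; simp
  map_mul' g h := by
    ext x; simp

variable {d}

theorem tsumRep_single [DecidableEq I] (g : GLinf) (i : I) (x : ⨂[ℂ] _ : Fin (d i), Cinf) :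
    tsumRep d g (DFinsupp.single i x) = DFinsupp.single i (tensorRep _ g x) :=
  DFinsupp.mapRange_single (hf := fun _ => map_zero _)

theorem tsum_ext [DecidableEq I] {V : Type*} [AddCommGroup V] [Module ℂ V]
    {f g : TSum d →ₗ[ℂ] V}
    (h : ∀ i (p : Fin (d i) → ℕ), f (DFinsupp.single i (tbas p)) = g (DFinsupp.single i (tbas p))) :
    f = g :=
  DFinsupp.lhom_ext' fun i => tensor_ext (h i)

open Classical in
/-- The polarization operators on a direct sum of tensor powers. -/
def polD {J : Type} [Fintype J] (j : J → ℕ) :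
    TSum d →ₗ[ℂ] (⨂[ℂ] _ : J, Cinf) →ₗ[ℂ] TSum d :=
  DFinsupp.lsum ℂ fun i => (polOp j).compr₂
    (DFinsupp.lsingle (R := ℂ) (M := fun i => ⨂[ℂ] _ : Fin (d i), Cinf) i)

theorem polD_single {J : Type} [Fintype J] [hI : DecidableEq I] [hJ : DecidableEq J]
    (j : J → ℕ) (i : I)
    (x : ⨂[ℂ] _ : Fin (d i), Cinf) (w : ⨂[ℂ] _ : J, Cinf) :
    polD j (DFinsupp.single i x : TSum d) w = DFinsupp.single i (polOp j x w) := by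
  rw [Subsingleton.elim hI (Classical.decEq I),
    Subsingleton.elim hJ (Classical.decEq J), polD, DFinsupp.lsum_single]
  rfl

theorem polD_tsumRep {J : Type} [Fintype J] (j : J → ℕ) (x : TSum d) (w : ⨂[ℂ] _ : J, Cinf)
    (g : GLinf) : polD j x (tensorRep J g w) = tsumRep d g (polD j x w) := by
  classical
  suffices h : (polD j).flip (tensorRep J g w) = tsumRep d g ∘ₗ (polD j).flip w from
    LinearMap.congr_fun h x
  refine tsum_ext fun i p => ?_
  simp only [LinearMap.flip_apply, LinearMap.comp_apply]
  rw [polD_single, polD_single, polOp_tensorRep, tsumRep_single]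

open Classical in
/-- The tensors of degree at most `D` in the basis vectors `e_0, …, e_{m-1}`. -/
def bounded (d : I → ℕ) (D m : ℕ) : Submodule ℂ (TSum d) :=
  Submodule.span ℂ {x | ∃ (i : I) (f : Fin (d i) → ℕ), d i ≤ D ∧ (∀ a, f a < m) ∧
    x = DFinsupp.single i (tbas f)}

theorem bounded_mono {D D' m m' : ℕ} (h1 : D ≤ D') (h2 : m ≤ m') :
    bounded d D m ≤ bounded d D' m' := by
  refine Submodule.span_mono ?_
  rintro _ ⟨i, f, h, hf, rfl⟩
  exact ⟨i, f, h.trans h1, fun a => (hf a).trans_le h2, rfl⟩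

theorem exists_bounded (x : TSum d) : ∃ D m, x ∈ bounded d D m := by
  classical
  have hadd : ∀ x y : TSum d, (∃ D m, x ∈ bounded d D m) → (∃ D m, y ∈ bounded d D m) →
      ∃ D m, x + y ∈ bounded d D m := by
    rintro x y ⟨D, m, h⟩ ⟨D', m', h'⟩
    exact ⟨max D D', max m m', Submodule.add_mem _
      (bounded_mono (le_max_left _ _) (le_max_left _ _) h)
      (bounded_mono (le_max_right _ _) (le_max_right _ _) h')⟩
  induction x using DFinsupp.induction with
  | h0 => exact ⟨0, 0, Submodule.zero_mem _⟩
  | ha i b f h0 h1 hf =>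
    clear h0 h1
    refine hadd _ _ ?_ hf
    have hb := (Basis.piTensorProduct fun _ : Fin (d i) => bas).mem_span b
    induction hb using Submodule.span_induction with
    | mem x hx =>
      obtain ⟨p, rfl⟩ := hx
      refine ⟨d i, ∑ a, (p a + 1), Submodule.subset_span ⟨i, p, le_rfl, fun a => ?_, ?_⟩⟩
      · exact Nat.lt_of_succ_le (Finset.single_le_sum (f := fun a => p a + 1)
          (fun _ _ => Nat.zero_le _) (Finset.mem_univ a))
      · rw [Basis.piTensorProduct_apply]
    | zero => exact ⟨0, 0, by simp⟩
    | add x y _ _ hx hy => rw [DFinsupp.single_add]; exact hadd _ _ hx hy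
    | smul c x _ hx =>
      obtain ⟨D, m, h⟩ := hx
      exact ⟨D, m, by rw [DFinsupp.single_smul]; exact Submodule.smul_mem _ _ h⟩

theorem asAlgebraHom_tsumRep_single [DecidableEq I] (θ : MonoidAlgebra ℂ GLinf) (i : I)
    (x : ⨂[ℂ] _ : Fin (d i), Cinf) :
    (tsumRep d).asAlgebraHom θ (DFinsupp.single i x) =
      DFinsupp.single i ((tensorRep _).asAlgebraHom θ x) := by
  induction θ using MonoidAlgebra.induction_linear with
  | zero => simp
  | add f g hf hg => simp only [map_add, LinearMap.add_apply, hf, hg, DFinsupp.single_add]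
  | single g c =>
    simp only [Representation.asAlgebraHom_single, LinearMap.smul_apply, tsumRep_single,
      DFinsupp.single_smul]

/-- On tensors of bounded degree in boundedly many basis vectors, the polarization operators agree with elements of the
group algebra of `GL_∞`. -/
theorem exists_groupAlgebra_polD {J : Type} [Fintype J] [DecidableEq J] (j : J → ℕ) (w : J → Cinf)
    (D m : ℕ) :
    ∃ θ : MonoidAlgebra ℂ GLinf,
      (∀ (ι : Type) [Fintype ι] [DecidableEq ι] (f : ι → ℕ), Fintype.card ι ≤ D → (∀ a, f a < m) →
        (tensorRep ι).asAlgebraHom θ (tbas f) = polOp j (tbas f) (PiTensorProduct.tprod ℂ w)) ∧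
      ∀ (I : Type) (d : I → ℕ) (x : TSum d), x ∈ bounded d D m →
        (tsumRep d).asAlgebraHom θ x = polD j x (PiTensorProduct.tprod ℂ w) := by
  classical
  obtain ⟨θ, hθ⟩ := exists_groupAlgebra_polarization D m J j w
  refine ⟨θ, fun ι _ _ f hc hf => ?_, fun I d x hx => ?_⟩
  · rw [hθ ι hc f hf, polOp_tbas_tprod]
  induction hx using Submodule.span_induction with
  | mem x hx =>
    obtain ⟨i, f, h, hf, rfl⟩ := hx
    rw [asAlgebraHom_tsumRep_single, polD_single, hθ _ (by simpa using h) f hf, polOp_tbas_tprod]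
  | zero => simp
  | add x y _ _ hx hy => simp only [map_add, hx, hy, LinearMap.add_apply]
  | smul c x _ hx => simp only [map_smul, hx, LinearMap.smul_apply]

theorem asAlgebraHom_mem {V : Type} [AddCommGroup V] [Module ℂ V] (ρ : Representation ℂ GLinf V)
    (N : Submodule ℂ V) (hN : ∀ g, ∀ x ∈ N, ρ g x ∈ N) (θ : MonoidAlgebra ℂ GLinf) {x : V}
    (hx : x ∈ N) : ρ.asAlgebraHom θ x ∈ N := by
  induction θ using MonoidAlgebra.induction_linear with
  | zero => simp
  | add f g hf hg => rw [map_add, LinearMap.add_apply]; exact N.add_mem hf hg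
  | single g c =>
    rw [Representation.asAlgebraHom_single]
    exact N.smul_mem _ (hN g x hx)

theorem asAlgebraHom_equivariant {V V' : Type} [AddCommGroup V] [Module ℂ V] [AddCommGroup V']
    [Module ℂ V'] (ρ : Representation ℂ GLinf V) (ρ' : Representation ℂ GLinf V')
    (f : V →ₗ[ℂ] V') (hf : ∀ g x, f (ρ g x) = ρ' g (f x)) (θ : MonoidAlgebra ℂ GLinf) (x : V) :
    f (ρ.asAlgebraHom θ x) = ρ'.asAlgebraHom θ (f x) := by
  induction θ using MonoidAlgebra.induction_linear with
  | zero => simp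
  | add a b ha hb => simp only [map_add, LinearMap.add_apply, ha, hb]
  | single g c => simp only [Representation.asAlgebraHom_single, LinearMap.smul_apply, map_smul, hf]

/-- Subrepresentations of direct sums of tensor powers are stable under polarization. -/
theorem polD_mem (N : Submodule ℂ (TSum d)) (hN : ∀ g, ∀ x ∈ N, tsumRep d g x ∈ N) {J : Type}
    [Fintype J] (j : J → ℕ) {x : TSum d} (hx : x ∈ N) (w : ⨂[ℂ] _ : J, Cinf) :
    polD j x w ∈ N := by
  classical
  obtain ⟨D, m, hb⟩ := exists_bounded x
  induction w using PiTensorProduct.induction_on with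
  | smul_tprod r w =>
    obtain ⟨θ, -, hθ⟩ := exists_groupAlgebra_polD j w D m
    rw [map_smul, ← hθ I d x hb]
    exact N.smul_mem _ (asAlgebraHom_mem _ N hN θ hx)
  | add w w' h h' => rw [map_add]; exact N.add_mem h h'

/-- The combination of polarization operators that is the identity on tensors of degree at most `D` in the
basis vectors `e_0, …, e_{m-1}`. -/
def depolarize (d : I → ℕ) (D m : ℕ) : TSum d →ₗ[ℂ] TSum d :=
  ∑ n ∈ Finset.range (D + 1), (n.factorial : ℂ)⁻¹ • ∑ j : Fin n → Fin m,
    (polD fun k => (j k : ℕ)).flip (tbas fun k => (j k : ℕ))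

theorem sum_polD_single [DecidableEq I] (m n : ℕ) (i : I) (f : Fin (d i) → ℕ)
    (hf : ∀ a, f a < m) :
    ∑ j : Fin n → Fin m, polD (fun k => (j k : ℕ))
      (DFinsupp.single i (tbas f) : TSum d) (tbas fun k => (j k : ℕ)) =
      if d i = n then (n.factorial : ℂ) • (DFinsupp.single i (tbas f) : TSum d) else 0 := by
  have h := congrArg (DFinsupp.lsingle (R := ℂ) (M := fun i => ⨂[ℂ] _ : Fin (d i), Cinf) i)
    (sum_polOp_tbas m n f hf)
  rw [map_sum, Fintype.card_fin] at h
  refine Eq.trans (Finset.sum_congr rfl fun j _ => ?_) (h.trans ?_)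
  · exact polD_single (d := d) (fun k => (j k : ℕ)) i (tbas f) (tbas fun k => (j k : ℕ))
  · split_ifs
    · rw [map_smul]; rfl
    · rw [map_zero]

theorem depolarize_bounded (D m : ℕ) :
    Set.EqOn (depolarize d D m) (LinearMap.id : TSum d →ₗ[ℂ] TSum d)
      {x | ∃ (i : I) (f : Fin (d i) → ℕ), d i ≤ D ∧ (∀ a, f a < m) ∧
        x = by classical exact DFinsupp.single i (tbas f)} := by
  classical
  rintro _ ⟨i, f, h, hf, rfl⟩
  have h1 := fun n => sum_polD_single (d := d) m n i f hf
  simp only [depolarize, LinearMap.sum_apply, LinearMap.smul_apply, LinearMap.flip_apply]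
  rw [Finset.sum_eq_single (d i)]
  · have := h1 (d i)
    rw [if_pos rfl] at this
    rw [this, smul_smul, inv_mul_cancel₀, one_smul]
    · rfl
    · exact_mod_cast Nat.factorial_ne_zero _
  · intro n _ hn
    have := h1 n
    rw [if_neg (Ne.symm hn)] at this
    rw [this, smul_zero]
  · intro hn
    simp at hn
    omega

/-- Every element of a direct sum of tensor powers is a combination of its polarizations. -/
theorem mem_span_polD (x : TSum d) :
    x ∈ Submodule.span ℂ {y | ∃ (n : ℕ) (j : Fin n → ℕ) (w : ⨂[ℂ] _ : Fin n, Cinf),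
      y = polD j x w} := by
  obtain ⟨D, m, hb⟩ := exists_bounded x
  have key : depolarize d D m x = x :=
    LinearMap.eqOn_span (g := LinearMap.id) (depolarize_bounded D m) hb
  have h : depolarize d D m x ∈ Submodule.span ℂ {y | ∃ (n : ℕ) (j : Fin n → ℕ)
      (w : ⨂[ℂ] _ : Fin n, Cinf), y = polD j x w} := by
    simp only [depolarize, LinearMap.sum_apply, LinearMap.smul_apply]
    refine Submodule.sum_mem _ fun n _ => Submodule.smul_mem _ _ <| Submodule.sum_mem _ fun j _ => ?_
    exact Submodule.subset_span ⟨n, _, _, rfl⟩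
  rwa [key] at h

end DirectSum

/-! ### Polynomial representations -/

/-- The space of `GL_∞`-equivariant maps from a tensor power of `ℂ^∞` to `V`. -/
def tensorHoms (ι : Type) {V : Type} [AddCommGroup V] [Module ℂ V] (ρ : Representation ℂ GLinf V) :
    Submodule ℂ ((⨂[ℂ] _ : ι, Cinf) →ₗ[ℂ] V) where
  carrier := {φ | ∀ g x, φ (tensorRep ι g x) = ρ g (φ x)}
  add_mem' h h' g x := by simp [h g x, h' g x]
  zero_mem' g x := by simp
  smul_mem' c φ h g x := by simp [h g x]

/-- A polynomial representation is spanned by the images of the equivariant maps from tensor powers. -/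
theorem IsPolynomial.span_eq_top {V : Type} [AddCommGroup V] [Module ℂ V]
    {ρ : Representation ℂ GLinf V} (h : IsPolynomial ρ) :
    Submodule.span ℂ {v | ∃ (n : ℕ) (φ : tensorHoms (Fin n) ρ) (w : ⨂[ℂ] _ : Fin n, Cinf),
      v = φ.1 w} = ⊤ := by
  obtain ⟨I, d, N, hN, q, hq, hqg⟩ := h
  rw [eq_top_iff]
  intro v _
  obtain ⟨x, rfl⟩ := hq v
  let A : Submodule ℂ (TSum d) := (Submodule.comap q (Submodule.span ℂ
    {v | ∃ (n : ℕ) (φ : tensorHoms (Fin n) ρ) (w : ⨂[ℂ] _ : Fin n, Cinf), v = φ.1 w})).map N.subtype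
  have hA : Submodule.span ℂ {y | ∃ (n : ℕ) (j : Fin n → ℕ) (w : ⨂[ℂ] _ : Fin n, Cinf),
      y = polD j x.1 w} ≤ A := by
    rw [Submodule.span_le]
    rintro _ ⟨n, j, w, rfl⟩
    have hm : ∀ w, polD j x.1 w ∈ N := polD_mem N hN j x.2
    refine ⟨⟨_, hm w⟩, Submodule.subset_span
      ⟨n, ⟨q ∘ₗ LinearMap.codRestrict N (polD j x.1) hm, fun g y => ?_⟩, w, rfl⟩, rfl⟩
    refine Eq.trans ?_ (hqg g ⟨_, hm y⟩)
    exact congrArg q (Subtype.ext (polD_tsumRep j x.1 y g))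
  obtain ⟨y, hy, hyx⟩ := hA (mem_span_polD x.1)
  rwa [Subtype.ext hyx] at hy

/-- Subrepresentations of polynomial representations are polynomial. -/
theorem IsPolynomial.submodule {V V' : Type} [AddCommGroup V] [Module ℂ V] [AddCommGroup V']
    [Module ℂ V'] {ρ : Representation ℂ GLinf V} (h : IsPolynomial ρ)
    (ρ' : Representation ℂ GLinf V') (f : V' →ₗ[ℂ] V) (hf : Function.Injective f)
    (hfg : ∀ g x, f (ρ' g x) = ρ g (f x)) : IsPolynomial ρ' := by
  obtain ⟨I, d, N, hN, q, hq, hqg⟩ := h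
  have hr : ∀ x : ((LinearMap.range f).comap q).map N.subtype, ∃ hx : x.1 ∈ N,
      q ⟨x.1, hx⟩ ∈ LinearMap.range f := by
    rintro ⟨_, y, hy, rfl⟩
    exact ⟨y.2, hy⟩
  let e := LinearEquiv.ofInjective f hf
  let q1 : (((LinearMap.range f).comap q).map N.subtype) →ₗ[ℂ] LinearMap.range f :=
    LinearMap.codRestrict _ (q ∘ₗ Submodule.inclusion (Submodule.map_subtype_le _ _))
      fun x => (hr x).2
  refine ⟨I, d, ((LinearMap.range f).comap q).map N.subtype, ?_, e.symm.toLinearMap ∘ₗ q1, ?_, ?_⟩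
  · rintro g _ ⟨y, ⟨v, hv⟩, rfl⟩
    refine ⟨⟨_, hN g y.1 y.2⟩, ⟨ρ' g v, ?_⟩, rfl⟩
    rw [hfg, hqg, hv]
  · refine e.symm.surjective.comp ?_
    rintro ⟨_, v, rfl⟩
    obtain ⟨y, hy⟩ := hq (f v)
    exact ⟨⟨y.1, y, ⟨v, hy.symm⟩, rfl⟩, Subtype.ext hy⟩
  · intro g x
    apply hf
    rw [hfg]
    have h1 : ∀ z, f (e.symm z) = z.1 := fun z =>
      congrArg Subtype.val (e.apply_symm_apply z)
    refine (h1 _).trans (Eq.trans ?_ (congrArg (ρ g) (h1 _)).symm)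
    exact hqg g ⟨x.1, (hr x).1⟩

/-! ### The enveloping algebra -/

section UEnv

variable {ε : ℤˣ}

theorem bracket_uι (v w : Cinf) :
    uι ε (v, 0) * uι ε (w, 0) + sg ε • (uι ε (w, 0) * uι ε (v, 0)) = uι ε (0, sqMul ε v w) := by
  have := RingQuot.mkAlgHom_rel ℂ (URel.odd_odd (ε := ε) v w)
  simpa [bracket, uι_def] using this

theorem sq_induction {P : Submodule ℂ (Sq ε)} (h : ∀ v w, sqMul ε v w ∈ P) (f : Sq ε) : f ∈ P := by
  obtain ⟨x, rfl⟩ := Submodule.Quotient.mk_surjective _ f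
  induction x using TensorProduct.induction_on with
  | zero => exact P.zero_mem
  | tmul v w => exact h v w
  | add x y hx hy => exact P.add_mem hx hy

/-- The algebra `U(𝔞)` is generated by `ℂ^∞`. -/
theorem uenv_eq_top (S : Subalgebra ℂ (UEnv ε)) (h : ∀ v, uι ε (v, 0) ∈ S) (u : UEnv ε) : u ∈ S := by
  have hz : ∀ f, uι ε (0, f) ∈ S := fun f =>
    sq_induction (P := S.toSubmodule.comap (uι ε ∘ₗ LinearMap.inr ℂ Cinf (Sq ε))) (fun v w => by
      change uι ε (0, sqMul ε v w) ∈ S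
      rw [← bracket_uι]
      exact S.add_mem (S.mul_mem (h v) (h w)) (S.smul_mem (S.mul_mem (h w) (h v)) _)) f
  obtain ⟨x, rfl⟩ := RingQuot.mkAlgHom_surjective ℂ (URel ε) u
  induction x using TensorAlgebra.induction with
  | algebraMap r => rw [AlgHom.commutes]; exact S.algebraMap_mem r
  | ι x =>
    rw [uι_def, show x = (x.1, 0) + (0, x.2) by simp, map_add]
    exact S.add_mem (h _) (hz _)
  | mul a b ha hb => rw [map_mul]; exact S.mul_mem ha hb
  | add a b ha hb => rw [map_add]; exact S.add_mem ha hb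

theorem uι_even_mem_center (f : Sq ε) : uι ε (0, f) ∈ Subalgebra.center ℂ (UEnv ε) := by
  rw [Subalgebra.mem_center_iff]
  intro u
  have := uenv_eq_top (Subalgebra.centralizer ℂ {uι ε (0, f)}) (fun v => by
    rw [Subalgebra.mem_centralizer_iff]
    rintro _ rfl
    have := RingQuot.mkAlgHom_rel ℂ (URel.odd_even (ε := ε) v f)
    simp only [bracket, map_sub, map_mul, uι_def, map_zero, Prod.mk_zero_zero] at this
    exact (sub_eq_zero.1 this).symm) u
  rw [Subalgebra.mem_centralizer_iff] at this
  exact (this _ rfl).symm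

/-- The map from the second summand of `𝔞` to the center of `U(𝔞)`. -/
def evenι (ε : ℤˣ) : Sq ε →ₗ[ℂ] Subalgebra.center ℂ (UEnv ε) :=
  LinearMap.codRestrict (Subalgebra.center ℂ (UEnv ε)).toSubmodule
    (uι ε ∘ₗ LinearMap.inr ℂ Cinf (Sq ε)) uι_even_mem_center

theorem coe_evenι (f : Sq ε) : (evenι ε f : UEnv ε) = uι ε (0, f) := rfl

theorem uMap_uι (g : Cinf →ₗ[ℂ] Cinf) (x : TwLie ε) : uMap ε g (uι ε x) = uι ε (twMap ε g x) := by
  simp [uMap, ← uι_def]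

end UEnv

/-! ### Diagrams act on equivariant maps -/

namespace BrauerDiagram

variable {L₁ L₂ L₃ : Type} [Fintype L₁] [Fintype L₂] [Fintype L₃] (D : BrauerDiagram L₁ L₂)

theorem nodup_exhaust : ((Finset.univ : Finset L₁).val.map D.inj + (D.circ : Multiset L₂) +
    D.edges.bind fun p => {p.1, p.2}).Nodup := D.exhaust ▸ Finset.univ.nodup

theorem inj_injective : Function.Injective D.inj := by
  have h := D.nodup_exhaust
  rw [Multiset.nodup_add, Multiset.nodup_add] at h
  intro a b hab
  exact Multiset.inj_on_of_nodup_map h.1.1 a (Finset.mem_univ a) b (Finset.mem_univ b) hab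

/-- The element of `U(𝔞)` attached to a diagram and a family of vectors: the product of the central elements
`w_i w_j` for the edges from `i` to `j`, times the ordered product of the `w_i` for `i ∈ U`. -/
def elt (ε : ℤˣ) (w : L₂ → Cinf) : UEnv ε :=
  ((D.edges.map fun p => evenι ε (sqMul ε (w p.1) (w p.2))).prod : Subalgebra.center ℂ (UEnv ε)) *
    (D.circ.map fun i => uι ε (w i, 0)).prod

/-- In the composite the elements of `U` that come from `D'` precede those that come from `D`. -/
theorem elt_comp (D' : BrauerDiagram L₂ L₃) (ε : ℤˣ) (w : L₃ → Cinf) :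
    (D.comp D').elt ε w = D'.elt ε w * D.elt ε (w ∘ D'.inj) := by
  simp only [elt, comp, Multiset.map_add, Multiset.map_map, List.map_append, List.map_map,
    List.prod_append, Multiset.prod_add]
  set z := (D'.edges.map fun p => evenι ε (sqMul ε (w p.1) (w p.2))).prod
  have hz := fun u => Subalgebra.mem_center_iff.1
    ((D.edges.map fun p => evenι ε (sqMul ε ((w ∘ D'.inj) p.1) ((w ∘ D'.inj) p.2))).prod).2 u
  simp only [MulMemClass.coe_mul]
  rw [mul_assoc, mul_assoc, ← mul_assoc _ _ (List.prod _), ← mul_assoc (List.prod _), hz]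
  rfl

theorem uMap_elt (ε : ℤˣ) (g : Cinf →ₗ[ℂ] Cinf) (w : L₂ → Cinf) :
    uMap ε g (D.elt ε w) = D.elt ε fun i => g (w i) := by
  rw [elt, elt, map_mul]
  congr 1
  · induction D.edges using Multiset.induction_on with
    | empty => simp
    | cons p M ih =>
      rw [Multiset.map_cons, Multiset.prod_cons, MulMemClass.coe_mul, map_mul, ih,
        Multiset.map_cons, Multiset.prod_cons, MulMemClass.coe_mul, coe_evenι, coe_evenι, uMap_uι]
      simp [twMap]
  · rw [map_list_prod, List.map_map]
    refine congrArg List.prod (List.map_congr_left fun i _ => ?_)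
    simp [uMap_uι, twMap]

/-- In `w ↦ u_D(w) · φ(⨂ w ∘ inj)` each `w_k` enters linearly, because `k` occurs exactly once in the diagram. -/
theorem exists_linear_update [DecidableEq L₂] {ε : ℤˣ} (M : UMod ε)
    (φ : (⨂[ℂ] _ : L₁, Cinf) →ₗ[ℂ] M.carrier) (w : L₂ → Cinf) (k : L₂) :
    ∃ T : Cinf →ₗ[ℂ] M.carrier, ∀ v, M.act (D.elt ε (Function.update w k v))
      (φ (PiTensorProduct.tprod ℂ (Function.update w k v ∘ D.inj))) = T v := by
  classical
  have hn := D.nodup_exhaust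
  have hk : k ∈ ((Finset.univ : Finset L₁).val.map D.inj + (D.circ : Multiset L₂) +
    D.edges.bind fun p => {p.1, p.2}) := D.exhaust ▸ Finset.mem_univ k
  rw [Multiset.nodup_add, Multiset.nodup_add] at hn
  obtain ⟨⟨h1, h2, h12⟩, h3, h123⟩ := hn
  rw [Multiset.disjoint_left] at h12 h123
  simp only [Multiset.mem_add] at h123 hk
  have hinj : (∀ a, D.inj a ≠ k) → ∀ v, Function.update w k v ∘ D.inj = w ∘ D.inj := by
    intro h v
    ext1 a
    exact Function.update_of_ne (h a) _ _
  have hcirc : ∀ l : List L₂, k ∉ l → ∀ v, (l.map fun i => uι ε (Function.update w k v i, 0)) =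
      l.map fun i => uι ε (w i, 0) := by
    intro l h v
    refine List.map_congr_left fun i hi => ?_
    rw [Function.update_of_ne (by rintro rfl; exact h hi)]
  have hedge : ∀ M : Multiset (L₂ × L₂), k ∉ (M.bind fun p => {p.1, p.2}) → ∀ v,
      (M.map fun p => evenι ε (sqMul ε (Function.update w k v p.1) (Function.update w k v p.2))) =
      M.map fun p => evenι ε (sqMul ε (w p.1) (w p.2)) := by
    intro M h v
    refine Multiset.map_congr rfl fun p hp => ?_
    rw [Function.update_of_ne, Function.update_of_ne] <;> rintro rfl <;>
      exact h (Multiset.mem_bind.2 ⟨p, hp, by simp⟩)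
  rcases hk with (hk | hk) | hk
  · obtain ⟨a, -, rfl⟩ := Multiset.mem_map.1 hk
    refine ⟨M.act (D.elt ε w) ∘ₗ φ ∘ₗ
      (PiTensorProduct.tprod ℂ).toLinearMap (w ∘ D.inj) a, fun v => ?_⟩
    rw [elt, hcirc _ (h12 hk), hedge _ (h123 (Or.inl hk)),
      Function.update_comp_eq_of_injective _ D.inj_injective]
    rfl
  · have hni : ∀ a, D.inj a ≠ k := by
      rintro a rfl
      exact h12 (Multiset.mem_map.2 ⟨a, Finset.mem_univ a, rfl⟩) hk
    obtain ⟨A, B, hAB⟩ := List.append_of_mem (Multiset.mem_coe.1 hk)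
    have hnd := Multiset.coe_nodup.1 h2
    rw [hAB, List.nodup_middle, List.nodup_cons, List.mem_append, not_or] at hnd
    refine ⟨(LinearMap.applyₗ (φ (PiTensorProduct.tprod ℂ (w ∘ D.inj)))) ∘ₗ M.act.toLinearMap ∘ₗ
      (LinearMap.mulLeft ℂ (((D.edges.map fun p => evenι ε (sqMul ε (w p.1) (w p.2))).prod :
        Subalgebra.center ℂ (UEnv ε)) * (A.map fun i => uι ε (w i, 0)).prod)) ∘ₗ
      (LinearMap.mulRight ℂ (B.map fun i => uι ε (w i, 0)).prod) ∘ₗ uι ε ∘ₗ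
      LinearMap.inl ℂ Cinf (Sq ε), fun v => ?_⟩
    rw [hinj hni, elt, hedge _ (h123 (Or.inr hk)), hAB, List.map_append, List.map_cons,
      hcirc _ hnd.1.1, hcirc _ hnd.1.2, Function.update_self]
    simp
  · have hni : ∀ a, D.inj a ≠ k := by
      rintro a rfl
      exact h123 (Or.inl (Multiset.mem_map.2 ⟨a, Finset.mem_univ a, rfl⟩)) hk
    have hnc : k ∉ D.circ := fun h => h123 (Or.inr (Multiset.mem_coe.2 h)) hk
    obtain ⟨p, hp, hkp⟩ := Multiset.mem_bind.1 hk
    obtain ⟨E, hE⟩ := Multiset.exists_cons_of_mem hp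
    rw [hE, Multiset.cons_bind, Multiset.nodup_add, Multiset.disjoint_left] at h3
    have hlin : ∃ S : Cinf →ₗ[ℂ] Sq ε, ∀ v, sqMul ε (Function.update w k v p.1)
        (Function.update w k v p.2) = S v := by
      have hne : p.1 ≠ p.2 := by
        have := h3.1
        simpa using this
      simp only [Multiset.insert_eq_cons, Multiset.mem_cons, Multiset.mem_singleton] at hkp
      rcases hkp with rfl | rfl
      · refine ⟨(sqMul ε).flip (w p.2), fun v => ?_⟩
        rw [Function.update_self, Function.update_of_ne hne.symm]; rfl
      · refine ⟨(sqMul ε) (w p.1), fun v => ?_⟩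
        rw [Function.update_self, Function.update_of_ne hne]
    obtain ⟨S, hS⟩ := hlin
    refine ⟨(LinearMap.applyₗ (φ (PiTensorProduct.tprod ℂ (w ∘ D.inj)))) ∘ₗ M.act.toLinearMap ∘ₗ
      (LinearMap.mulRight ℂ (((E.map fun p => evenι ε (sqMul ε (w p.1) (w p.2))).prod :
        Subalgebra.center ℂ (UEnv ε)) * (D.circ.map fun i => uι ε (w i, 0)).prod)) ∘ₗ
      (Subalgebra.center ℂ (UEnv ε)).val.toLinearMap ∘ₗ evenι ε ∘ₗ S, fun v => ?_⟩
    rw [hinj hni, elt, hcirc _ hnc, hE, Multiset.map_cons, hedge _ (h3.2.2 hkp), hS,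
      Multiset.prod_cons, MulMemClass.coe_mul, mul_assoc]
    rfl

end BrauerDiagram

section action

variable {ε : ℤˣ} (M : UMod ε) {L₁ L₂ L₃ : Type} [Fintype L₁] [Fintype L₂] [Fintype L₃]

/-- The map `⨂ w ↦ u_D(w) · φ(⨂ w ∘ inj)`. -/
def diagramLift (D : BrauerDiagram L₁ L₂) (φ : (⨂[ℂ] _ : L₁, Cinf) →ₗ[ℂ] M.carrier) :
    (⨂[ℂ] _ : L₂, Cinf) →ₗ[ℂ] M.carrier :=
  PiTensorProduct.lift (R := ℂ)
    { toFun := fun w => M.act (D.elt ε w) (φ (PiTensorProduct.tprod ℂ (w ∘ D.inj)))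
      map_update_add' := by
        intro _ w k x y
        obtain ⟨T, hT⟩ := D.exists_linear_update M φ w k
        rw [hT, hT, hT, map_add]
      map_update_smul' := by
        intro _ w k c x
        obtain ⟨T, hT⟩ := D.exists_linear_update M φ w k
        rw [hT, hT, map_smul] }

theorem diagramLift_tprod (D : BrauerDiagram L₁ L₂) (φ : (⨂[ℂ] _ : L₁, Cinf) →ₗ[ℂ] M.carrier)
    (w : L₂ → Cinf) : diagramLift M D φ (PiTensorProduct.tprod ℂ w) =
      M.act (D.elt ε w) (φ (PiTensorProduct.tprod ℂ (w ∘ D.inj))) :=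
  PiTensorProduct.lift.tprod w

theorem tensor_ext_tprod {ι : Type} {V : Type*} [AddCommGroup V] [Module ℂ V]
    {f g : (⨂[ℂ] _ : ι, Cinf) →ₗ[ℂ] V}
    (h : ∀ w : ι → Cinf, f (PiTensorProduct.tprod ℂ w) = g (PiTensorProduct.tprod ℂ w)) : f = g :=
  PiTensorProduct.ext (MultilinearMap.ext h)

/-- The action of a diagram on equivariant maps. -/
def diagramAct (D : BrauerDiagram L₁ L₂) : tensorHoms L₁ M.ρ →ₗ[ℂ] tensorHoms L₂ M.ρ where
  toFun φ := ⟨diagramLift M D φ.1, fun g x => by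
    suffices h : diagramLift M D φ.1 ∘ₗ tensorRep L₂ g = M.ρ g ∘ₗ diagramLift M D φ.1 from
      LinearMap.congr_fun h x
    refine tensor_ext_tprod fun w => ?_
    rw [LinearMap.comp_apply, LinearMap.comp_apply, tensorRep_tprod, diagramLift_tprod,
      diagramLift_tprod, M.compat, BrauerDiagram.uMap_elt, ← φ.2, tensorRep_tprod]
    rfl⟩
  map_add' φ ψ := Subtype.ext <| tensor_ext_tprod fun w => by
    simp only [diagramLift_tprod, Submodule.coe_add, LinearMap.add_apply, map_add]
  map_smul' c φ := Subtype.ext <| tensor_ext_tprod fun w => by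
    simp only [diagramLift_tprod, Submodule.coe_smul, LinearMap.smul_apply, map_smul,
      RingHom.id_apply]

theorem diagramAct_tprod (D : BrauerDiagram L₁ L₂) (φ : tensorHoms L₁ M.ρ) (w : L₂ → Cinf) :
    (diagramAct M D φ).1 (PiTensorProduct.tprod ℂ w) =
      M.act (D.elt ε w) (φ.1 (PiTensorProduct.tprod ℂ (w ∘ D.inj))) := diagramLift_tprod M D φ.1 w

theorem diagramAct_comp (D : BrauerDiagram L₁ L₂) (D' : BrauerDiagram L₂ L₃) :
    diagramAct M (D.comp D') = diagramAct M D' ∘ₗ diagramAct M D := by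
  refine LinearMap.ext fun φ => Subtype.ext <| tensor_ext_tprod fun w => ?_
  rw [LinearMap.comp_apply, diagramAct_tprod, diagramAct_tprod, diagramAct_tprod,
    BrauerDiagram.elt_comp, map_mul]
  rfl

theorem diagramAct_refl : diagramAct M (BrauerDiagram.refl L₁) = LinearMap.id := by
  refine LinearMap.ext fun φ => Subtype.ext <| tensor_ext_tprod fun w => ?_
  rw [diagramAct_tprod]
  simp [BrauerDiagram.elt, BrauerDiagram.refl, BrauerDiagram.ofEquiv]

/-- The action of the morphisms of the upwards category on equivariant maps. -/
def upAct : UpHom ε L₁ L₂ →ₗ[ℂ] tensorHoms L₁ M.ρ →ₗ[ℂ] tensorHoms L₂ M.ρ :=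
  Submodule.liftQ _ (Finsupp.linearCombination ℂ fun D => diagramAct M D) <| by
    rw [relSub, Submodule.span_le]
    intro x hx
    rw [SetLike.mem_coe, LinearMap.mem_ker]
    refine LinearMap.ext fun φ => Subtype.ext <| tensor_ext_tprod fun w => ?_
    cases hx with
    | reverse D D' i j N hinj hcirc h h' =>
      simp only [map_sub, map_smul, Finsupp.linearCombination_single, one_smul,
        LinearMap.sub_apply, LinearMap.smul_apply, Submodule.coe_sub, Submodule.coe_smul,
        diagramAct_tprod, LinearMap.zero_apply, Submodule.coe_zero]
      have : D.elt ε w = sg ε • D'.elt ε w := by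
        rw [BrauerDiagram.elt, BrauerDiagram.elt, h, h', hcirc, Multiset.map_cons,
          Multiset.map_cons, Multiset.prod_cons, Multiset.prod_cons, sqMul_comm ε (w i), map_smul,
          smul_mul_assoc]
        exact smul_mul_assoc _ _ _
      rw [this, hinj, map_smul, LinearMap.smul_apply, sub_self]
    | clifford D D' D'' A B i j hinj' hinj'' h h' h'' he' he'' =>
      simp only [map_sub, map_add, map_smul, Finsupp.linearCombination_single, one_smul,
        LinearMap.sub_apply, LinearMap.add_apply, LinearMap.smul_apply, Submodule.coe_sub,
        Submodule.coe_add, Submodule.coe_smul,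
        diagramAct_tprod, LinearMap.zero_apply, Submodule.coe_zero]
      have : D''.elt ε w = D.elt ε w + sg ε • D'.elt ε w := by
        have hz := Subalgebra.mem_center_iff.1 (evenι ε (sqMul ε (w i) (w j))).2
        rw [BrauerDiagram.elt, BrauerDiagram.elt, BrauerDiagram.elt, h, h', h'', he', he'',
          Multiset.map_cons, Multiset.prod_cons, mul_comm (evenι ε _), MulMemClass.coe_mul,
          mul_assoc, List.map_append, List.prod_append, ← mul_assoc (evenι ε _ : UEnv ε), ← hz,
          coe_evenι, ← bracket_uι]
        simp only [List.map_append, List.map_cons, List.prod_append, List.prod_cons, mul_add,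
          add_mul, mul_smul_comm, smul_mul_assoc, mul_assoc]
      rw [this, hinj', hinj'', map_add, map_smul, LinearMap.add_apply, LinearMap.smul_apply,
        sub_self]

@[simp] theorem upAct_mk (D : BrauerDiagram L₁ L₂) : upAct M (UpHom.mk ε D) = diagramAct M D := by
  refine (Submodule.liftQ_apply _ _ _).trans ?_
  simp

theorem upAct_comp (f : UpHom ε L₁ L₂) (g : UpHom ε L₂ L₃) :
    upAct M (UpHom.comp ε L₁ L₂ L₃ f g) = upAct M g ∘ₗ upAct M f := by
  refine LinearMap.ext fun φ => ?_
  suffices h : (upAct M).flip φ ∘ₗ UpHom.comp ε L₁ L₂ L₃ f = (upAct M).flip (upAct M f φ) from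
    LinearMap.congr_fun h g
  refine UpHom.hom_ext fun D' => ?_
  suffices h : (upAct M).flip φ ∘ₗ (UpHom.comp ε L₁ L₂ L₃).flip (UpHom.mk ε D') =
      upAct M (UpHom.mk ε D') ∘ₗ (upAct M).flip φ from LinearMap.congr_fun h f
  refine UpHom.hom_ext fun D => ?_
  simp only [LinearMap.comp_apply, LinearMap.flip_apply, UpHom.comp_mk, upAct_mk, diagramAct_comp]

end action

/-! ### The functor -/

/-- The functor `L ↦ Hom_{GL_∞}((ℂ^∞)^{⊗ L}, M)` on the upwards category. -/
def multiplicityObj {ε : ℤˣ} (M : UMod ε) : UpMod ε where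
  obj :=
    { obj := fun L => ModuleCat.of ℂ (tensorHoms L.carrier M.ρ)
      map := fun {L L'} f => ModuleCat.ofHom (upAct M (L₁ := L.carrier) (L₂ := L'.carrier) f)
      map_id := fun L => by
        refine congrArg ModuleCat.ofHom ?_
        exact (upAct_mk M _).trans (diagramAct_refl M)
      map_comp := fun f g => congrArg ModuleCat.ofHom (upAct_comp M f g) }
  property := ⟨⟨fun {X Y} {f g} => congrArg ModuleCat.ofHom (map_add (upAct M) f g)⟩,
    ⟨fun {X Y} f c => congrArg ModuleCat.ofHom (map_smul (upAct M) c f)⟩⟩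

/-- Composition with a map of modules. -/
def tensorHomsPost {ε : ℤˣ} {M N : UMod ε} (f : M ⟶ N) (L : Type) :
    tensorHoms L M.ρ →ₗ[ℂ] tensorHoms L N.ρ where
  toFun φ := ⟨f.1 ∘ₗ φ.1, fun g x => by
    rw [LinearMap.comp_apply, φ.2, f.2.2]; rfl⟩
  map_add' φ ψ := Subtype.ext (LinearMap.comp_add _ _ _)
  map_smul' c φ := Subtype.ext (LinearMap.comp_smul _ _ _)

theorem tensorHomsPost_upAct {ε : ℤˣ} {M N : UMod ε} (f : M ⟶ N) {L L' : Type} [Fintype L]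
    [Fintype L'] (a : UpHom ε L L') :
    tensorHomsPost f L' ∘ₗ upAct M a = upAct N a ∘ₗ tensorHomsPost f L := by
  refine LinearMap.ext fun φ => ?_
  suffices h : tensorHomsPost f L' ∘ₗ (upAct M).flip φ =
      (upAct N).flip (tensorHomsPost f L φ) from LinearMap.congr_fun h a
  refine UpHom.hom_ext fun D => Subtype.ext <| tensor_ext_tprod fun w => ?_
  rw [LinearMap.comp_apply, LinearMap.flip_apply, LinearMap.flip_apply, upAct_mk, upAct_mk]
  refine (congrArg f.1 (diagramAct_tprod M D φ w)).trans ?_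
  rw [f.2.1]
  exact (diagramAct_tprod N D (tensorHomsPost f L φ) w).symm

/-- The functor from `U(𝔞)`-modules to representations of the upwards category. -/
def multiplicityFunctor (ε : ℤˣ) : UMod ε ⥤ UpMod ε where
  obj := multiplicityObj
  map f := ObjectProperty.homMk
    { app := fun L => ModuleCat.ofHom (tensorHomsPost f L.carrier)
      naturality := fun _ _ a => congrArg ModuleCat.ofHom (tensorHomsPost_upAct f a) }
  map_id _ := rfl
  map_comp _ _ := rfl

instance (ε : ℤˣ) : (multiplicityFunctor ε).Additive where
  map_add := by
    intros; rfl

instance (ε : ℤˣ) : (multiplicityFunctor ε).Linear ℂ where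
  map_smul := by
    intros; rfl

/-! ### The functor is fully faithful -/

section FullyFaithful

variable {ε : ℤˣ}

/-- The evaluation map from the direct sum of the tensor powers indexed by a family of equivariant maps. -/
def evalSum {I V : Type} [AddCommGroup V] [Module ℂ V] (d : I → ℕ)
    (φ : ∀ i, (⨂[ℂ] _ : Fin (d i), Cinf) →ₗ[ℂ] V) : TSum d →ₗ[ℂ] V := by
  classical exact DFinsupp.lsum ℂ φ

theorem evalSum_single {I V : Type} [AddCommGroup V] [Module ℂ V] [DecidableEq I] (d : I → ℕ)
    (φ : ∀ i, (⨂[ℂ] _ : Fin (d i), Cinf) →ₗ[ℂ] V) (i : I) (x : ⨂[ℂ] _ : Fin (d i), Cinf) :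
    evalSum d φ (DFinsupp.single i x) = φ i x := by
  have := DFinsupp.lsum_single (R := ℂ) ℂ φ i x
  rw [evalSum]
  convert this

theorem evalSum_tsumRep {I V : Type} [AddCommGroup V] [Module ℂ V]
    {ρ : Representation ℂ GLinf V} (d : I → ℕ)
    (φ : ∀ i, tensorHoms (Fin (d i)) ρ) (g : GLinf) (x : TSum d) :
    evalSum d (fun i => (φ i).1) (tsumRep d g x) = ρ g (evalSum d (fun i => (φ i).1) x) := by
  classical
  suffices h : evalSum d (fun i => (φ i).1) ∘ₗ tsumRep d g =
      ρ g ∘ₗ evalSum d (fun i => (φ i).1) from LinearMap.congr_fun h x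
  refine tsum_ext fun i p => ?_
  rw [LinearMap.comp_apply, LinearMap.comp_apply, tsumRep_single, evalSum_single, evalSum_single,
    (φ i).2]

/-- The polarizations of an element `x` of a direct sum of tensor powers, as an equivariant map depending
linearly on `x`. -/
def polHom {I V : Type} [AddCommGroup V] [Module ℂ V] {ρ : Representation ℂ GLinf V} (d : I → ℕ)
    (φ : ∀ i, tensorHoms (Fin (d i)) ρ) {n : ℕ} (j : Fin n → ℕ) :
    TSum d →ₗ[ℂ] tensorHoms (Fin n) ρ where
  toFun x := ⟨evalSum d (fun i => (φ i).1) ∘ₗ polD j x, fun g w => by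
    rw [LinearMap.comp_apply, polD_tsumRep, evalSum_tsumRep]; rfl⟩
  map_add' x y := Subtype.ext (by simp [LinearMap.comp_add])
  map_smul' c x := Subtype.ext (by simp [LinearMap.comp_smul])

theorem diagramAct_ofEquiv (M : UMod ε) {L₁ L₂ : Type} [Fintype L₁] [Fintype L₂] (e : L₂ ≃ L₁)
    (φ : tensorHoms L₁ M.ρ) (x : ⨂[ℂ] _ : L₂, Cinf) :
    (diagramAct M (.ofEquiv e) φ).1 x = φ.1 (relabel e x) := by
  suffices h : (diagramAct M (.ofEquiv e) φ).1 = φ.1 ∘ₗ (relabel e).toLinearMap from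
    LinearMap.congr_fun h x
  refine tensor_ext_tprod fun w => ?_
  rw [diagramAct_tprod, LinearMap.comp_apply]
  refine Eq.trans ?_ (congrArg φ.1 (relabel_tprod e w)).symm
  simp [BrauerDiagram.elt, BrauerDiagram.ofEquiv]
  rfl

theorem relabel_symm_relabel {ι κ : Type} (e : ι ≃ κ) (x : ⨂[ℂ] _ : ι, Cinf) :
    relabel e.symm (relabel e x) = x := by
  suffices h : (relabel e.symm).toLinearMap ∘ₗ (relabel e).toLinearMap = LinearMap.id from
    LinearMap.congr_fun h x
  refine tensor_ext_tprod fun w => ?_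
  simp

/-- The diagram with `U = {0}`, no edges, and the other elements shifted down by one. -/
def consDiagram (n : ℕ) : BrauerDiagram (Fin n) (Fin (n + 1)) where
  inj := Fin.succ
  circ := [0]
  edges := 0
  exhaust := by
    rw [Fin.univ_succ]
    simp [← Multiset.singleton_add, add_comm]

/-- The action of `ℂ^∞ ⊂ 𝔞` on a module can be read off from the action of diagrams. -/
theorem diagramAct_cons (M : UMod ε) {n : ℕ} (φ : tensorHoms (Fin n) M.ρ) (v : Cinf)
    (w : Fin n → Cinf) :
    (diagramAct M (consDiagram n) φ).1 (PiTensorProduct.tprod ℂ (Fin.cons v w : Fin (n + 1) → Cinf)) =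
      M.act (uι ε (v, 0)) (φ.1 (PiTensorProduct.tprod ℂ w)) := by
  rw [diagramAct_tprod]
  simp [BrauerDiagram.elt, consDiagram, Function.comp_def]

variable {M N : UMod ε} (η : (multiplicityFunctor ε).obj M ⟶ (multiplicityFunctor ε).obj N)

/-- The components of a natural transformation, as linear maps. -/
def natComponent (L : Type) [Fintype L] : tensorHoms L M.ρ →ₗ[ℂ] tensorHoms L N.ρ :=
  (η.hom.app ⟨L⟩).hom

theorem natComponent_diagramAct {L L' : Type} [Fintype L] [Fintype L'] (D : BrauerDiagram L L')
    (φ : tensorHoms L M.ρ) :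
    natComponent η L' (diagramAct M D φ) = diagramAct N D (natComponent η L φ) := by
  have := η.hom.naturality (X := (⟨L⟩ : UpCat ε)) (Y := ⟨L'⟩) (UpHom.mk ε D)
  have h := LinearMap.congr_fun (congrArg ModuleCat.Hom.hom this) φ
  rw [← upAct_mk, ← upAct_mk]
  exact h

/-- The total degree function on the index set of all equivariant maps from tensor powers to `M`. -/
abbrev homDegree (M : UMod ε) : (Σ n : ℕ, tensorHoms (Fin n) M.ρ) → ℕ := Sigma.fst

/-- The tautological map from a direct sum of tensor powers onto `M`. -/
def cover (M : UMod ε) : TSum (homDegree M) →ₗ[ℂ] M.carrier :=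
  evalSum (homDegree M) fun p => p.2.1

theorem cover_surjective (M : UMod ε) : Function.Surjective (cover M) := by
  classical
  rw [← LinearMap.range_eq_top, ← top_le_iff, ← M.polynomial.span_eq_top, Submodule.span_le]
  rintro _ ⟨n, φ, w, rfl⟩
  exact ⟨DFinsupp.single ⟨n, φ⟩ w, evalSum_single _ _ _ _⟩

/-- The map that a natural transformation induces from the tautological cover of `M` to `N`. -/
def coverNat : TSum (homDegree M) →ₗ[ℂ] N.carrier :=
  evalSum (homDegree M) fun p => (natComponent η (Fin p.1) p.2).1

/-- The polarizations of `x` are combinations of relabellings of the summands of the cover, with which a natural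
transformation is compatible. -/
theorem coverNat_polD {n : ℕ} (j : Fin n → ℕ) (x : TSum (homDegree M)) (w : ⨂[ℂ] _ : Fin n, Cinf) :
    coverNat η (polD j x w) = (natComponent η (Fin n) (polHom (homDegree M) Sigma.snd j x)).1 w := by
  classical
  suffices h : coverNat η ∘ₗ (polD j).flip w = LinearMap.applyₗ w ∘ₗ (tensorHoms (Fin n) N.ρ).subtype ∘ₗ
      natComponent η (Fin n) ∘ₗ polHom (homDegree M) Sigma.snd j from LinearMap.congr_fun h x
  refine tsum_ext fun p f => ?_
  have h1 : polHom (homDegree M) Sigma.snd j (DFinsupp.single p (tbas f)) =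
      ∑ σ : Fin p.1 ≃ Fin n, tcoord (j ∘ σ) (tbas f) • diagramAct M (.ofEquiv σ.symm) p.2 := by
    refine Subtype.ext (LinearMap.ext fun y => ?_)
    change evalSum (homDegree M) (fun p => p.2.1) (polD j (DFinsupp.single p (tbas f)) y) = _
    rw [polD_single, evalSum_single, polOp_apply, map_sum, AddSubmonoidClass.coe_finsetSum,
      LinearMap.sum_apply]
    refine Finset.sum_congr rfl fun σ _ => ?_
    rw [map_smul, Submodule.coe_smul, LinearMap.smul_apply, diagramAct_ofEquiv]
  simp only [LinearMap.comp_apply, LinearMap.flip_apply]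
  rw [h1, coverNat, polD_single, evalSum_single, polOp_apply, map_sum, map_sum, map_sum, map_sum]
  refine Finset.sum_congr rfl fun σ _ => ?_
  simp only [map_smul, natComponent_diagramAct]
  refine congrArg _ ?_
  exact (diagramAct_ofEquiv N σ.symm (natComponent η (Fin p.1) p.2) w).symm

/-- If `x` is in the kernel of the cover, then so are its polarizations, which form equivariant maps; a natural
transformation maps these to zero, and they span `x`. -/
theorem ker_cover_le : LinearMap.ker (cover M) ≤ LinearMap.ker (coverNat η) := by
  intro x hx
  have hst : ∀ g, ∀ x ∈ LinearMap.ker (cover M), tsumRep _ g x ∈ LinearMap.ker (cover M) := by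
    intro g x hx
    rw [LinearMap.mem_ker] at hx ⊢
    rw [cover, evalSum_tsumRep _ (fun p : Σ n : ℕ, tensorHoms (Fin n) M.ρ => p.2)]
    rw [cover] at hx
    rw [hx, map_zero]
  have h : Submodule.span ℂ {y | ∃ (n : ℕ) (j : Fin n → ℕ) (w : ⨂[ℂ] _ : Fin n, Cinf),
      y = polD j x w} ≤ LinearMap.ker (coverNat η) := by
    rw [Submodule.span_le]
    rintro _ ⟨n, j, w, rfl⟩
    rw [SetLike.mem_coe, LinearMap.mem_ker, coverNat_polD]
    have : polHom (homDegree M) Sigma.snd j x = 0 :=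
      Subtype.ext (LinearMap.ext fun y => polD_mem _ hst j hx y)
    rw [this, map_zero]; rfl
  exact h (mem_span_polD x)

/-- The linear map that induces a given natural transformation. -/
def descend : M.carrier →ₗ[ℂ] N.carrier :=
  Submodule.liftQ _ (coverNat η) (ker_cover_le η) ∘ₗ
    ((cover M).quotKerEquivOfSurjective (cover_surjective M)).symm.toLinearMap

theorem descend_cover (x : TSum (homDegree M)) : descend η (cover M x) = coverNat η x := by
  have : ((cover M).quotKerEquivOfSurjective (cover_surjective M)).symm (cover M x) =
      Submodule.Quotient.mk x := by
    rw [LinearEquiv.symm_apply_eq]; rfl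
  rw [descend, LinearMap.comp_apply, LinearEquiv.coe_coe, this, Submodule.liftQ_apply]

theorem descend_apply {n : ℕ} (φ : tensorHoms (Fin n) M.ρ) (w : ⨂[ℂ] _ : Fin n, Cinf) :
    descend η (φ.1 w) = (natComponent η (Fin n) φ).1 w := by
  classical
  have := descend_cover η (DFinsupp.single ⟨n, φ⟩ w)
  rw [cover, coverNat, evalSum_single, evalSum_single] at this
  exact this

theorem cover_ext {V : Type} [AddCommGroup V] [Module ℂ V] {f g : M.carrier →ₗ[ℂ] V}
    (h : ∀ (n : ℕ) (φ : tensorHoms (Fin n) M.ρ) (w : Fin n → Cinf),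
      f (φ.1 (PiTensorProduct.tprod ℂ w)) = g (φ.1 (PiTensorProduct.tprod ℂ w))) : f = g := by
  refine LinearMap.ext_on M.polynomial.span_eq_top ?_
  rintro _ ⟨n, φ, w, rfl⟩
  exact LinearMap.congr_fun (tensor_ext_tprod (f := f ∘ₗ φ.1) (g := g ∘ₗ φ.1) fun w => h n φ w) w

/-- A natural transformation comes from a map of modules. -/
def descendHom : M ⟶ N := ⟨descend η, by
  have hU : ∀ v, descend η ∘ₗ M.act (uι ε (v, 0)) = N.act (uι ε (v, 0)) ∘ₗ descend η := by
    refine fun v => cover_ext fun n φ w => ?_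
    rw [LinearMap.comp_apply, LinearMap.comp_apply, ← diagramAct_cons, descend_apply, descend_apply,
      natComponent_diagramAct, diagramAct_cons]
  let S : Subalgebra ℂ (UEnv ε) :=
    { carrier := {u | descend η ∘ₗ M.act u = N.act u ∘ₗ descend η}
      mul_mem' := fun {a b} ha hb => by
        simp only [Set.mem_ofPred_eq, map_mul] at ha hb ⊢
        rw [Module.End.mul_eq_comp, Module.End.mul_eq_comp, ← LinearMap.comp_assoc, ha,
          LinearMap.comp_assoc, hb, LinearMap.comp_assoc]
      add_mem' := fun {a b} ha hb => by
        simp only [Set.mem_ofPred_eq, map_add] at ha hb ⊢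
        rw [LinearMap.comp_add, LinearMap.add_comp, ha, hb]
      algebraMap_mem' := fun r => LinearMap.ext fun x => by
        simp [AlgHom.commutes, Module.algebraMap_end_apply] }
  exact fun u m => LinearMap.congr_fun (uenv_eq_top S hU u) m, by
  intro g m
  suffices h : descend η ∘ₗ M.ρ g = N.ρ g ∘ₗ descend η from LinearMap.congr_fun h m
  refine cover_ext fun n φ w => ?_
  rw [LinearMap.comp_apply, LinearMap.comp_apply, ← φ.2, descend_apply, descend_apply,
    (natComponent η (Fin n) φ).2]⟩

theorem multiplicityFunctor_map_descendHom : (multiplicityFunctor ε).map (descendHom η) = η := by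
  refine ObjectProperty.hom_ext _ (NatTrans.ext (funext fun L => ?_))
  refine ModuleCat.hom_ext (LinearMap.ext fun φ => ?_)
  let φ' : tensorHoms L.carrier M.ρ := φ
  change tensorHomsPost (descendHom η) L.carrier φ' = natComponent η L.carrier φ'
  let e := Fintype.equivFin L.carrier
  refine Subtype.ext (LinearMap.ext fun w => ?_)
  have h1 : φ'.1 w = (diagramAct M (.ofEquiv e.symm) φ').1 (relabel e w) := by
    rw [diagramAct_ofEquiv]
    exact congrArg φ'.1 (relabel_symm_relabel e w).symm
  refine (congrArg (descend η) h1).trans ?_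
  rw [descend_apply, natComponent_diagramAct, diagramAct_ofEquiv]
  exact congrArg (natComponent η L.carrier φ').1 (relabel_symm_relabel e w)

instance : (multiplicityFunctor ε).Full where
  map_surjective η := ⟨descendHom η, multiplicityFunctor_map_descendHom η⟩

instance : (multiplicityFunctor ε).Faithful where
  map_injective {M N} {f g} h := by
    refine Subtype.ext (cover_ext fun n φ w => ?_)
    have h1 := congrArg (fun η => (natComponent η (Fin n) φ).1 (PiTensorProduct.tprod ℂ w)) h
    exact h1

end FullyFaithful

/-! ### Relations between diagrams -/

namespace BrauerDiagram

variable {L₁ L₂ : Type} [Fintype L₁] [Fintype L₂]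

/-- Rearrange the order on `U`. -/
def permCirc (D : BrauerDiagram L₁ L₂) (l : List L₂) (h : l.Perm D.circ) : BrauerDiagram L₁ L₂ where
  inj := D.inj
  circ := l
  edges := D.edges
  exhaust := by rw [Multiset.coe_eq_coe.2 h]; exact D.exhaust

/-- Replace an edge from `i` to `j` by the two elements `i, j` at the beginning of `U`. -/
def cutEdge (D : BrauerDiagram L₁ L₂) (i j : L₂) (E : Multiset (L₂ × L₂)) (h : D.edges = (i, j) ::ₘ E) :
    BrauerDiagram L₁ L₂ where
  inj := D.inj
  circ := i :: j :: D.circ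
  edges := E
  exhaust := by
    rw [D.exhaust, h, Multiset.cons_bind, ← Multiset.cons_coe, ← Multiset.cons_coe,
      ← Multiset.singleton_add i, ← Multiset.singleton_add j, Multiset.insert_eq_cons,
      ← Multiset.singleton_add i]
    abel

/-- Join two consecutive elements `i, j` of `U` by an edge. -/
def joinEdge (D : BrauerDiagram L₁ L₂) (A B : List L₂) (i j : L₂) (h : D.circ = A ++ i :: j :: B) :
    BrauerDiagram L₁ L₂ where
  inj := D.inj
  circ := A ++ B
  edges := (i, j) ::ₘ D.edges
  exhaust := by
    rw [D.exhaust, h, Multiset.cons_bind, ← Multiset.coe_add, ← Multiset.coe_add,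
      ← Multiset.cons_coe, ← Multiset.cons_coe,
      ← Multiset.singleton_add i, ← Multiset.singleton_add j, Multiset.insert_eq_cons,
      ← Multiset.singleton_add i]
    abel

open Classical in
/-- If `U = i :: l` and there are no edges, remove `i` from `L₂`. -/
def tailDiagram (D : BrauerDiagram L₁ L₂) (i : L₂) (l : List L₂) (hc : D.circ = i :: l)
    (he : D.edges = 0) : BrauerDiagram L₁ {j : L₂ // j ≠ i} where
  inj a := ⟨D.inj a, by
    have hn := D.nodup_exhaust
    rw [hc, he, Multiset.zero_bind, add_zero, Multiset.nodup_add, Multiset.disjoint_left] at hn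
    intro h
    exact hn.2.2 (Multiset.mem_map.2 ⟨a, Finset.mem_univ a, h⟩) (by simp)⟩
  circ := l.pmap Subtype.mk (by
    have hn := D.nodup_exhaust
    rw [hc, he, Multiset.zero_bind, add_zero, Multiset.nodup_add, Multiset.coe_nodup,
      List.nodup_cons] at hn
    rintro j hj rfl
    exact hn.2.1.1 hj)
  edges := 0
  exhaust := by
    have h := D.exhaust
    rw [hc, he] at h
    have h2 := (contract i).exhaust
    apply Multiset.map_injective Subtype.val_injective
    apply add_right_cancel (b := ({i} : Multiset L₂))
    simp only [contract, Multiset.zero_bind, add_zero] at h2 h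
    rw [Multiset.coe_singleton] at h2
    rw [← Multiset.cons_coe, ← Multiset.singleton_add] at h
    rw [← h2, h]
    simp only [Multiset.map_add, Multiset.map_map, Multiset.map_coe, List.map_pmap,
      Multiset.zero_bind, add_zero, Function.comp_def]
    simp only [List.pmap_eq_map, List.map_id']
    abel

open Classical in
theorem tailDiagram_comp (D : BrauerDiagram L₁ L₂) (i : L₂) (l : List L₂) (hc : D.circ = i :: l)
    (he : D.edges = 0) : (D.tailDiagram i l hc he).comp (contract i) = D := by
  ext1
  · rfl
  · simp [comp, contract, tailDiagram, hc, List.map_pmap]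
  · simp [comp, contract, tailDiagram, he]

theorem ofEquiv_comp {L₃ : Type} [Fintype L₃] (e : L₂ ≃ L₁) (e' : L₃ ≃ L₂) :
    (ofEquiv e).comp (ofEquiv e') = ofEquiv (e'.trans e) := by
  ext1 <;> simp [comp, ofEquiv]

/-- A diagram with empty `U` and without edges is given by a bijection. -/
theorem exists_eq_ofEquiv (D : BrauerDiagram L₁ L₂) (hc : D.circ = []) (he : D.edges = 0) :
    ∃ e : L₂ ≃ L₁, D = ofEquiv e := by
  have hs : Function.Surjective D.inj := by
    intro i
    have h := D.exhaust ▸ Finset.mem_univ_val i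
    rw [hc, he] at h
    simpa using h
  refine ⟨(Equiv.ofBijective D.inj ⟨D.inj_injective, hs⟩).symm, ?_⟩
  ext1
  · rfl
  · exact hc
  · exact he

end BrauerDiagram

theorem UpHom.mk_cutEdge {ε : ℤˣ} {L₁ L₂ : Type} [Fintype L₁] [Fintype L₂]
    {D D' D'' : BrauerDiagram L₁ L₂} (A B : List L₂) (i j : L₂)
    (hinj' : D'.inj = D.inj) (hinj'' : D''.inj = D.inj)
    (h : D.circ = A ++ i :: j :: B) (h' : D'.circ = A ++ j :: i :: B) (h'' : D''.circ = A ++ B)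
    (he' : D'.edges = D.edges) (he'' : D''.edges = (i, j) ::ₘ D.edges) :
    UpHom.mk ε D'' = UpHom.mk ε D + sg ε • UpHom.mk ε D' := by
  have hx := Submodule.subset_span (R := ℂ)
    (DRel.clifford (ε := ε) D D' D'' A B i j hinj' hinj'' h h' h'' he' he'')
  exact ((Submodule.Quotient.mk_eq_zero _).2 hx |> sub_eq_zero.1).symm

/-! ### Representations of the upwards category -/

section UpMod

variable {ε : ℤˣ} (N : UpMod ε)

/-- The value of a representation of the upwards category on a finite set. -/
abbrev Val (L : Type) [Fintype L] : Type := N.obj.obj (UpCat.mk L)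

variable {L₁ L₂ L₃ : Type} [Fintype L₁] [Fintype L₂] [Fintype L₃]

/-- A representation of the upwards category on morphisms, as a linear map. -/
def homMap : UpHom ε L₁ L₂ →ₗ[ℂ] Val N L₁ →ₗ[ℂ] Val N L₂ where
  toFun f := (N.obj.map (X := UpCat.mk L₁) (Y := UpCat.mk L₂) f).hom
  map_add' f g := congrArg ModuleCat.Hom.hom
    (N.property.1.map_add (X := UpCat.mk L₁) (Y := UpCat.mk L₂) (f := f) (g := g))
  map_smul' c f := congrArg ModuleCat.Hom.hom
    (N.property.2.map_smul (X := UpCat.mk L₁) (Y := UpCat.mk L₂) f c)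

/-- The action of a diagram in a representation of the upwards category. -/
def diagMap (D : BrauerDiagram L₁ L₂) : Val N L₁ →ₗ[ℂ] Val N L₂ := homMap N (UpHom.mk ε D)

theorem diagMap_comp (D : BrauerDiagram L₁ L₂) (D' : BrauerDiagram L₂ L₃) (y : Val N L₁) :
    diagMap N D' (diagMap N D y) = diagMap N (D.comp D') y := by
  have h := N.obj.map_comp (X := UpCat.mk L₁) (Y := UpCat.mk L₂) (Z := UpCat.mk L₃)
    (UpHom.mk ε D) (UpHom.mk ε D')
  have h2 := LinearMap.congr_fun (congrArg ModuleCat.Hom.hom h) y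
  rw [diagMap, diagMap, diagMap, ← UpHom.comp_mk]
  exact h2.symm

theorem diagMap_refl (y : Val N L₁) : diagMap N (.ofEquiv (Equiv.refl L₁)) y = y :=
  LinearMap.congr_fun (congrArg ModuleCat.Hom.hom (N.obj.map_id (UpCat.mk L₁))) y

theorem diagMap_cutEdge {D D' D'' : BrauerDiagram L₁ L₂} (A B : List L₂) (i j : L₂)
    (hinj' : D'.inj = D.inj) (hinj'' : D''.inj = D.inj)
    (h : D.circ = A ++ i :: j :: B) (h' : D'.circ = A ++ j :: i :: B) (h'' : D''.circ = A ++ B)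
    (he' : D'.edges = D.edges) (he'' : D''.edges = (i, j) ::ₘ D.edges) :
    diagMap N D'' = diagMap N D + sg ε • diagMap N D' := by
  rw [diagMap, UpHom.mk_cutEdge A B i j hinj' hinj'' h h' h'' he' he'', map_add, map_smul]
  rfl

end UpMod

/-! ### The inverse construction -/

section Coend

variable {ε : ℤˣ} (N : UpMod ε)

/-- The relations of the coinvariants of the symmetric groups. -/
def coendRel : Submodule ℂ (Π₀ n : ℕ, Val N (Fin n) ⊗[ℂ] (⨂[ℂ] _ : Fin n, Cinf)) :=
  Submodule.span ℂ {x | ∃ (n : ℕ) (σ : Equiv.Perm (Fin n)) (y : Val N (Fin n))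
    (w : ⨂[ℂ] _ : Fin n, Cinf), x = DFinsupp.single n (diagMap N (.ofEquiv σ) y ⊗ₜ[ℂ] w) -
      DFinsupp.single n (y ⊗ₜ[ℂ] relabel σ w)}

/-- The direct sum over `n` of the `S_n`-coinvariants of `N([n]) ⊗ (ℂ^∞)^{⊗ n}`. -/
def Coend : Type := (Π₀ n : ℕ, Val N (Fin n) ⊗[ℂ] (⨂[ℂ] _ : Fin n, Cinf)) ⧸ coendRel N

instance : AddCommGroup (Coend N) := inferInstanceAs (AddCommGroup (_ ⧸ _))
instance : Module ℂ (Coend N) := inferInstanceAs (Module ℂ (_ ⧸ _))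

/-- The class of `y ⊗ w` in the coend, for the standard finite sets. -/
def brk (n : ℕ) : Val N (Fin n) →ₗ[ℂ] (⨂[ℂ] _ : Fin n, Cinf) →ₗ[ℂ] Coend N :=
  (TensorProduct.mk ℂ _ _).compr₂ ((coendRel N).mkQ ∘ₗ
    DFinsupp.lsingle (R := ℂ) (M := fun n => Val N (Fin n) ⊗[ℂ] (⨂[ℂ] _ : Fin n, Cinf)) n)

variable {N}

theorem brk_ofEquiv {n : ℕ} (σ : Equiv.Perm (Fin n)) (y : Val N (Fin n))
    (w : ⨂[ℂ] _ : Fin n, Cinf) :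
    brk N n (diagMap N (.ofEquiv σ) y) w = brk N n y (relabel σ w) :=
  (Submodule.Quotient.eq _).2 (Submodule.subset_span ⟨n, σ, y, w, rfl⟩)

/-- Linear maps out of the coend. -/
def coendLift {V : Type} [AddCommGroup V] [Module ℂ V]
    (B : ∀ n, Val N (Fin n) →ₗ[ℂ] (⨂[ℂ] _ : Fin n, Cinf) →ₗ[ℂ] V)
    (hB : ∀ n (σ : Equiv.Perm (Fin n)) y w,
      B n (diagMap N (.ofEquiv σ) y) w = B n y (relabel σ w)) : Coend N →ₗ[ℂ] V :=
  Submodule.liftQ (coendRel N) (DFinsupp.lsum ℂ fun n => TensorProduct.lift (B n)) <| by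
    rw [coendRel, Submodule.span_le]
    rintro _ ⟨n, σ, y, w, rfl⟩
    rw [SetLike.mem_coe, LinearMap.mem_ker, map_sub, DFinsupp.lsum_single, DFinsupp.lsum_single,
      TensorProduct.lift.tmul, TensorProduct.lift.tmul, hB, sub_self]

theorem coendLift_brk {V : Type} [AddCommGroup V] [Module ℂ V]
    (B : ∀ n, Val N (Fin n) →ₗ[ℂ] (⨂[ℂ] _ : Fin n, Cinf) →ₗ[ℂ] V)
    (hB : ∀ n (σ : Equiv.Perm (Fin n)) y w,
      B n (diagMap N (.ofEquiv σ) y) w = B n y (relabel σ w)) (n : ℕ) (y : Val N (Fin n))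
    (w : ⨂[ℂ] _ : Fin n, Cinf) : coendLift B hB (brk N n y w) = B n y w := by
  refine (Submodule.liftQ_apply _ _ _).trans ?_
  refine (DFinsupp.lsum_single _ _ _ _).trans ?_
  rfl

theorem coend_ext {V : Type*} [AddCommGroup V] [Module ℂ V] {f g : Coend N →ₗ[ℂ] V}
    (h : ∀ n y (w : Fin n → Cinf), f (brk N n y (PiTensorProduct.tprod ℂ w)) =
      g (brk N n y (PiTensorProduct.tprod ℂ w))) : f = g := by
  refine Submodule.linearMap_qext _ (DFinsupp.lhom_ext' fun n => TensorProduct.ext ?_)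
  refine LinearMap.ext fun y => tensor_ext_tprod fun w => ?_
  exact h n y w

/-- The class of `y ⊗ w` in the coend, for an arbitrary finite set. By `brkL_eq` it does not depend on the bijection
to the standard finite set. -/
def brkL (L : Type) [Fintype L] : Val N L →ₗ[ℂ] (⨂[ℂ] _ : L, Cinf) →ₗ[ℂ] Coend N :=
  (brk N _).compl₁₂ (diagMap N (.ofEquiv (Fintype.equivFin L).symm))
    (relabel (Fintype.equivFin L)).toLinearMap

theorem relabel_relabel {ι κ μ : Type} (e : ι ≃ κ) (e' : κ ≃ μ) (x : ⨂[ℂ] _ : ι, Cinf) :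
    relabel e' (relabel e x) = relabel (e.trans e') x := by
  suffices h : (relabel e').toLinearMap ∘ₗ (relabel e).toLinearMap =
      (relabel (e.trans e')).toLinearMap from LinearMap.congr_fun h x
  refine tensor_ext_tprod fun w => ?_
  simp

theorem brkL_eq {L : Type} [Fintype L] {n : ℕ} (e : L ≃ Fin n) (y : Val N L)
    (w : ⨂[ℂ] _ : L, Cinf) :
    brkL L y w = brk N n (diagMap N (.ofEquiv e.symm) y) (relabel e w) := by
  obtain rfl : Fintype.card L = n := by simpa using Fintype.card_congr e
  have h1 : diagMap N (.ofEquiv e.symm) y =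
      diagMap N (.ofEquiv (e.symm.trans (Fintype.equivFin L)))
        (diagMap N (.ofEquiv (Fintype.equivFin L).symm) y) := by
    rw [diagMap_comp, BrauerDiagram.ofEquiv_comp, show (e.symm.trans (Fintype.equivFin L)).trans
      (Fintype.equivFin L).symm = e.symm by ext; simp]
  rw [h1, brk_ofEquiv, relabel_relabel]
  have h2 : e.trans (e.symm.trans (Fintype.equivFin L)) = Fintype.equivFin L := by
    ext a
    simp
  rw [h2]
  rfl

theorem brkL_fin (n : ℕ) (y : Val N (Fin n)) (w : ⨂[ℂ] _ : Fin n, Cinf) :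
    brkL (Fin n) y w = brk N n y w := by
  rw [brkL_eq (Equiv.refl _)]
  rw [Equiv.refl_symm, diagMap_refl]
  congr 1
  exact LinearEquiv.congr_fun (PiTensorProduct.reindex_refl (R := ℂ) (s := fun _ : Fin n => Cinf)) w

theorem brkL_ofEquiv {L₁ L₂ : Type} [Fintype L₁] [Fintype L₂] (e : L₂ ≃ L₁) (y : Val N L₁)
    (w : ⨂[ℂ] _ : L₂, Cinf) : brkL L₂ (diagMap N (.ofEquiv e) y) w = brkL L₁ y (relabel e w) := by
  rw [brkL_eq (e.trans (Fintype.equivFin L₁)), diagMap_comp, BrauerDiagram.ofEquiv_comp, brkL,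
    LinearMap.compl₁₂_apply, show (e.trans (Fintype.equivFin L₁)).symm.trans e =
      (Fintype.equivFin L₁).symm by ext; simp, ← relabel_relabel]
  rfl

theorem brk_compl₂_tensorRep (g : GLinf) (n : ℕ) (σ : Equiv.Perm (Fin n)) (y : Val N (Fin n))
    (w : ⨂[ℂ] _ : Fin n, Cinf) :
    (brk N n).compl₂ (tensorRep (Fin n) g) (diagMap N (.ofEquiv σ) y) w =
      (brk N n).compl₂ (tensorRep (Fin n) g) y (relabel σ w) := by
  rw [LinearMap.compl₂_apply, LinearMap.compl₂_apply, brk_ofEquiv, relabel_tensorRep]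

/-- The action of `GL_∞` on the coend. -/
def coendRep (N : UpMod ε) : Representation ℂ GLinf (Coend N) where
  toFun g := coendLift (fun n => (brk N n).compl₂ (tensorRep (Fin n) g))
    (brk_compl₂_tensorRep g)
  map_one' := coend_ext fun n y w => by
    rw [coendLift_brk, LinearMap.compl₂_apply, map_one]; rfl
  map_mul' g h := coend_ext fun n y w => by
    rw [Module.End.mul_apply, coendLift_brk, coendLift_brk, LinearMap.compl₂_apply,
      LinearMap.compl₂_apply, coendLift_brk, LinearMap.compl₂_apply, map_mul]; rfl

theorem coendRep_brk (g : GLinf) (n : ℕ) (y : Val N (Fin n)) (w : ⨂[ℂ] _ : Fin n, Cinf) :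
    coendRep N g (brk N n y w) = brk N n y (tensorRep (Fin n) g w) :=
  coendLift_brk _ (brk_compl₂_tensorRep g) n y w

theorem coendRep_brkL (g : GLinf) {L : Type} [Fintype L] (y : Val N L) (w : ⨂[ℂ] _ : L, Cinf) :
    coendRep N g (brkL L y w) = brkL L y (tensorRep L g w) := by
  rw [brkL, LinearMap.compl₁₂_apply, LinearMap.compl₁₂_apply, coendRep_brk]
  exact congrArg _ (relabel_tensorRep _ g w).symm

theorem coend_polynomial (N : UpMod ε) : IsPolynomial (coendRep N) := by
  classical
  let d : (Σ n : ℕ, Val N (Fin n)) → ℕ := Sigma.fst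
  let q : TSum d →ₗ[ℂ] Coend N := evalSum d fun p => brk N p.1 p.2
  have hq : LinearMap.range q = ⊤ := by
    have : (LinearMap.range q).mkQ = 0 := by
      refine coend_ext fun n y w => ?_
      rw [LinearMap.zero_apply, Submodule.mkQ_apply, Submodule.Quotient.mk_eq_zero]
      exact ⟨DFinsupp.single (⟨n, y⟩ : Σ n : ℕ, Val N (Fin n)) (PiTensorProduct.tprod ℂ w),
        evalSum_single d _ _ _⟩
    rw [← Submodule.ker_mkQ (LinearMap.range q), this, LinearMap.ker_zero]
  refine ⟨_, d, ⊤, fun _ _ _ => trivial, q ∘ₗ Submodule.subtype _, ?_, ?_⟩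
  · intro x
    obtain ⟨y, rfl⟩ := LinearMap.range_eq_top.1 hq x
    exact ⟨⟨y, trivial⟩, rfl⟩
  · intro g x
    exact evalSum_tsumRep (ρ := coendRep N) d
      (fun p => ⟨brk N p.1 p.2, fun g w => (coendRep_brk g p.1 p.2 w).symm⟩) g x.1

end Coend

/-! ### The inverse construction is a `U(𝔞)`-module -/

section CoendModule

variable {ε : ℤˣ} (N : UpMod ε)

/-- Insertion of a vector as the first tensor factor. -/
def tcons (n : ℕ) : Cinf →ₗ[ℂ] (⨂[ℂ] _ : Fin n, Cinf) →ₗ[ℂ] ⨂[ℂ] _ : Fin (n + 1), Cinf :=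
  (PiTensorProduct.lift (R := ℂ) (s := fun _ : Fin n => Cinf)
    (E := ⨂[ℂ] _ : Fin (n + 1), Cinf)).toLinearMap ∘ₗ
    MultilinearMap.curryLeft (PiTensorProduct.tprod ℂ (s := fun _ : Fin (n + 1) => Cinf))

theorem tcons_tprod {n : ℕ} (v : Cinf) (w : Fin n → Cinf) :
    tcons n v (PiTensorProduct.tprod ℂ w) =
      PiTensorProduct.tprod ℂ (Fin.cons v w : Fin (n + 1) → Cinf) :=
  PiTensorProduct.lift.tprod w

/-- Extension of a bijection by a distinguished point, which is put at the position `0`. -/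
def succEquiv {n : ℕ} {L : Type} [DecidableEq L] (i : L) (e : {j : L // j ≠ i} ≃ Fin n) :
    L ≃ Fin (n + 1) :=
  (Equiv.optionSubtypeNe i).symm.trans ((Equiv.optionCongr e).trans (finSuccEquiv n).symm)

theorem succEquiv_self {n : ℕ} {L : Type} [DecidableEq L] (i : L) (e : {j : L // j ≠ i} ≃ Fin n) :
    succEquiv i e i = 0 := by
  simp [succEquiv]

theorem succEquiv_of_ne {n : ℕ} {L : Type} [DecidableEq L] (i : L) (e : {j : L // j ≠ i} ≃ Fin n)
    (j : {j : L // j ≠ i}) : succEquiv i e j = (e j).succ := by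
  simp [succEquiv, Equiv.optionSubtypeNe_symm_of_ne j.2]

variable {N}

open Classical in
theorem brkL_contract {L : Type} [Fintype L] (i : L) {n : ℕ} (e : {j : L // j ≠ i} ≃ Fin n)
    (y : Val N {j : L // j ≠ i}) (w : L → Cinf) :
    brkL L (diagMap N (.contract i) y) (PiTensorProduct.tprod ℂ w) =
      brk N (n + 1) (diagMap N (consDiagram n) (diagMap N (.ofEquiv e.symm) y))
        (tcons n (w i) (PiTensorProduct.tprod ℂ fun a => w (e.symm a))) := by
  rw [brkL_eq (succEquiv i e), tcons_tprod, diagMap_comp, diagMap_comp]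
  congr 1
  · have : (BrauerDiagram.contract i).comp (.ofEquiv (succEquiv i e).symm) =
        (BrauerDiagram.ofEquiv e.symm).comp (consDiagram n) := by
      ext1
      · ext1 j
        exact succEquiv_of_ne i e j
      · simp [BrauerDiagram.comp, BrauerDiagram.contract, BrauerDiagram.ofEquiv, consDiagram,
          succEquiv_self]
      · simp [BrauerDiagram.comp, BrauerDiagram.contract, BrauerDiagram.ofEquiv, consDiagram]
    rw [this]
  · refine (relabel_tprod _ _).trans (congrArg _ (funext fun k => ?_))
    obtain ⟨j, rfl⟩ := (succEquiv i e).surjective k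
    rw [Equiv.symm_apply_apply]
    by_cases h : j = i
    · subst h
      rw [succEquiv_self, Fin.cons_zero]
    · have := succEquiv_of_ne i e ⟨j, h⟩
      dsimp only at this
      rw [this, Fin.cons_succ, Equiv.symm_apply_apply]

open Classical in
theorem brk_tcons_ofEquiv_aux {L : Type} [Fintype L] (i : L) {n : ℕ} (e : {j : L // j ≠ i} ≃ Fin n)
    (σ : Equiv.Perm (Fin n)) (y : Val N (Fin n)) (w : L → Cinf) :
    brk N (n + 1) (diagMap N (consDiagram n) (diagMap N (.ofEquiv σ) y))
        (tcons n (w i) (PiTensorProduct.tprod ℂ fun a => w (e.symm (σ a)))) =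
      brk N (n + 1) (diagMap N (consDiagram n) y)
        (tcons n (w i) (PiTensorProduct.tprod ℂ fun a => w (e.symm a))) := by
  -- The left hand side of `brkL_contract` does not depend on the bijection.
  have h1 := brkL_contract (N := N) i e (diagMap N (.ofEquiv e) y) w
  have h2 := brkL_contract (N := N) i (e.trans σ.symm) (diagMap N (.ofEquiv e) y) w
  rw [h1, diagMap_comp N (.ofEquiv e), diagMap_comp N (.ofEquiv e), BrauerDiagram.ofEquiv_comp,
    BrauerDiagram.ofEquiv_comp, Equiv.symm_trans_self, diagMap_refl,
    show (e.trans σ.symm).symm.trans e = σ by ext; simp] at h2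
  exact h2.symm

theorem brk_tcons_ofEquiv {n : ℕ} (v : Cinf) (σ : Equiv.Perm (Fin n)) (y : Val N (Fin n))
    (w : ⨂[ℂ] _ : Fin n, Cinf) :
    brk N (n + 1) (diagMap N (consDiagram n) (diagMap N (.ofEquiv σ) y)) (tcons n v w) =
      brk N (n + 1) (diagMap N (consDiagram n) y) (tcons n v (relabel σ w)) := by
  suffices h : brk N (n + 1) (diagMap N (consDiagram n) (diagMap N (.ofEquiv σ) y)) ∘ₗ tcons n v =
      brk N (n + 1) (diagMap N (consDiagram n) y) ∘ₗ tcons n v ∘ₗ (relabel σ).toLinearMap from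
    LinearMap.congr_fun h w
  refine tensor_ext_tprod fun w => ?_
  let e : {j : Fin (n + 1) // j ≠ 0} ≃ Fin n := (finSuccAboveEquiv 0).symm
  have he : ∀ (u : Fin n → Cinf) a, (Fin.cons v u : Fin (n + 1) → Cinf) (e.symm a) = u a :=
    fun u a => by
      have : ((e.symm a : {j : Fin (n + 1) // j ≠ 0}) : Fin (n + 1)) = a.succ := by
        simp [e, finSuccAboveEquiv_apply]
      rw [this, Fin.cons_succ]
  have h := brk_tcons_ofEquiv_aux (N := N) 0 e σ y (Fin.cons v fun a => w (σ.symm a))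
  simp only [Fin.cons_zero, he, Equiv.symm_apply_apply] at h
  rw [LinearMap.comp_apply, LinearMap.comp_apply, LinearMap.comp_apply, h]
  exact congrArg (fun z => brk N (n + 1) (diagMap N (consDiagram n) y) (tcons n v z))
    (relabel_tprod σ w).symm

/-- Insertion of a vector as the first tensor factor, on the coend. -/
def coendInsert (N : UpMod ε) (v : Cinf) : Module.End ℂ (Coend N) :=
  coendLift (fun n => ((brk N (n + 1)) ∘ₗ diagMap N (consDiagram n)).compl₂ (tcons n v))
    fun _ σ y w => brk_tcons_ofEquiv v σ y w

theorem coendInsert_brk (v : Cinf) (n : ℕ) (y : Val N (Fin n)) (w : ⨂[ℂ] _ : Fin n, Cinf) :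
    coendInsert N v (brk N n y w) = brk N (n + 1) (diagMap N (consDiagram n) y) (tcons n v w) :=
  coendLift_brk _ (fun _ σ y w => brk_tcons_ofEquiv v σ y w) n y w

/-- The action of `ℂ^∞` on the coend: on `y ⊗ w` the vector `v` is inserted as the first tensor factor, and the
diagram with `U = {0}` is applied to `y`. -/
def coendX (N : UpMod ε) : Cinf →ₗ[ℂ] Module.End ℂ (Coend N) where
  toFun := coendInsert N
  map_add' v v' := coend_ext fun n y w => by
    simp only [coendInsert_brk, LinearMap.add_apply, map_add]
  map_smul' c v := coend_ext fun n y w => by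
    simp only [coendInsert_brk, LinearMap.smul_apply, map_smul, RingHom.id_apply]

theorem coendX_brk (v : Cinf) (n : ℕ) (y : Val N (Fin n)) (w : ⨂[ℂ] _ : Fin n, Cinf) :
    coendX N v (brk N n y w) = brk N (n + 1) (diagMap N (consDiagram n) y) (tcons n v w) :=
  coendInsert_brk v n y w

open Classical in
theorem coendX_brkL {L : Type} [Fintype L] (i : L) (y : Val N {j : L // j ≠ i}) (w : L → Cinf) :
    coendX N (w i) (brkL _ y (PiTensorProduct.tprod ℂ fun j : {j : L // j ≠ i} => w j)) =
      brkL L (diagMap N (.contract i) y) (PiTensorProduct.tprod ℂ w) := by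
  rw [brkL_contract i (Fintype.equivFin _), brkL_eq (Fintype.equivFin _), coendX_brk]
  congr 2
  exact relabel_tprod _ _

/-- Diagrams without edges act through the operators of `ℂ^∞` on the coend, by induction on the number of elements
of `U`. -/
theorem brkL_of_edges_eq_zero {L L' : Type} [Fintype L] [Fintype L'] (D : BrauerDiagram L' L)
    (he : D.edges = 0) (y : Val N L') (w : L → Cinf) :
    brkL L (diagMap N D y) (PiTensorProduct.tprod ℂ w) =
      (D.circ.map fun i => coendX N (w i)).prod
        (brkL L' y (PiTensorProduct.tprod ℂ (w ∘ D.inj))) := by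
  classical
  obtain ⟨n, hn⟩ : ∃ n, D.circ.length = n := ⟨_, rfl⟩
  induction n generalizing L with
  | zero =>
    have hl := List.length_eq_zero_iff.1 hn
    obtain ⟨e, rfl⟩ := D.exists_eq_ofEquiv hl he
    rw [hl, brkL_ofEquiv]
    refine congrArg (brkL L' y) ?_
    exact relabel_tprod e w
  | succ n ih =>
    obtain ⟨i, l, hl⟩ := List.exists_cons_of_length_eq_add_one hn
    have h := ih (D.tailDiagram i l hl he) rfl (fun j => w j)
      (by simpa [BrauerDiagram.tailDiagram, hl] using hn)
    have h2 : (D.tailDiagram i l hl he).circ.map (fun j => coendX N (w j.1)) =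
        l.map fun j => coendX N (w j) := by
      simp [BrauerDiagram.tailDiagram, List.map_pmap]
    conv_lhs => rw [← D.tailDiagram_comp i l hl he, ← diagMap_comp, ← coendX_brkL, h, h2]
    rw [hl, List.map_cons, List.prod_cons, Module.End.mul_apply]
    rfl

/-- The operators `X_v X_w + ε X_w X_v` on the coend, as a bilinear map. -/
def coendBracket (N : UpMod ε) : Cinf →ₗ[ℂ] Cinf →ₗ[ℂ] Module.End ℂ (Coend N) :=
  (LinearMap.mul ℂ _).compl₁₂ (coendX N) (coendX N) +
    sg ε • ((LinearMap.mul ℂ _).compl₁₂ (coendX N) (coendX N)).flip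

theorem coendBracket_apply (v w : Cinf) : coendBracket N v w =
    coendX N v * coendX N w + sg ε • (coendX N w * coendX N v) := rfl

/-- Both products are given by the diagrams on three points with one edge and one element of `U`, and an edge has no
position relative to `U`. -/
theorem coendX_commute_bracket (u v w : Cinf) :
    Commute (coendX N u) (coendBracket N v w) := by
  refine coend_ext fun n y t => ?_
  let W : Fin (n + 3) → Cinf := Fin.cons u (Fin.cons v (Fin.cons w t))
  let D₀ := ((consDiagram n).comp (consDiagram (n + 1))).comp (consDiagram (n + 2))
  have hD₀ : D₀.circ = [0, 1, 2] := rfl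
  have hE₀ : D₀.edges = 0 := rfl
  have hinj : W ∘ D₀.inj = t := rfl
  have key : ∀ l h, brkL (Fin (n + 3)) (diagMap N (D₀.permCirc l h) y) (PiTensorProduct.tprod ℂ W) =
      (l.map fun i => coendX N (W i)).prod (brk N n y (PiTensorProduct.tprod ℂ t)) := by
    intro l h
    rw [brkL_of_edges_eq_zero (D₀.permCirc l h) hE₀, ← hinj, ← brkL_fin]
    rfl
  have p1 : [0, 1, 2].Perm D₀.circ := List.Perm.refl _
  have p2 : [0, 2, 1].Perm D₀.circ := (List.Perm.swap _ _ _).cons _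
  have p3 : [1, 2, 0].Perm D₀.circ := ((List.Perm.swap _ _ _).cons _).trans (List.Perm.swap _ _ _)
  have p4 : [2, 1, 0].Perm D₀.circ := (List.Perm.swap _ _ _).trans p3
  let E := (D₀.permCirc _ p1).joinEdge [0] [] 1 2 rfl
  have e1 : diagMap N E = diagMap N (D₀.permCirc _ p1) + sg ε • diagMap N (D₀.permCirc _ p2) :=
    diagMap_cutEdge N [0] [] 1 2 rfl rfl rfl rfl rfl rfl rfl
  have e2 : diagMap N E = diagMap N (D₀.permCirc _ p3) + sg ε • diagMap N (D₀.permCirc _ p4) :=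
    diagMap_cutEdge N [] [0] 1 2 rfl rfl rfl rfl rfl rfl rfl
  have h1 := congrArg (fun f => brkL (Fin (n + 3)) (f y) (PiTensorProduct.tprod ℂ W)) (e1.symm.trans e2)
  simp only [LinearMap.add_apply, LinearMap.smul_apply, map_add, map_smul, key] at h1
  have hW : W 0 = u ∧ W 1 = v ∧ W 2 = w := ⟨rfl, rfl, rfl⟩
  simpa [coendBracket_apply, hW, mul_add, add_mul, mul_assoc] using h1

/-- The action of the second summand of `𝔞` on the coend. -/
def coendY (N : UpMod ε) : Sq ε →ₗ[ℂ] Module.End ℂ (Coend N) :=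
  Submodule.liftQ _ (TensorProduct.lift (coendBracket N)) <| by
    rw [Submodule.span_le]
    rintro _ ⟨p, rfl⟩
    rw [SetLike.mem_coe, LinearMap.mem_ker, map_sub, map_smul, TensorProduct.lift.tmul,
      TensorProduct.lift.tmul, coendBracket_apply, coendBracket_apply, smul_add, smul_smul,
      sg_mul_self, one_smul, add_comm, sub_self]

theorem coendY_sqMul (v w : Cinf) : coendY N (sqMul ε v w) = coendBracket N v w := rfl

theorem coendX_commute_coendY (u : Cinf) (f : Sq ε) : Commute (coendX N u) (coendY N f) := by
  refine sq_induction (P := LinearMap.eqLocus (LinearMap.mulLeft ℂ (coendX N u) ∘ₗ coendY N)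
    (LinearMap.mulRight ℂ (coendX N u) ∘ₗ coendY N)) (fun v w => ?_) f
  exact coendX_commute_bracket u v w

theorem coendBracket_commute_coendY (v w : Cinf) (f : Sq ε) :
    Commute (coendBracket N v w) (coendY N f) := by
  have h1 := coendX_commute_coendY (N := N) v f
  have h2 := coendX_commute_coendY (N := N) w f
  rw [coendBracket_apply]
  generalize coendY N f = Y at *
  generalize coendX N v = X at *
  generalize coendX N w = X' at *
  exact (h1.mul_left h2).add_left ((h2.mul_left h1).smul_left _)

theorem coendY_commute_coendY (f f' : Sq ε) : Commute (coendY N f) (coendY N f') := by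
  have h := sq_induction
    (P := (Subalgebra.centralizer ℂ {coendY N f'}).toSubmodule.comap (coendY N)) (fun v w => ?_) f
  · exact (h _ rfl).symm
  · rintro _ rfl
    exact (coendBracket_commute_coendY v w f').eq.symm

/-- The action of `U(𝔞)` on the coend. -/
def coendAct (N : UpMod ε) : UEnv ε →ₐ[ℂ] Module.End ℂ (Coend N) :=
  RingQuot.liftAlgHom ℂ ⟨TensorAlgebra.lift ℂ ((coendX N).coprod (coendY N)), by
    intro x y h
    cases h with
    | odd_odd v w => simp [bracket, coendY_sqMul, coendBracket_apply]
    | odd_even v f => simpa [bracket, sub_eq_zero] using (coendX_commute_coendY v f).eq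
    | even_even f f' => simpa [bracket, sub_eq_zero] using (coendY_commute_coendY f f').eq⟩

theorem coendAct_uι (v : Cinf) : coendAct N (uι ε (v, 0)) = coendX N v := by
  simp [coendAct, ← uι_def]

theorem tensorRep_tcons (g : GLinf) {n : ℕ} (v : Cinf) (w : Fin n → Cinf) :
    tensorRep (Fin (n + 1)) g (tcons n v (PiTensorProduct.tprod ℂ w)) =
      tcons n (g.1 v) (tensorRep (Fin n) g (PiTensorProduct.tprod ℂ w)) := by
  rw [tcons_tprod, tensorRep_tprod, tensorRep_tprod, tcons_tprod]
  congr 1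
  ext1 k
  refine Fin.cases ?_ (fun k => ?_) k <;> simp

/-- The coend as a module over `U(𝔞)`. -/
def coendMod (N : UpMod ε) : UMod ε where
  carrier := Coend N
  ρ := coendRep N
  polynomial := coend_polynomial N
  act := coendAct N
  compat g u m := by
    let S : Subalgebra ℂ (UEnv ε) :=
      { carrier := {u | coendRep N g ∘ₗ coendAct N u =
          coendAct N (uMap ε g.1 u) ∘ₗ coendRep N g}
        mul_mem' := fun {a b} ha hb => by
          simp only [Set.mem_ofPred_eq, map_mul] at ha hb ⊢
          rw [Module.End.mul_eq_comp, Module.End.mul_eq_comp, ← LinearMap.comp_assoc, ha,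
            LinearMap.comp_assoc, hb, LinearMap.comp_assoc]
        add_mem' := fun {a b} ha hb => by
          simp only [Set.mem_ofPred_eq, map_add] at ha hb ⊢
          rw [LinearMap.comp_add, LinearMap.add_comp, ha, hb]
        algebraMap_mem' := fun r => LinearMap.ext fun x => by
          simp [AlgHom.commutes, Module.algebraMap_end_apply] }
    refine LinearMap.congr_fun (uenv_eq_top S (fun v => ?_) u) m
    refine coend_ext fun n y w => ?_
    rw [uMap_uι, show twMap ε g.1 (v, 0) = (g.1 v, 0) by simp [twMap], coendAct_uι, coendAct_uι,
      LinearMap.comp_apply, LinearMap.comp_apply, coendX_brk, coendRep_brk, coendRep_brk,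
      coendX_brk, tensorRep_tcons]

/-! ### The unit of the coend construction -/

/-- The map `N(L) → Hom_{GL_∞}((ℂ^∞)^{⊗ L}, coend)`. -/
def coendUnit (N : UpMod ε) (L : Type) [Fintype L] : Val N L →ₗ[ℂ] tensorHoms L (coendRep N) where
  toFun y := ⟨brkL L y, fun g x => (coendRep_brkL g y x).symm⟩
  map_add' _ _ := Subtype.ext (map_add _ _ _)
  map_smul' _ _ := Subtype.ext (map_smul _ _ _)

theorem diagramAct_cutEdge (M : UMod ε) {L L' : Type} [Fintype L] [Fintype L']
    {D D' D'' : BrauerDiagram L' L} (A B : List L) (i j : L)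
    (hinj' : D'.inj = D.inj) (hinj'' : D''.inj = D.inj)
    (h : D.circ = A ++ i :: j :: B) (h' : D'.circ = A ++ j :: i :: B) (h'' : D''.circ = A ++ B)
    (he' : D'.edges = D.edges) (he'' : D''.edges = (i, j) ::ₘ D.edges) :
    diagramAct M D'' = diagramAct M D + sg ε • diagramAct M D' := by
  rw [← upAct_mk, UpHom.mk_cutEdge A B i j hinj' hinj'' h h' h'' he' he'', map_add, map_smul,
    upAct_mk, upAct_mk]

/-- Statements about diagrams that are compatible with the Clifford relation can be checked on diagrams
without edges. -/
theorem BrauerDiagram.cutEdge_induction {L L' : Type} [Fintype L] [Fintype L']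
    {P : BrauerDiagram L' L → Prop} (h0 : ∀ D, D.edges = 0 → P D)
    (h1 : ∀ (D : BrauerDiagram L' L) (i j : L) (E : Multiset (L × L)) (h : D.edges = (i, j) ::ₘ E),
      P (D.cutEdge i j E h) → P ((D.cutEdge i j E h).permCirc (j :: i :: D.circ)
        (List.Perm.swap _ _ _)) → P D) (D : BrauerDiagram L' L) : P D := by
  obtain ⟨E, hE⟩ : ∃ E, D.edges = E := ⟨_, rfl⟩
  induction E using Multiset.induction_on generalizing D with
  | empty => exact h0 D hE
  | cons p E ih => exact h1 D p.1 p.2 E hE (ih _ rfl) (ih _ rfl)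

theorem coendUnit_diagMap {L L' : Type} [Fintype L] [Fintype L'] (D : BrauerDiagram L' L) :
    coendUnit N L ∘ₗ diagMap N D = diagramAct (coendMod N) D ∘ₗ coendUnit N L' := by
  induction D using BrauerDiagram.cutEdge_induction with
  | h0 D he =>
    refine LinearMap.ext fun y => Subtype.ext <| tensor_ext_tprod fun w => ?_
    refine (brkL_of_edges_eq_zero D he y w).trans ?_
    refine Eq.trans ?_ (diagramAct_tprod (coendMod N) D (coendUnit N L' y) w).symm
    rw [BrauerDiagram.elt, he, Multiset.map_zero, Multiset.prod_zero, OneMemClass.coe_one, one_mul,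
      map_list_prod, List.map_map]
    refine congrArg (fun l : List (Module.End ℂ (Coend N)) => l.prod _) ?_
    exact List.map_congr_left fun i _ => (coendAct_uι (w i)).symm
  | h1 D i j E h ha hb =>
    rw [diagMap_cutEdge N (D'' := D) [] D.circ i j (D := D.cutEdge i j E h)
      (D' := (D.cutEdge i j E h).permCirc (j :: i :: D.circ) (List.Perm.swap _ _ _))
      rfl rfl rfl rfl rfl rfl h, LinearMap.comp_add, LinearMap.comp_smul, ha, hb,
      diagramAct_cutEdge (coendMod N) (D'' := D) [] D.circ i j (D := D.cutEdge i j E h)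
      (D' := (D.cutEdge i j E h).permCirc (j :: i :: D.circ) (List.Perm.swap _ _ _))
      rfl rfl rfl rfl rfl rfl h]
    rfl

end CoendModule

/-! ### The functor is an equivalence -/

section EssSurj

variable {ε : ℤˣ} {N : UpMod ε}

theorem tcoord_relabel {ι κ : Type} [Finite ι] [Finite κ] (e : ι ≃ κ) (f : κ → ℕ)
    (x : ⨂[ℂ] _ : ι, Cinf) : tcoord f (relabel e x) = tcoord (f ∘ e) x := by
  classical
  suffices h : tcoord f ∘ₗ (relabel e).toLinearMap = tcoord (f ∘ e) from LinearMap.congr_fun h x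
  refine tensor_ext fun p => ?_
  have h : relabel e (tbas p) = tbas (p ∘ e.symm) := relabel_tprod e fun i => bas (p i)
  rw [LinearMap.comp_apply, LinearEquiv.coe_coe, h, tcoord_tbas, tcoord_tbas]
  congr 1
  rw [Equiv.comp_symm_eq]

open Classical in
/-- The coefficient of the basis tensors `e_{j ∘ σ}`, for a fixed `j : L → ℕ`, in an element of the coend. -/
def coendCoeff (N : UpMod ε) {L : Type} [Fintype L] (j : L → ℕ) : Coend N →ₗ[ℂ] Val N L :=
  coendLift (fun n => ∑ σ : Fin n ≃ L,
      ((LinearMap.lsmul ℂ (Val N L)).compl₁₂ (tcoord (j ∘ σ)) (diagMap N (.ofEquiv σ.symm))).flip)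
    fun n τ y w => by
      simp only [LinearMap.sum_apply, LinearMap.flip_apply, LinearMap.compl₁₂_apply,
        LinearMap.lsmul_apply, diagMap_comp, BrauerDiagram.ofEquiv_comp, tcoord_relabel]
      refine Fintype.sum_equiv (Equiv.equivCongr τ (Equiv.refl L)) _ _ fun σ => ?_
      congr 2
      refine congrArg tcoord (funext fun a => ?_)
      simp

open Classical in
theorem coendCoeff_brk {L : Type} [Fintype L] (j : L → ℕ) (n : ℕ) (y : Val N (Fin n))
    (x : ⨂[ℂ] _ : Fin n, Cinf) :
    coendCoeff N j (brk N n y x) =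
      ∑ σ : Fin n ≃ L, tcoord (j ∘ σ) x • diagMap N (.ofEquiv σ.symm) y := by
  rw [coendCoeff, coendLift_brk]
  simp only [LinearMap.sum_apply, LinearMap.flip_apply, LinearMap.compl₁₂_apply,
    LinearMap.lsmul_apply]

theorem coendCoeff_brkL {L : Type} [Fintype L] (j : L → ℕ) (hj : Function.Injective j)
    (y : Val N L) : coendCoeff N j (brkL L y (tbas j)) = y := by
  classical
  let e := Fintype.equivFin L
  rw [brkL_eq e, coendCoeff_brk, Finset.sum_eq_single e.symm]
  · rw [tcoord_relabel, tcoord_tbas, if_pos (by ext; simp), one_smul, diagMap_comp,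
      BrauerDiagram.ofEquiv_comp, Equiv.symm_symm, Equiv.self_trans_symm, diagMap_refl]
  · intro σ _ hσ
    rw [tcoord_relabel, tcoord_tbas, if_neg, zero_smul]
    intro h
    refine hσ (Equiv.ext fun a => ?_)
    have := congrFun h (e.symm a)
    simp only [Function.comp_apply, Equiv.apply_symm_apply] at this
    exact (hj this).symm
  · intro h
    exact absurd (Finset.mem_univ _) h

/-- The tautological cover of the coend by a direct sum of tensor powers. -/
def coendCover (N : UpMod ε) : TSum (fun i : Σ n, Val N (Fin n) => i.1) →ₗ[ℂ] Coend N :=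
  evalSum _ fun i => brk N i.1 i.2

theorem coendCover_surjective : Function.Surjective (coendCover N) := by
  classical
  rw [← LinearMap.range_eq_top, ← Submodule.ker_mkQ (LinearMap.range (coendCover N)),
    LinearMap.ker_eq_top]
  refine coend_ext fun n y w => (Submodule.Quotient.mk_eq_zero _).2 ?_
  exact ⟨DFinsupp.single ⟨n, y⟩ (PiTensorProduct.tprod ℂ w), evalSum_single _ _ _ _⟩

/-- Every polarization of an element of the coend is the class of a tensor `y ⊗ w`. -/
theorem coendCover_polD {L : Type} [Fintype L] (j : L → ℕ)
    (t : TSum (fun i : Σ n, Val N (Fin n) => i.1)) (w : ⨂[ℂ] _ : L, Cinf) :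
    coendCover N (polD j t w) = brkL L (coendCoeff N j (coendCover N t)) w := by
  classical
  suffices h : coendCover N ∘ₗ (polD j).flip w = (brkL L).flip w ∘ₗ coendCoeff N j ∘ₗ coendCover N from
    LinearMap.congr_fun h t
  refine tsum_ext fun i p => ?_
  change coendCover N (polD j (DFinsupp.single i (tbas p)) w) =
    brkL L (coendCoeff N j (coendCover N (DFinsupp.single i (tbas p)))) w
  rw [polD_single, coendCover, evalSum_single, evalSum_single, coendCoeff_brk, polOp_apply, map_sum,
    map_sum, LinearMap.sum_apply]
  refine Finset.sum_congr rfl fun σ _ => ?_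
  rw [map_smul, map_smul, LinearMap.smul_apply, brkL_ofEquiv, brkL_fin]

theorem coendCover_tsumRep (g : GLinf) (t : TSum (fun i : Σ n, Val N (Fin n) => i.1)) :
    coendCover N (tsumRep _ g t) = coendRep N g (coendCover N t) := by
  have h (i : Σ n, Val N (Fin n)) : brk N i.1 i.2 ∈ tensorHoms (Fin i.1) (coendRep N) :=
    fun g x => (coendRep_brk g _ _ _).symm
  exact evalSum_tsumRep (I := Σ n, Val N (Fin n)) (ρ := coendRep N) (fun i => i.1)
    (fun i => ⟨brk N i.1 i.2, h i⟩) g t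

/-- An equivariant map from `(ℂ^∞)^{⊗ L}` to the coend is determined by its value at a basis tensor with pairwise
different factors, and the coefficient of that tensor in the value gives back an element of `N(L)`. -/
theorem coendUnit_bijective (N : UpMod ε) (L : Type) [Fintype L] :
    Function.Bijective (coendUnit N L) := by
  classical
  let j : L → ℕ := fun a => Fintype.equivFin L a
  have hj : Function.Injective j := fun a b h => (Fintype.equivFin L).injective (Fin.ext h)
  constructor
  · refine Function.LeftInverse.injective (g := fun φ => coendCoeff N j (φ.1 (tbas j))) fun y => ?_
    exact coendCoeff_brkL j hj y
  · intro φ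
    refine ⟨coendCoeff N j (φ.1 (tbas j)), Subtype.ext <| tensor_ext_tprod fun w => ?_⟩
    obtain ⟨t, ht⟩ := coendCover_surjective (φ.1 (tbas j))
    obtain ⟨D, m, hDm⟩ := exists_bounded t
    -- An element of the group algebra that takes `e_j` to `w` and polarizes `t`.
    obtain ⟨θ, h1, h2⟩ := exists_groupAlgebra_polD j w (max D (Fintype.card L))
      (max m (Fintype.card L))
    have h3 := h1 L j (le_max_right _ _) fun a => (Fin.is_lt _).trans_le (le_max_right _ _)
    have h4 := h2 _ _ t (bounded_mono (le_max_left _ _) (le_max_left _ _) hDm)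
    rw [polOp_tbas_self j hj] at h3
    have h5 := asAlgebraHom_equivariant (tensorRep L) (coendRep N) φ.1 φ.2 θ (tbas j)
    have h6 := asAlgebraHom_equivariant (tsumRep _) (coendRep N) (coendCover N) coendCover_tsumRep θ t
    rw [h4, coendCover_polD, ht] at h6
    rw [h3] at h5
    exact h6.trans h5.symm

theorem coendUnit_homMap {L L' : Type} [Fintype L] [Fintype L'] (f : UpHom ε L' L) (y : Val N L') :
    coendUnit N L (homMap N f y) = upAct (coendMod N) f (coendUnit N L' y) := by
  suffices h : coendUnit N L ∘ₗ (homMap N).flip y = (upAct (coendMod N)).flip (coendUnit N L' y) from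
    LinearMap.congr_fun h f
  refine UpHom.hom_ext fun D => ?_
  refine (LinearMap.congr_fun (coendUnit_diagMap D) y).trans ?_
  exact LinearMap.congr_fun (upAct_mk (coendMod N) D).symm (coendUnit N L' y)

/-- A representation of the upwards category is the image of its coend. -/
def coendUnitIso (N : UpMod ε) : N ≅ (multiplicityFunctor ε).obj (coendMod N) :=
  ObjectProperty.isoMk _ <| NatIso.ofComponents
    (fun L => (LinearEquiv.ofBijective _ (coendUnit_bijective N L.carrier)).toModuleIso)
    fun {_ _} f => ModuleCat.hom_ext <| LinearMap.ext fun y => coendUnit_homMap f y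

instance : (multiplicityFunctor ε).EssSurj := ⟨fun N => ⟨coendMod N, ⟨(coendUnitIso N).symm⟩⟩⟩

instance : (multiplicityFunctor ε).IsEquivalence where

end EssSurj

/-! ### The categories are abelian -/

section Abelian

open Limits
open scoped ZeroObject

variable {C : Type*} [Category C] [Preadditive C] [Linear ℂ C]

/-- The property of being a `ℂ`-linear functor to vector spaces. -/
abbrev linearFunctors (C : Type*) [Category C] [Preadditive C] [Linear ℂ C] :
    ObjectProperty (C ⥤ ModuleCat.{0} ℂ) := fun F => F.Additive ∧ F.Linear ℂ

instance : (linearFunctors C).IsClosedUnderSubobjects where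
  prop_of_mono {X Y} f _ hY := by
    obtain ⟨_, _⟩ := hY
    refine ⟨⟨fun {K L} {a b} => ?_⟩, ⟨fun {K L} a c => ?_⟩⟩
    · rw [← cancel_mono (f.app L), Preadditive.add_comp, f.naturality, f.naturality, f.naturality,
        Functor.map_add, Preadditive.comp_add]
    · rw [← cancel_mono (f.app L), Linear.smul_comp, f.naturality, f.naturality, Functor.map_smul,
        Linear.comp_smul]

instance : (linearFunctors C).IsClosedUnderQuotients where
  prop_of_epi {X Y} f _ hX := by
    obtain ⟨_, _⟩ := hX
    refine ⟨⟨fun {K L} {a b} => ?_⟩, ⟨fun {K L} a c => ?_⟩⟩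
    · rw [← cancel_epi (f.app K), Preadditive.comp_add, ← f.naturality, ← f.naturality,
        ← f.naturality, Functor.map_add, Preadditive.add_comp]
    · rw [← cancel_epi (f.app K), Linear.comp_smul, ← f.naturality, ← f.naturality,
        Functor.map_smul, Linear.smul_comp]

instance : (linearFunctors C).ContainsZero where
  exists_zero := by
    have h : IsZero ((Functor.const C).obj (0 : ModuleCat.{0} ℂ)) :=
      Functor.isZero _ fun _ => isZero_zero _
    exact ⟨_, h, ⟨(isZero_zero _).eq_of_src _ _⟩, ⟨fun _ _ => (isZero_zero _).eq_of_src _ _⟩⟩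

instance : (linearFunctors C).IsClosedUnderFiniteProducts := by
  refine .of_isClosedUnderLimitsOfShape.{0} fun J _ => ⟨?_⟩
  rintro X ⟨⟨F, π, hl⟩, hF⟩
  have hL (L : C) := isLimitOfPreserves ((evaluation _ _).obj L) hl
  have h1 (j) : (F.obj j).Additive := (hF j).1
  have h2 (j) : (F.obj j).Linear ℂ := (hF j).2
  refine ⟨⟨fun {K L} {a b} => (hL L).hom_ext fun j => ?_⟩, ⟨fun {K L} a c => (hL L).hom_ext fun j => ?_⟩⟩
  · change (X.map (a + b)) ≫ (π.app j).app L = (X.map a + X.map b) ≫ (π.app j).app L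
    rw [Preadditive.add_comp]
    erw [(π.app j).naturality, (π.app j).naturality, (π.app j).naturality]
    rw [Functor.map_add, Preadditive.comp_add]
  · change (X.map (c • a)) ≫ (π.app j).app L = (c • X.map a) ≫ (π.app j).app L
    rw [Linear.smul_comp]
    erw [(π.app j).naturality, (π.app j).naturality]
    rw [Functor.map_smul, Linear.comp_smul]

theorem upMod_abelian (ε : ℤˣ) :
    ∃ B : Abelian (UpMod ε), B.toPreadditive = Preadditive.fullSubcategory _ :=
  ⟨inferInstanceAs (Abelian (linearFunctors (UpCat ε)).FullSubcategory), rfl⟩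

theorem uMod_abelian (ε : ℤˣ) : ∃ A : Abelian (UMod ε), A.toPreadditive = UMod.preadditive ε := by
  obtain ⟨B, hB⟩ := upMod_abelian ε
  have : HasFiniteProducts (UMod ε) :=
    ⟨fun n => Adjunction.hasLimitsOfShape_of_equivalence (multiplicityFunctor ε)⟩
  exact ⟨abelianOfEquivalence (multiplicityFunctor ε), rfl⟩

end Abelian

/-! ### The Young symmetrizer -/

section Young

open MonoidAlgebra (single)

variable (μ : YoungDiagram)

/-- The sum of the permutations that preserve the rows. -/
def rowSum : MonoidAlgebra ℂ (Equiv.Perm (Cell μ)) :=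
  ∑ p : Equiv.Perm (Cell μ) with ∀ c, (p c).1.1 = c.1.1, single p 1

/-- The signed sum of the permutations that preserve the columns. -/
def colSum : MonoidAlgebra ℂ (Equiv.Perm (Cell μ)) :=
  ∑ q : Equiv.Perm (Cell μ) with ∀ c, (q c).1.2 = c.1.2, single q (sg (Equiv.Perm.sign q))

theorem youngSym_eq : youngSym μ = rowSum μ * colSum μ := by
  simp [youngSym, rowSum, colSum, Finset.sum_mul_sum, MonoidAlgebra.single_mul_single]

variable {μ}

theorem rowSum_mul_single (t : Equiv.Perm (Cell μ)) (ht : ∀ c, (t c).1.1 = c.1.1) :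
    rowSum μ * single t 1 = rowSum μ := by
  rw [rowSum, Finset.sum_mul]
  refine Finset.sum_equiv (Equiv.mulRight t) (fun p => ?_) fun p _ => ?_
  · simp only [Finset.mem_filter, Finset.mem_univ, true_and, Equiv.coe_mulRight, Equiv.Perm.mul_apply]
    refine ⟨fun h c => (h _).trans (ht c), fun h c => ?_⟩
    have := h (t.symm c)
    rw [Equiv.apply_symm_apply] at this
    rw [this, ← ht, Equiv.apply_symm_apply]
  · simp [MonoidAlgebra.single_mul_single]

theorem single_mul_colSum (t : Equiv.Perm (Cell μ)) (ht : ∀ c, (t c).1.2 = c.1.2) :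
    single t 1 * colSum μ = sg (Equiv.Perm.sign t) • colSum μ := by
  rw [colSum, Finset.mul_sum, Finset.smul_sum]
  refine Finset.sum_equiv (Equiv.mulLeft t) (fun p => ?_) fun p _ => ?_
  · simp only [Finset.mem_filter, Finset.mem_univ, true_and, Equiv.coe_mulLeft, Equiv.Perm.mul_apply, ht]
  · simp [MonoidAlgebra.single_mul_single, MonoidAlgebra.smul_single, sg, ← mul_assoc, ← Int.cast_mul,
      ← Units.val_mul]

/-- The number of cells of column `j` in the first `k` rows. -/
theorem card_col_lt (j k : ℕ) :
    (Finset.univ.filter fun c : Cell μ => c.1.2 = j ∧ c.1.1 < k).card = min k (μ.colLen j) := by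
  rw [← Finset.card_range (min k (μ.colLen j))]
  refine Finset.card_bij (fun c _ => c.1.1) (fun c hc => ?_) (fun c hc d hd h => ?_) fun i hi => ?_
  · obtain ⟨rfl, h⟩ := (Finset.mem_filter.1 hc).2
    exact Finset.mem_range.2 (lt_min h (YoungDiagram.mem_iff_lt_colLen.1 c.2))
  · exact Subtype.ext (Prod.ext h
      ((Finset.mem_filter.1 hc).2.1.trans (Finset.mem_filter.1 hd).2.1.symm))
  · obtain ⟨h1, h2⟩ := lt_min_iff.1 (Finset.mem_range.1 hi)
    exact ⟨⟨(i, j), YoungDiagram.mem_iff_lt_colLen.2 h2⟩, by simp [h1], rfl⟩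

theorem card_col (j : ℕ) : (Finset.univ.filter fun c : Cell μ => c.1.2 = j).card = μ.colLen j := by
  rw [← card_col_lt j (μ.colLen j) |>.trans (min_self _)]
  congr 1
  ext c
  simp only [Finset.mem_filter, Finset.mem_univ, true_and, iff_self_and]
  rintro rfl
  exact YoungDiagram.mem_iff_lt_colLen.1 c.2

/-- A permutation that does not move two cells of a column into one row is the product of a permutation
that preserves the rows and one that preserves the columns. The reason is that the first `k` rows contain at most
`min k (colLen j)` cells of the image of column `j`, and hence exactly so many. -/
theorem exists_row_mul_col (g : Equiv.Perm (Cell μ))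
    (hg : ∀ c d : Cell μ, c.1.2 = d.1.2 → (g c).1.1 = (g d).1.1 → c = d) :
    ∃ p q : Equiv.Perm (Cell μ), (∀ c, (p c).1.1 = c.1.1) ∧ (∀ c, (q c).1.2 = c.1.2) ∧ g = p * q := by
  have hle (j k : ℕ) : (Finset.univ.filter fun c : Cell μ => c.1.2 = j ∧ (g c).1.1 < k).card ≤
      min k (μ.colLen j) := by
    refine le_min ?_ ?_
    · conv_rhs => rw [← Finset.card_range k]
      refine Finset.card_le_card_of_injOn (fun c => (g c).1.1) (fun c hc => ?_) fun c hc d hd h => ?_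
      · simpa using (Finset.mem_filter.1 hc).2.2
      · exact hg c d ((Finset.mem_filter.1 hc).2.1.trans (Finset.mem_filter.1 hd).2.1.symm) h
    · rw [← card_col]
      exact Finset.card_le_card fun c hc => by simp_all
  have hsum (k : ℕ) : ∑ j ∈ Finset.univ.image (fun c : Cell μ => c.1.2),
        (Finset.univ.filter fun c : Cell μ => c.1.2 = j ∧ (g c).1.1 < k).card =
      ∑ j ∈ Finset.univ.image (fun c : Cell μ => c.1.2), min k (μ.colLen j) := by
    have h (u : Cell μ → ℕ) :
        (Finset.univ.filter fun c : Cell μ => u c < k).card =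
        ∑ j ∈ Finset.univ.image (fun c : Cell μ => c.1.2),
          (Finset.univ.filter fun c : Cell μ => c.1.2 = j ∧ u c < k).card := by
      rw [Finset.card_eq_sum_card_fiberwise (f := fun c : Cell μ => c.1.2)
        (t := Finset.univ.image (fun c : Cell μ => c.1.2)) fun c _ => by simp]
      refine Finset.sum_congr rfl fun j _ => ?_
      rw [Finset.filter_filter]
      simp only [and_comm]
    simp_rw [← card_col_lt (μ := μ), ← h (fun c => (g c).1.1), ← h (fun c => c.1.1)]
    exact Finset.card_equiv g fun c => by simp
  have hrow (c : Cell μ) : (g c).1.1 < μ.colLen c.1.2 := by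
    have h1 := (Finset.sum_eq_sum_iff_of_le fun j _ => hle j (μ.colLen c.1.2)).1
      (hsum (μ.colLen c.1.2)) c.1.2 (Finset.mem_image_of_mem _ (Finset.mem_univ c))
    rw [min_self, ← card_col] at h1
    have h2 := Finset.eq_of_subset_of_card_le
      (fun d hd => Finset.mem_filter.2 ⟨Finset.mem_univ _, (Finset.mem_filter.1 hd).2.1⟩) h1.ge
    have h3 : c ∈ (Finset.univ.filter fun d : Cell μ => d.1.2 = c.1.2) := by simp
    rw [← h2] at h3
    have := (Finset.mem_filter.1 h3).2.2
    rwa [card_col] at this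
  let q' : Cell μ → Cell μ := fun c =>
    ⟨((g c).1.1, c.1.2), YoungDiagram.mem_iff_lt_colLen.2 (hrow c)⟩
  have hq' : Function.Injective q' := fun c d h => by
    have h1 : (q' c).1.1 = (q' d).1.1 := by rw [h]
    have h2 : (q' c).1.2 = (q' d).1.2 := by rw [h]
    exact hg c d h2 h1
  let q : Equiv.Perm (Cell μ) := Equiv.ofBijective q' (Finite.injective_iff_bijective.1 hq')
  refine ⟨g * q⁻¹, q, fun c => ?_, fun c => rfl, by simp⟩
  have h : (q (q.symm c)).1.1 = c.1.1 := by rw [q.apply_symm_apply]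
  exact h

theorem rowSum_mul_mul_colSum (x : MonoidAlgebra ℂ (Equiv.Perm (Cell μ))) :
    ∃ r : ℂ, rowSum μ * x * colSum μ = r • youngSym μ := by
  induction x using MonoidAlgebra.induction_linear with
  | zero => exact ⟨0, by simp⟩
  | add x y hx hy =>
    obtain ⟨r, hr⟩ := hx
    obtain ⟨s, hs⟩ := hy
    exact ⟨r + s, by rw [mul_add, add_mul, hr, hs, add_smul]⟩
  | single g z =>
    have hz : (single g z : MonoidAlgebra ℂ (Equiv.Perm (Cell μ))) = z • single g 1 := by simp
    suffices h : ∃ r : ℂ, rowSum μ * single g 1 * colSum μ = r • youngSym μ by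
      obtain ⟨r, hr⟩ := h
      exact ⟨z * r, by rw [hz, mul_smul_comm, smul_mul_assoc, hr, smul_smul]⟩
    by_cases hg : ∀ c d : Cell μ, c.1.2 = d.1.2 → (g c).1.1 = (g d).1.1 → c = d
    · obtain ⟨p, q, hp, hq, rfl⟩ := exists_row_mul_col g hg
      refine ⟨sg (Equiv.Perm.sign q), ?_⟩
      rw [← one_mul (1 : ℂ), ← MonoidAlgebra.single_mul_single, ← mul_assoc, rowSum_mul_single p hp,
        mul_assoc, single_mul_colSum q hq, mul_smul_comm, youngSym_eq]
    · push Not at hg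
      obtain ⟨c, d, hcd, hr, hne⟩ := hg
      refine ⟨0, ?_⟩
      -- The transposition `(g c, g d)` can be absorbed into `rowSum`, and its conjugate `(c, d)` changes the
      -- sign of `colSum`.
      have h1 := rowSum_mul_single (Equiv.swap (g c) (g d)) fun x => by
        rcases eq_or_ne x (g c) with rfl | h
        · simp [hr]
        rcases eq_or_ne x (g d) with rfl | h'
        · simp [hr]
        · rw [Equiv.swap_apply_of_ne_of_ne h h']
      have h2 := single_mul_colSum (Equiv.swap c d) fun x => by
        rcases eq_or_ne x c with rfl | h
        · simp [hcd]
        rcases eq_or_ne x d with rfl | h'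
        · simp [hcd]
        · rw [Equiv.swap_apply_of_ne_of_ne h h']
      have h3 : single (Equiv.swap (g c) (g d)) (1 : ℂ) * single g 1 =
          single g 1 * single (Equiv.swap c d) 1 := by
        rw [MonoidAlgebra.single_mul_single, MonoidAlgebra.single_mul_single, Equiv.mul_swap_eq_swap_mul]
      have h4 : rowSum μ * single g 1 * colSum μ = -(rowSum μ * single g 1 * colSum μ) := by
        conv_lhs => rw [← h1, mul_assoc, mul_assoc, ← mul_assoc (single _ _), h3, mul_assoc, h2]
        simp [Equiv.Perm.sign_swap hne, sg, mul_assoc]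
      rw [zero_smul]
      have h5 := eq_neg_iff_add_eq_zero.1 h4
      rw [← two_smul ℂ] at h5
      exact (smul_eq_zero.1 h5).resolve_left two_ne_zero

theorem youngSym_mul_mul_youngSym (x : MonoidAlgebra ℂ (Equiv.Perm (Cell μ))) :
    ∃ r : ℂ, youngSym μ * x * youngSym μ = r • youngSym μ := by
  obtain ⟨r, hr⟩ := rowSum_mul_mul_colSum (μ := μ) (colSum μ * x * rowSum μ)
  refine ⟨r, ?_⟩
  rw [← hr]
  simp only [youngSym_eq, mul_assoc]

theorem coeff_one_youngSym : (youngSym μ).coeff 1 = 1 := by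
  classical
  rw [youngSym]
  simp only [MonoidAlgebra.coeff_sum, Finsupp.finsetSum_apply]
  rw [Finset.sum_eq_single 1, Finset.sum_eq_single 1]
  · simp [sg]
  · intro q _ hq
    simp [hq]
  · simp
  · intro p hp hp1
    refine Finset.sum_eq_zero fun q hq => ?_
    rw [MonoidAlgebra.coeff_single, Finsupp.single_apply, if_neg]
    intro h
    have hq1 : q = 1 := Equiv.ext fun c => Subtype.ext <| Prod.ext
      (((Finset.mem_filter.1 hp).2 (q c)).symm.trans (congrArg (fun f : Equiv.Perm (Cell μ) => (f c).1.1) h))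
      ((Finset.mem_filter.1 hq).2 c)
    rw [hq1, mul_one] at h
    exact hp1 h
  · simp

theorem youngSym_ne_zero : youngSym μ ≠ 0 := fun h => by
  have := coeff_one_youngSym (μ := μ)
  simp [h] at this

/-- The group algebra of a finite group is semiprime. -/
theorem eq_zero_of_mul_mul_eq_zero {G : Type} [Group G] [Finite G] (x : MonoidAlgebra ℂ G)
    (h : ∀ y, x * y * x = 0) : x = 0 := by
  have : NeZero (Nat.card G : ℂ) := ⟨Nat.cast_ne_zero.2 Nat.card_pos.ne'⟩
  obtain ⟨e, he, hI⟩ := IsSemisimpleRing.ideal_eq_span_idempotent (Ideal.span {x})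
  obtain ⟨y, hy⟩ := Ideal.mem_span_singleton'.1 (hI ▸ Ideal.mem_span_singleton_self e : e ∈ Ideal.span {x})
  obtain ⟨z, hz⟩ := Ideal.mem_span_singleton'.1 (hI ▸ Ideal.mem_span_singleton_self x : x ∈ Ideal.span {e})
  have : e = 0 := by
    rw [← he.eq, ← hy, mul_assoc, ← mul_assoc x, h, mul_zero]
  rw [← hz, this, mul_zero]

/-- The Young symmetrizer is a nonzero multiple of an idempotent. Otherwise its square would be zero, while
the trace of the multiplication by it is not zero. -/
theorem youngSym_mul_self : ∃ m : ℂ, m ≠ 0 ∧ youngSym μ * youngSym μ = m • youngSym μ := by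
  obtain ⟨m, hm⟩ := youngSym_mul_mul_youngSym (μ := μ) 1
  rw [mul_one] at hm
  refine ⟨m, ?_, hm⟩
  rintro rfl
  rw [zero_smul] at hm
  have h1 : IsNilpotent (LinearMap.mulRight ℂ (youngSym μ)) :=
    ⟨2, LinearMap.ext fun x => by simp [pow_two, mul_assoc, hm]⟩
  have h2 := (LinearMap.isNilpotent_trace_of_isNilpotent h1).eq_zero
  rw [LinearMap.trace_eq_matrix_trace ℂ (MonoidAlgebra.basis (Equiv.Perm (Cell μ)) ℂ), Matrix.trace,
    Finset.sum_congr rfl fun g _ => show _ = (1 : ℂ) from ?_] at h2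
  · simp [Fintype.card_ne_zero] at h2
  · rw [Matrix.diag_apply, LinearMap.toMatrix_apply, MonoidAlgebra.basis_apply]
    change (single g 1 * youngSym μ).coeff g = 1
    rw [MonoidAlgebra.coeff_single_mul_apply, inv_mul_cancel, coeff_one_youngSym, mul_one]

end Young

/-! ### Equivariant maps between tensor powers -/

section TensorHom

theorem exists_mem_span_tbas {ι : Type} [Finite ι] (x : ⨂[ℂ] _ : ι, Cinf) :
    ∃ m : ℕ, x ∈ Submodule.span ℂ (tbas '' {f : ι → ℕ | ∀ a, f a < m}) := by
  classical
  have := Fintype.ofFinite ι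
  let B : Module.Basis (ι → ℕ) ℂ (⨂[ℂ] _ : ι, Cinf) := Basis.piTensorProduct fun _ : ι => bas
  refine ⟨(B.repr x).support.sup (fun f => Finset.univ.sup f) + 1, ?_⟩
  have hx := B.linearCombination_repr x
  rw [Finsupp.linearCombination_apply] at hx
  set m := (B.repr x).support.sup (fun f => Finset.univ.sup f) + 1 with hm
  rw [← hx]
  refine Submodule.sum_mem _ fun f hf => Submodule.smul_mem _ _ (Submodule.subset_span ⟨f, ?_, ?_⟩)
  · intro a
    exact Nat.lt_succ_of_le ((Finset.le_sup (f := f) (Finset.mem_univ a)).trans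
      (Finset.le_sup (f := fun f : ι → ℕ => Finset.univ.sup f) hf))
  · exact (Basis.piTensorProduct_apply (fun _ : ι => bas) f).symm

/-- A map between tensor powers that commutes with `GL_∞` is determined by its value at a basis tensor `e_j` with
pairwise different factors. -/
theorem eq_polOp_of_mem_tensorHoms {J ι : Type} [Fintype J] [DecidableEq J] [Fintype ι] [DecidableEq ι]
    (j : J → ℕ) (hj : Function.Injective j) (φ : tensorHoms J (tensorRep ι)) (x : ⨂[ℂ] _ : J, Cinf) :
    φ.1 x = polOp j (φ.1 (tbas j)) x := by
  suffices h : φ.1 = polOp j (φ.1 (tbas j)) from LinearMap.congr_fun h x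
  refine tensor_ext_tprod fun w => ?_
  obtain ⟨m, hm⟩ := exists_mem_span_tbas (φ.1 (tbas j))
  obtain ⟨θ, h1, -⟩ := exists_groupAlgebra_polD j w (max (Fintype.card J) (Fintype.card ι))
    (max m (Finset.univ.sup j + 1))
  have h2 := h1 J j (le_max_left _ _) fun a =>
    (Nat.lt_succ_of_le (Finset.le_sup (Finset.mem_univ a))).trans_le (le_max_right _ _)
  have h3 : ∀ x ∈ Submodule.span ℂ (tbas '' {f : ι → ℕ | ∀ a, f a < m}),
      (tensorRep ι).asAlgebraHom θ x = polOp j x (PiTensorProduct.tprod ℂ w) := by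
    intro x hx
    induction hx using Submodule.span_induction with
    | mem x hx =>
      obtain ⟨f, hf, rfl⟩ := hx
      exact h1 ι f (le_max_right _ _) fun a => (hf a).trans_le (le_max_left _ _)
    | zero => simp
    | add x y _ _ hx hy => rw [map_add, map_add, hx, hy, LinearMap.add_apply]
    | smul c x _ hx => rw [map_smul, map_smul, hx, LinearMap.smul_apply]
  rw [polOp_tbas_self j hj] at h2
  rw [← h3 _ hm, ← h2]
  exact asAlgebraHom_equivariant _ _ φ.1 φ.2 θ _

/-- There are no nonzero equivariant maps between tensor powers of different degrees. -/
theorem eq_zero_of_mem_tensorHoms {J ι : Type} [Fintype J] [Fintype ι]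
    (h : Fintype.card ι ≠ Fintype.card J) (φ : tensorHoms J (tensorRep ι)) : φ = 0 := by
  classical
  refine Subtype.ext <| LinearMap.ext fun x => ?_
  rw [eq_polOp_of_mem_tensorHoms (fun a => (Fintype.equivFin J a : ℕ))
    (fun a b hab => (Fintype.equivFin J).injective (Fin.ext hab)) φ x, polOp_apply]
  have : IsEmpty (ι ≃ J) := ⟨fun e => h (Fintype.card_congr e)⟩
  simp

theorem permRep_tbas {J : Type} (σ : Equiv.Perm J) (j : J → ℕ) : permRep J σ (tbas j) = tbas (j ∘ σ.symm) :=
  permOp_tprod σ _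

theorem asAlgebraHom_permRep_mem {J : Type} (a : MonoidAlgebra ℂ (Equiv.Perm J)) :
    (permRep J).asAlgebraHom a ∈ tensorHoms J (tensorRep J) := by
  intro g x
  induction a using MonoidAlgebra.induction_linear with
  | zero => simp
  | add x y hx hy => simp [hx, hy]
  | single τ z =>
    rw [Representation.asAlgebraHom_single, LinearMap.smul_apply, LinearMap.smul_apply, map_smul]
    exact congrArg (z • ·) (LinearMap.congr_fun (permRep_tensorRep J τ g).eq x)

variable {J : Type} [Fintype J]

theorem tcoord_asAlgebraHom (j : J → ℕ) (hj : Function.Injective j)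
    (a : MonoidAlgebra ℂ (Equiv.Perm J)) (σ : Equiv.Perm J) :
    tcoord (j ∘ σ.symm) ((permRep J).asAlgebraHom a (tbas j)) = a.coeff σ := by
  classical
  induction a using MonoidAlgebra.induction_linear with
  | zero => simp
  | add x y hx hy => simp [hx, hy]
  | single τ z =>
    rw [Representation.asAlgebraHom_single, LinearMap.smul_apply, permRep_tbas, map_smul, tcoord_tbas,
      MonoidAlgebra.coeff_single, Finsupp.single_apply]
    have : (j ∘ τ.symm = j ∘ σ.symm) ↔ τ = σ := by
      rw [hj.comp_left.eq_iff]
      exact ⟨fun h => Equiv.symm_bijective.injective (DFunLike.coe_injective h), fun h => by rw [h]⟩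
    simp [this]

theorem asAlgebraHom_tbas_injective (j : J → ℕ) (hj : Function.Injective j)
    {a b : MonoidAlgebra ℂ (Equiv.Perm J)}
    (h : (permRep J).asAlgebraHom a (tbas j) = (permRep J).asAlgebraHom b (tbas j)) : a = b := by
  refine MonoidAlgebra.coeff_injective (Finsupp.ext fun σ => ?_)
  rw [← tcoord_asAlgebraHom j hj, h, tcoord_asAlgebraHom j hj]

theorem asAlgebraHom_permRep_injective : Function.Injective (permRep J).asAlgebraHom := fun a b h =>
  asAlgebraHom_tbas_injective (fun a => (Fintype.equivFin J a : ℕ))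
    (fun a b hab => (Fintype.equivFin J).injective (Fin.ext hab)) (by rw [h])

/-- The endomorphisms of `(ℂ^∞)^{⊗ J}` that commute with `GL_∞` are given by the group algebra of the symmetric
group. -/
theorem exists_asAlgebraHom_permRep (φ : tensorHoms J (tensorRep J)) :
    ∃ a : MonoidAlgebra ℂ (Equiv.Perm J), φ.1 = (permRep J).asAlgebraHom a := by
  classical
  let j : J → ℕ := fun a => (Fintype.equivFin J a : ℕ)
  refine ⟨∑ σ : Equiv.Perm J, MonoidAlgebra.single σ.symm (tcoord (j ∘ σ) (φ.1 (tbas j))),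
    LinearMap.ext fun x => ?_⟩
  rw [eq_polOp_of_mem_tensorHoms j
    (fun a b hab => (Fintype.equivFin J).injective (Fin.ext hab)) φ x, polOp_apply, map_sum,
    LinearMap.sum_apply]
  refine Finset.sum_congr rfl fun σ _ => ?_
  rw [Representation.asAlgebraHom_single]
  rfl

end TensorHom

/-! ### Simplicity of the modules attached to partitions -/

section Simple

variable {ε : ℤˣ} {μ : YoungDiagram}

/-- The map is given by an element `a` of the group algebra with `c a = m a`, where `c` is the Young symmetrizer and
`c² = m c`. If `a ≠ 0`, then `a z a ≠ 0` for some `z`, so `a z c` is a nonzero multiple of `c`, and `c` factors through `a`. -/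
theorem surjective_of_mem_tensorHoms {n : ℕ} (φ : tensorHoms (Fin n) (schurRep μ)) (hφ : φ ≠ 0) :
    Function.Surjective φ.1 := by
  classical
  let ψ₀ : tensorHoms (Fin n) (tensorRep (Cell μ)) := ⟨(SchurFunctor μ).subtype ∘ₗ φ.1, fun g x => by
    rw [LinearMap.comp_apply, φ.2]; rfl⟩
  have hψ₀ : ψ₀ ≠ 0 := fun h => hφ <| Subtype.ext <| LinearMap.ext fun x =>
    Subtype.ext (LinearMap.congr_fun (congrArg Subtype.val h) x)
  have hcard : Fintype.card (Cell μ) = n := by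
    by_contra h
    exact hψ₀ (eq_zero_of_mem_tensorHoms (by simpa using h) ψ₀)
  let e : Cell μ ≃ Fin n := Fintype.equivFinOfCardEq hcard
  let ψ : tensorHoms (Cell μ) (tensorRep (Cell μ)) := ⟨ψ₀.1 ∘ₗ (relabel e).toLinearMap, fun g x => by
    refine (congrArg ψ₀.1 (relabel_tensorRep e g x)).trans ?_
    exact ψ₀.2 g _⟩
  obtain ⟨a, ha⟩ := exists_asAlgebraHom_permRep ψ
  have ha0 : a ≠ 0 := by
    rintro rfl
    refine hψ₀ (Subtype.ext <| LinearMap.ext fun x => ?_)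
    have := LinearMap.congr_fun ha ((relabel e).symm x)
    rw [map_zero] at this
    exact (congrArg ψ₀.1 ((relabel e).apply_symm_apply x)).symm.trans this
  obtain ⟨m, hm, hm2⟩ := youngSym_mul_self (μ := μ)
  have hca : youngSym μ * a = m • a := by
    refine asAlgebraHom_permRep_injective (LinearMap.ext fun x => ?_)
    rw [map_mul, map_smul, ← ha, Module.End.mul_apply, LinearMap.smul_apply]
    obtain ⟨y, hy⟩ := (φ.1 (relabel e x)).2
    have hy' : ψ.1 x = youngOp μ y := hy.symm
    rw [hy', youngOp, ← Module.End.mul_apply, ← map_mul, hm2, map_smul, LinearMap.smul_apply]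
  obtain ⟨z, hz⟩ : ∃ z, a * z * a ≠ 0 := by
    by_contra! h
    exact ha0 (eq_zero_of_mul_mul_eq_zero a h)
  obtain ⟨r, hr⟩ := youngSym_mul_mul_youngSym (μ := μ) (a * z)
  have hr2 : m • (a * z * youngSym μ) = r • youngSym μ := by
    rw [← hr, ← mul_assoc, hca, smul_mul_assoc, smul_mul_assoc]
  have hr0 : r ≠ 0 := by
    rintro rfl
    rw [zero_smul] at hr2
    have h1 := (smul_eq_zero.1 hr2).resolve_left hm
    refine hz ?_
    have h2 : m • (a * z * a) = 0 := by rw [← mul_smul_comm, ← hca, ← mul_assoc, h1, zero_mul]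
    exact (smul_eq_zero.1 h2).resolve_left hm
  rintro ⟨_, x, rfl⟩
  refine ⟨(r⁻¹ * m) • relabel e ((permRep _).asAlgebraHom (z * youngSym μ) x), Subtype.ext ?_⟩
  have h3 : ∀ y, (φ.1 (relabel e y)).1 = (permRep _).asAlgebraHom a y := fun y =>
    LinearMap.congr_fun ha y
  have h4 : (r⁻¹ * m) • (a * (z * youngSym μ)) = youngSym μ := by
    rw [← mul_assoc, mul_smul, hr2, smul_smul, inv_mul_cancel₀ hr0, one_smul]
  rw [map_smul, Submodule.coe_smul, h3, ← Module.End.mul_apply, ← map_mul, ← LinearMap.smul_apply,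
    ← map_smul, h4]
  rfl

/-- The kernel of a map of modules. -/
def UMod.kernel {M N : UMod ε} (f : M ⟶ N) : UMod ε where
  carrier := LinearMap.ker f.1
  ρ :=
    { toFun := fun g => (M.ρ g).restrict fun x hx => by
        rw [LinearMap.mem_ker] at hx ⊢; rw [f.2.2, hx, map_zero]
      map_one' := by ext x; simp
      map_mul' := fun g h => by ext x; simp }
  polynomial := M.polynomial.submodule _ (LinearMap.ker f.1).subtype Subtype.val_injective fun g x => rfl
  act :=
    { toFun := fun u => (M.act u).restrict fun x hx => by
        rw [LinearMap.mem_ker] at hx ⊢; rw [f.2.1, hx, map_zero]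
      map_one' := by ext x; simp
      map_mul' := fun g h => by ext x; simp
      map_zero' := by ext x; simp
      map_add' := fun g h => by ext x; simp
      commutes' := fun r => by ext x; simp [AlgHom.commutes, Module.algebraMap_end_apply] }
  compat g u m := Subtype.ext (M.compat g u m.1)

theorem UMod.injective_of_mono {M N : UMod ε} (f : M ⟶ N) [Mono f] : Function.Injective f.1 := by
  let i : UMod.kernel f ⟶ M := ⟨(LinearMap.ker f.1).subtype, fun _ _ => rfl, fun _ _ => rfl⟩
  have h : i ≫ f = 0 ≫ f := by
    rw [Limits.zero_comp]
    exact Subtype.ext (LinearMap.ext fun x => x.2)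
  have h2 := (cancel_mono f).1 h
  rw [← LinearMap.ker_eq_bot, Submodule.eq_bot_iff]
  exact fun x hx => LinearMap.congr_fun (congrArg Subtype.val h2) (⟨x, hx⟩ : LinearMap.ker f.1)

theorem UMod.isIso_of_bijective {M N : UMod ε} (f : M ⟶ N) (hf : Function.Bijective f.1) : IsIso f := by
  let e := LinearEquiv.ofBijective f.1 hf
  have he : ∀ x, e x = f.1 x := fun _ => rfl
  let g : N ⟶ M := ⟨e.symm.toLinearMap, fun u m => by
      rw [LinearEquiv.coe_coe, LinearEquiv.symm_apply_eq, he, f.2.1, ← he, LinearEquiv.apply_symm_apply],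
    fun a m => by
      rw [LinearEquiv.coe_coe, LinearEquiv.symm_apply_eq, he, f.2.2, ← he, LinearEquiv.apply_symm_apply]⟩
  exact ⟨g, Subtype.ext (LinearMap.ext e.symm_apply_apply), Subtype.ext (LinearMap.ext e.apply_symm_apply)⟩

theorem simpleU_simple (ε : ℤˣ) (μ : YoungDiagram) : Simple (simpleU ε μ) where
  mono_isIso_iff_nonzero {M} f _ := by
    constructor
    · rintro h rfl
      have h1 : 𝟙 (simpleU ε μ) = 0 := by
        rw [← IsIso.inv_hom_id (0 : M ⟶ simpleU ε μ), Limits.comp_zero]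
      refine youngSym_ne_zero (μ := μ) (asAlgebraHom_permRep_injective (LinearMap.ext fun x => ?_))
      rw [map_zero]
      exact congrArg Subtype.val (LinearMap.congr_fun (congrArg Subtype.val h1)
        (⟨youngOp μ x, x, rfl⟩ : SchurFunctor μ))
    · intro hf
      refine UMod.isIso_of_bijective f ⟨UMod.injective_of_mono f, ?_⟩
      obtain ⟨n, φ, hφ⟩ : ∃ (n : ℕ) (φ : tensorHoms (Fin n) M.ρ), tensorHomsPost f (Fin n) φ ≠ 0 := by
        by_contra! h
        refine hf (Subtype.ext (LinearMap.ker_eq_top.1 ?_))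
        rw [← top_le_iff, ← M.polynomial.span_eq_top, Submodule.span_le]
        rintro _ ⟨n, φ, w, rfl⟩
        exact LinearMap.congr_fun (congrArg Subtype.val (h n φ)) w
      intro x
      obtain ⟨y, hy⟩ := surjective_of_mem_tensorHoms _ hφ x
      exact ⟨φ.1 y, hy⟩

end Simple

/-! ### Signs of reorderings -/

section Signs

open Classical

/-- The product of `σ p q` over the pairs that are ordered differently by the injections `u` and `v`. -/
def inversionProd {L : Type} [Fintype L] (σ : L → L → ℂ) (u v : L → ℕ) : ℂ :=
  ∏ p : L × L with u p.1 < u p.2 ∧ v p.2 < v p.1, σ p.1 p.2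

/-- The products over inversions form a cocycle, because a pair that is inverted twice contributes a square. -/
theorem inversionProd_mul {L : Type} [Fintype L] (σ : L → L → ℂ) (hσ : ∀ p q, σ p q = σ q p)
    (hσ2 : ∀ p q, σ p q * σ p q = 1) (u v w : L → ℕ) (hu : Function.Injective u)
    (hv : Function.Injective v) (hw : Function.Injective w) :
    inversionProd σ u v * inversionProd σ v w = inversionProd σ u w := by
  have key : inversionProd σ v w = ∏ p : L × L,
      ((if u p.1 < u p.2 then (if v p.1 < v p.2 ∧ w p.2 < w p.1 then σ p.1 p.2 else 1) else 1) *
        (if u p.1 < u p.2 then (if v p.2 < v p.1 ∧ w p.1 < w p.2 then σ p.2 p.1 else 1) else 1)) := by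
    rw [Finset.prod_mul_distrib, inversionProd, Finset.prod_filter]
    have h : ∏ p : L × L, (if u p.1 < u p.2 then
          (if v p.2 < v p.1 ∧ w p.1 < w p.2 then σ p.2 p.1 else 1) else 1) =
        ∏ p : L × L, (if u p.2 < u p.1 then
          (if v p.1 < v p.2 ∧ w p.2 < w p.1 then σ p.1 p.2 else 1) else 1) :=
      Fintype.prod_equiv (Equiv.prodComm L L) _ _ fun p => rfl
    rw [h, ← Finset.prod_mul_distrib]
    refine Finset.prod_congr rfl fun p _ => ?_
    rcases lt_trichotomy (u p.1) (u p.2) with h | h | h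
    · simp [h, h.not_gt]
    · have := hu h
      simp [this]
    · simp [h, h.not_gt]
  rw [key, inversionProd, inversionProd, Finset.prod_filter, Finset.prod_filter, ← Finset.prod_mul_distrib]
  refine Finset.prod_congr rfl fun p _ => ?_
  rcases lt_trichotomy (u p.1) (u p.2) with h | h | h
  · have hne : p.1 ≠ p.2 := fun h' => by simp [h'] at h
    rcases lt_or_gt_of_ne (hv.ne hne) with h1 | h1 <;> rcases lt_or_gt_of_ne (hw.ne hne) with h2 | h2 <;>
      simp [h, h1, h2, h1.not_gt, h2.not_gt, hσ p.2 p.1, hσ2]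
  · simp [h]
  · simp [h.not_gt]

/-- The sign by which the symmetry of `𝐕 ⊗ 𝐕` acts. -/
def swapSign (ε : ℤˣ) (x y : VB) : ℂ := sg ε * koszul ε x y

variable {ε : ℤˣ}

theorem swapSign_comm (x y : VB) : swapSign ε x y = swapSign ε y x := by
  rw [swapSign, swapSign, koszul_comm]

theorem swapSign_mul_self (x y : VB) : swapSign ε x y * swapSign ε x y = 1 := by
  rw [swapSign, mul_mul_mul_comm, sg_mul_self, koszul_mul_self, one_mul]

/-- A list that contains every element exactly once. -/
structure IsEnum {L : Type} (l : List L) : Prop where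
  nodup : l.Nodup
  mem : ∀ a, a ∈ l

theorem IsEnum.perm {L : Type} {l l' : List L} (h : IsEnum l) (h' : l'.Perm l) : IsEnum l' :=
  ⟨h'.nodup_iff.2 h.nodup, fun a => h'.mem_iff.2 (h.mem a)⟩

theorem IsEnum.idxOf_injective {L : Type} {l : List L} (h : IsEnum l) :
    Function.Injective fun p => l.idxOf p :=
  fun p _ hpq => (List.idxOf_inj (h.mem p)).1 hpq

variable {L : Type} [Fintype L]

theorem reorderSign_eq (c : L → VB) (l l' : List L) : reorderSign ε c l l' =
    inversionProd (fun p q => swapSign ε (c p) (c q)) (fun p => l.idxOf p) fun p => l'.idxOf p := rfl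

theorem isEnum_enum : IsEnum (enum L) := ⟨Finset.nodup_toList _, fun a => by simp [enum]⟩

theorem reorderSign_mul (c : L → VB) {l l' l'' : List L} (h : IsEnum l) (h' : IsEnum l')
    (h'' : IsEnum l'') :
    reorderSign ε c l l' * reorderSign ε c l' l'' = reorderSign ε c l l'' := by
  rw [reorderSign_eq, reorderSign_eq, reorderSign_eq]
  exact inversionProd_mul _ (fun _ _ => swapSign_comm _ _) (fun _ _ => swapSign_mul_self _ _) _ _ _
    h.idxOf_injective h'.idxOf_injective h''.idxOf_injective

theorem reorderSign_self (c : L → VB) (l : List L) : reorderSign ε c l l = 1 := by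
  rw [reorderSign, Finset.filter_false_of_mem, Finset.prod_empty]
  rintro p - ⟨h1, h2⟩
  exact h1.not_gt h2

theorem reorderSign_swap (c : L → VB) (A B : List L) (x y : L) (h : (A ++ x :: y :: B).Nodup) :
    reorderSign ε c (A ++ x :: y :: B) (A ++ y :: x :: B) = swapSign ε (c x) (c y) := by
  rw [reorderSign]
  have hxy : x ≠ y := by
    rintro rfl
    simp [List.nodup_append] at h
  have hxA : x ∉ A := fun hA => (List.nodup_append.1 h).2.2 x hA x (by simp) rfl
  have hyA : y ∉ A := fun hA => (List.nodup_append.1 h).2.2 y hA y (by simp) rfl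
  have h1 : ∀ z, (A ++ x :: y :: B).idxOf z = if z ∈ A then A.idxOf z else if z = x then A.length
      else if z = y then A.length + 1 else A.length + 2 + B.idxOf z := by
    intro z
    rw [List.idxOf_append, List.idxOf_cons, List.idxOf_cons]
    simp only [cond_eq_ite, beq_iff_eq, eq_comm (b := z)]
    split_ifs <;> omega
  have h2 : ∀ z, (A ++ y :: x :: B).idxOf z = if z ∈ A then A.idxOf z else if z = y then A.length
      else if z = x then A.length + 1 else A.length + 2 + B.idxOf z := by
    intro z
    rw [List.idxOf_append, List.idxOf_cons, List.idxOf_cons]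
    simp only [cond_eq_ite, beq_iff_eq, eq_comm (b := z)]
    split_ifs <;> omega
  have h3 : (Finset.univ.filter fun p : L × L =>
      (A ++ x :: y :: B).idxOf p.1 < (A ++ x :: y :: B).idxOf p.2 ∧
        (A ++ y :: x :: B).idxOf p.2 < (A ++ y :: x :: B).idxOf p.1) = {(x, y)} := by
    ext ⟨p, q⟩
    have hA : ∀ z ∈ A, A.idxOf z < A.length := fun z hz => List.idxOf_lt_length_iff.2 hz
    simp only [Finset.mem_filter, Finset.mem_univ, true_and, Finset.mem_singleton, Prod.mk.injEq, h1, h2]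
    constructor
    · rintro ⟨h3, h4⟩
      by_cases hp : p ∈ A <;> by_cases hq : q ∈ A
      · simp only [hp, hq, if_true] at h3 h4; omega
      · have := hA p hp
        simp only [hp, hq, if_true, if_false] at h3 h4; split_ifs at h3 h4 <;> omega
      · have := hA q hq
        simp only [hp, hq, if_true, if_false] at h3 h4; split_ifs at h3 h4 <;> omega
      · simp only [hp, hq, if_false] at h3 h4
        split_ifs at h3 h4 <;> first | omega | exact ⟨by assumption, by assumption⟩
    · rintro ⟨rfl, rfl⟩
      simp [hxA, hyA, hxy, hxy.symm]
  refine (Finset.prod_congr h3 fun _ _ => rfl).trans ?_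
  rw [Finset.prod_singleton, swapSign]

theorem idxOf_map_of_injective {α β : Type} {f : α → β} (hf : Function.Injective f) (a : α) (l : List α) :
    (l.map f).idxOf (f a) = l.idxOf a := by
  induction l with
  | nil => rfl
  | cons b l ih =>
    rw [List.map_cons]
    by_cases h : b = a
    · rw [List.idxOf_cons_eq _ h, List.idxOf_cons_eq _ (congrArg f h)]
    · rw [List.idxOf_cons_ne _ h, List.idxOf_cons_ne _ (hf.ne h), ih]

/-- The sign of a reordering of the first factors only does not depend on the last ones. -/
theorem reorderSign_map_append {L₂ : Type} [Fintype L₂] (c : L → VB) (f : L₂ → L)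
    (hf : Function.Injective f) {l l' : List L₂} (h : IsEnum l) (h' : IsEnum l') (T : List L) :
    reorderSign ε c (l.map f ++ T) (l'.map f ++ T) = reorderSign ε (c ∘ f) l l' := by
  have hlen : l.length = l'.length :=
    ((List.perm_ext_iff_of_nodup h.nodup h'.nodup).2 fun a => by simp [h.mem, h'.mem]).length_eq
  have h1 : ∀ {l : List L₂}, IsEnum l → ∀ a, (l.map f ++ T).idxOf (f a) = l.idxOf a := by
    intro l h a
    rw [List.idxOf_append, if_pos (List.mem_map_of_mem (h.mem a))]
    exact idxOf_map_of_injective hf a l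
  have h2 : ∀ {l : List L₂}, IsEnum l → ∀ p, p ∉ Set.range f →
      (l.map f ++ T).idxOf p = T.idxOf p + l.length := by
    intro l h p hp
    rw [List.idxOf_append, if_neg, List.length_map]
    intro hm
    obtain ⟨a, -, rfl⟩ := List.mem_map.1 hm
    exact hp ⟨a, rfl⟩
  have h3 : ∀ {l : List L₂}, IsEnum l → ∀ a, l.idxOf a < l.length := fun h a =>
    List.idxOf_lt_length_iff.2 (h.mem a)
  symm
  refine Finset.prod_bij (fun p _ => (f p.1, f p.2)) (fun p hp => ?_) (fun p _ q _ hpq => ?_)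
    (fun p hp => ?_) fun p _ => rfl
  · simpa [h1 h, h1 h'] using hp
  · exact Prod.ext (hf (Prod.ext_iff.1 hpq).1) (hf (Prod.ext_iff.1 hpq).2)
  · obtain ⟨p, q⟩ := p
    obtain ⟨h4, h5⟩ := (Finset.mem_filter.1 hp).2
    dsimp only at h4 h5
    by_cases hp' : p ∈ Set.range f <;> by_cases hq : q ∈ Set.range f
    · obtain ⟨a, rfl⟩ := hp'
      obtain ⟨b, rfl⟩ := hq
      rw [h1 h, h1 h] at h4
      rw [h1 h', h1 h'] at h5
      exact ⟨(a, b), by simp [h4, h5], rfl⟩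
    · obtain ⟨a, rfl⟩ := hp'
      rw [h1 h', h2 h' q hq] at h5
      have := h3 h' a
      omega
    · obtain ⟨b, rfl⟩ := hq
      rw [h1 h, h2 h p hp'] at h4
      have := h3 h b
      omega
    · rw [h2 h p hp', h2 h q hq] at h4
      rw [h2 h' p hp', h2 h' q hq] at h5
      omega

/-- The effect on the sign of changing one tensor factor: the factor of parity `|y|` at `a` is replaced by `x`, and
the products are the signs of moving an operator of parity `|x| + |y|` past the factors in front of `a`. -/
theorem reorderSign_update_mul (c : L → VB) {l l' : List L} (h : IsEnum l) (h' : IsEnum l') (a : L)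
    (x y : VB) (hy : ∀ z, koszul ε y z = koszul ε (c a) z) :
    reorderSign ε (Function.update c a x) l l' *
        ∏ j : L with l.idxOf j < l.idxOf a, koszul ε x (c j) * koszul ε y (c j) =
      reorderSign ε c l l' *
        ∏ j : L with l'.idxOf j < l'.idxOf a, koszul ε x (c j) * koszul ε y (c j) := by
  set k : L → ℂ := fun j => koszul ε x (c j) * koszul ε y (c j) with hk
  have hk2 : ∀ j, k j * k j = 1 := fun j => by
    simp only [hk]
    rw [mul_mul_mul_comm, koszul_mul_self, koszul_mul_self, one_mul]
  set P : List L → ℂ := fun l => ∏ j : L with l.idxOf j < l.idxOf a, k j with hP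
  have hP2 : ∀ l, P l * P l = 1 := fun l => by
    simp only [hP, ← Finset.prod_mul_distrib, hk2, Finset.prod_const_one]
  have hR2 : reorderSign ε c l l' * reorderSign ε c l l' = 1 := by
    simp only [reorderSign_eq, inversionProd, ← Finset.prod_mul_distrib]
    exact Finset.prod_eq_one fun p _ => swapSign_mul_self _ _
  suffices hmain : reorderSign ε (Function.update c a x) l l' * reorderSign ε c l l' = P l * P l' by
    change reorderSign ε (Function.update c a x) l l' * P l = reorderSign ε c l l' * P l'
    calc _ = (reorderSign ε (Function.update c a x) l l' * reorderSign ε c l l') *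
          (reorderSign ε c l l' * P l) := by
            rw [mul_assoc, ← mul_assoc (reorderSign ε c l l'), hR2, one_mul]
      _ = _ := by rw [hmain, mul_comm (P l), mul_assoc, mul_left_comm (P l), hP2, mul_one, mul_comm]
  simp only [reorderSign, hP]
  rw [← Finset.prod_mul_distrib, Finset.prod_filter, Finset.prod_filter, Finset.prod_filter,
    ← Finset.prod_mul_distrib, Fintype.prod_prod_type, ← Finset.mul_prod_erase _ _ (Finset.mem_univ a)]
  have hs : ∀ z, sg ε * koszul ε x z * (sg ε * koszul ε (c a) z) = koszul ε x z * koszul ε y z := by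
    intro z
    rw [mul_mul_mul_comm, sg_mul_self, one_mul, hy]
  have hs' : ∀ z, sg ε * koszul ε z x * (sg ε * koszul ε z (c a)) = koszul ε x z * koszul ε y z := by
    intro z
    rw [koszul_comm ε x z, koszul_comm ε (c a) z, hs]
  have h1 : ∀ p ∈ Finset.univ.erase a, (∏ q : L,
      if l.idxOf p < l.idxOf q ∧ l'.idxOf q < l'.idxOf p then
        (sg ε * koszul ε (Function.update c a x p) (Function.update c a x q)) *
          (sg ε * koszul ε (c p) (c q)) else 1) =
      if l.idxOf p < l.idxOf a ∧ l'.idxOf a < l'.idxOf p then k p else 1 := by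
    intro p hp
    have hpa := (Finset.mem_erase.1 hp).1
    rw [Finset.prod_eq_single a]
    · rw [Function.update_self, Function.update_of_ne hpa, hs']
    · intro q _ hq
      rw [Function.update_of_ne hpa, Function.update_of_ne hq]
      split_ifs
      · exact swapSign_mul_self _ _
      · rfl
    · simp
  rw [Finset.prod_congr rfl h1]
  rw [← Finset.mul_prod_erase _ _ (Finset.mem_univ a), ← Finset.mul_prod_erase _ (fun j => _ * _) (Finset.mem_univ a)]
  simp only [lt_irrefl, false_and, if_false, one_mul]
  rw [← Finset.prod_mul_distrib]
  refine Finset.prod_congr rfl fun p hp => ?_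
  have hpa := (Finset.mem_erase.1 hp).1
  rw [Function.update_self, Function.update_of_ne hpa, hs]
  have hk3 : koszul ε x (c p) * koszul ε y (c p) * (koszul ε x (c p) * koszul ε y (c p)) = 1 := hk2 p
  have e1 := h.idxOf_injective.ne hpa
  have e2 := h'.idxOf_injective.ne hpa
  rcases lt_or_gt_of_ne e1 with h1 | h1 <;> rcases lt_or_gt_of_ne e2 with h2 | h2 <;>
      simp [h1, h2, h1.not_gt, h2.not_gt, hk3, hk]

end Signs

/-! ### The kernel `𝒦` is functorial and equivariant -/

section KernelMaps

open Classical

variable {ε : ℤˣ} (F : FockModule ε) {L L' : Type} [Fintype L] [Fintype L']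

/-- The form is even. -/
theorem koszul_eq_of_form_ne_zero {x y : VB} (h : form ε x y ≠ 0) (z : VB) :
    koszul ε x z = koszul ε y z := by
  cases x <;> cases y <;> cases z <;> simp_all [form, koszul]

theorem word_isEnum (D : BrauerDiagram L' L) : IsEnum D.word := by
  have h : (D.word : Multiset L) = (Finset.univ : Finset L).val := by
    have h1 : ((D.edges.toList.flatMap fun p => [p.2, p.1] : List L) : Multiset L) =
        D.edges.bind fun p => {p.1, p.2} := by
      conv_rhs => rw [← Multiset.coe_toList D.edges]
      rw [← Multiset.coe_bind]
      exact Multiset.bind_congr fun p _ => Multiset.pair_comm _ _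
    rw [D.exhaust, BrauerDiagram.word, ← Multiset.coe_add, ← Multiset.coe_add, h1, ← Multiset.map_coe, enum,
      Finset.coe_toList, Multiset.coe_reverse]
    abel
  exact ⟨by rw [← Multiset.coe_nodup, h]; exact Finset.univ.nodup,
    fun a => by rw [← Multiset.mem_coe, h]; exact Finset.mem_univ a⟩

theorem sum_exhaust {M : Type*} [AddCommMonoid M] (D : BrauerDiagram L' L) (he : D.edges = 0) (g : L → M) :
    ∑ a, g a = ∑ a, g (D.inj a) + (D.circ.map g).sum := by
  have h := congrArg (fun s => (s.map g).sum) D.exhaust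
  simpa [he] using h

theorem prod_exhaust {M : Type*} [CommMonoid M] (D : BrauerDiagram L' L) (he : D.edges = 0) (g : L → M) :
    ∏ a, g a = (∏ a, g (D.inj a)) * (D.circ.map g).prod := by
  have h := congrArg (fun s => (s.map g).prod) D.exhaust
  simpa [he] using h

theorem kerMap_single (D : BrauerDiagram L' L) (c : L → VB) (m : F.carrier) :
    kerMap F D (Finsupp.single c m) =
      (reorderSign ε c (enum L) D.word * (D.edges.map fun p => form ε (c p.2) (c p.1)).prod) •
        Finsupp.single (c ∘ D.inj) ((D.circ.map fun i => F.t (c i)).reverse.prod m) := by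
  rw [kerMap, Finsupp.lsum_single]
  rfl

theorem ker_ext {L : Type} {V : Type*} [AddCommGroup V] [Module ℂ V] {f g : Ker F L →ₗ[ℂ] V}
    (h : ∀ c m, f (Finsupp.single c m) = g (Finsupp.single c m)) : f = g :=
  Finsupp.lhom_ext h

theorem word_of_edges_eq_zero (D : BrauerDiagram L' L) (he : D.edges = 0) :
    D.word = (enum L').map D.inj ++ D.circ.reverse := by
  simp [BrauerDiagram.word, he]

theorem kerMap_comp {L₁ L₂ L₃ : Type} [Fintype L₁] [Fintype L₂] [Fintype L₃] (D : BrauerDiagram L₁ L₂)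
    (D' : BrauerDiagram L₂ L₃) (he : D.edges = 0) (he' : D'.edges = 0) :
    kerMap F (D.comp D') = kerMap F D ∘ₗ kerMap F D' := by
  refine ker_ext F fun c m => ?_
  have hcomp : (D.comp D').edges = 0 := by simp [BrauerDiagram.comp, he, he']
  have hw : (D.comp D').word = D.word.map D'.inj ++ D'.circ.reverse := by
    rw [word_of_edges_eq_zero _ hcomp, word_of_edges_eq_zero _ he]
    simp [BrauerDiagram.comp, List.map_append, Function.comp_def]
  have hs : reorderSign ε c (enum L₃) (D.comp D').word =
      reorderSign ε c (enum L₃) D'.word * reorderSign ε (c ∘ D'.inj) (enum L₂) D.word := by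
    rw [← reorderSign_map_append c D'.inj D'.inj_injective isEnum_enum (word_isEnum D) D'.circ.reverse,
      ← hw, ← word_of_edges_eq_zero _ he',
      reorderSign_mul c isEnum_enum (word_isEnum D') (word_isEnum (D.comp D'))]
  rw [LinearMap.comp_apply, kerMap_single, kerMap_single, map_smul, kerMap_single, smul_smul, hs,
    he, he', hcomp]
  simp only [Multiset.map_zero, Multiset.prod_zero, mul_one]
  congr 2
  rw [← Module.End.mul_apply, ← List.prod_append, ← List.reverse_append]
  simp [BrauerDiagram.comp, Function.comp_def]

theorem kerMap_refl : kerMap F (.ofEquiv (Equiv.refl L)) = LinearMap.id := by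
  refine ker_ext F fun c m => ?_
  rw [kerMap_single]
  have : (BrauerDiagram.ofEquiv (Equiv.refl L)).word = enum L := by
    simp [BrauerDiagram.word, BrauerDiagram.ofEquiv]
  rw [this, reorderSign_self]
  simp [BrauerDiagram.ofEquiv]

/-- The reordering of the tensor factors from the order `l` to the order `l'`. -/
def reorderOp (l l' : List L) : Module.End ℂ (Ker F L) :=
  Finsupp.lsum ℂ fun c : L → VB => reorderSign ε c l l' • Finsupp.lsingle c

/-- The action of `x ∧ y` on `𝐕^{⊗ L} ⊗ Δ`, the tensor factors being taken in the order `l`. -/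
def wedgeList (l : List L) (x y : VB) : Module.End ℂ (Ker F L) :=
  Finsupp.lsum ℂ fun c : L → VB =>
    ∑ i : L, (∏ j : L with l.idxOf j < l.idxOf i, koszul ε x (c j) * koszul ε y (c j)) •
      (form ε y (c i) • Finsupp.lsingle (Function.update c i x) -
        (koszul ε x y * form ε x (c i)) • Finsupp.lsingle (Function.update c i y)) +
    (∏ j : L, koszul ε x (c j) * koszul ε y (c j)) •
      (Finsupp.lsingle c ∘ₗ (F.t x * F.t y - (form ε x y / 2) • 1))

theorem wedgeOp_eq (x y : VB) : wedgeOp F (L := L) x y = wedgeList F (enum L) x y := rfl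

theorem wedgeList_single (l : List L) (x y : VB) (c : L → VB) (m : F.carrier) :
    wedgeList F l x y (Finsupp.single c m) =
      ∑ i : L, (∏ j : L with l.idxOf j < l.idxOf i, koszul ε x (c j) * koszul ε y (c j)) •
        (form ε y (c i) • Finsupp.single (Function.update c i x) m -
          (koszul ε x y * form ε x (c i)) • Finsupp.single (Function.update c i y) m) +
      (∏ j : L, koszul ε x (c j) * koszul ε y (c j)) •
        Finsupp.single c (F.t x (F.t y m) - (form ε x y / 2) • m) := by
  rw [wedgeList, Finsupp.lsum_single, LinearMap.add_apply, LinearMap.sum_apply]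
  rfl

theorem reorderOp_single (l l' : List L) (c : L → VB) (m : F.carrier) :
    reorderOp F l l' (Finsupp.single c m) = reorderSign ε c l l' • Finsupp.single c m := by
  rw [reorderOp, Finsupp.lsum_single]
  rfl

/-- The Leibniz rule does not depend on the order of the tensor factors. This reduces the compatibility with diagrams
to the case where the contracted factor is next to `Δ`. -/
theorem reorderOp_wedgeList {l l' : List L} (h : IsEnum l) (h' : IsEnum l') (x y : VB) :
    reorderOp F l l' ∘ₗ wedgeList F l x y = wedgeList F l' x y ∘ₗ reorderOp F l l' := by
  refine ker_ext F fun c m => ?_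
  rw [LinearMap.comp_apply, LinearMap.comp_apply, reorderOp_single, map_smul, wedgeList_single,
    wedgeList_single, map_add, map_sum, smul_add, Finset.smul_sum, map_smul, reorderOp_single,
    smul_comm (reorderSign ε c l l')]
  refine congrArg₂ _ (Finset.sum_congr rfl fun i _ => ?_) rfl
  rw [map_smul, map_sub, map_smul, map_smul, reorderOp_single, reorderOp_single, smul_sub, smul_sub, smul_sub]
  simp only [smul_smul]
  refine congrArg₂ _ (congrArg (· • _) ?_) (congrArg (· • _) ?_)
  · by_cases hf : form ε y (c i) = 0
    · simp [hf]
    · have := reorderSign_update_mul c h h' i x y fun z => koszul_eq_of_form_ne_zero hf z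
      linear_combination form ε y (c i) * this
  · by_cases hf : form ε x (c i) = 0
    · simp [hf]
    · have := reorderSign_update_mul c h h' i y x fun z => koszul_eq_of_form_ne_zero hf z
      simp only [mul_comm (koszul ε y _)] at this
      linear_combination koszul ε x y * form ε x (c i) * this

/-- The map given by a diagram without edges, the signs being left out. -/
def rawMap (D : BrauerDiagram L' L) : Ker F L →ₗ[ℂ] Ker F L' :=
  Finsupp.lsum ℂ fun c : L → VB =>
    Finsupp.lsingle (c ∘ D.inj) ∘ₗ (D.circ.map fun i => F.t (c i)).reverse.prod

theorem rawMap_single (D : BrauerDiagram L' L) (c : L → VB) (m : F.carrier) :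
    rawMap F D (Finsupp.single c m) =
      Finsupp.single (c ∘ D.inj) ((D.circ.map fun i => F.t (c i)).reverse.prod m) := by
  rw [rawMap, Finsupp.lsum_single]
  rfl

theorem kerMap_eq (D : BrauerDiagram L' L) (he : D.edges = 0) :
    kerMap F D = rawMap F D ∘ₗ reorderOp F (enum L) D.word := by
  refine ker_ext F fun c m => ?_
  rw [LinearMap.comp_apply, reorderOp_single, map_smul, rawMap_single, kerMap_single, he]
  simp

/-- The action of `x ∧ y` commutes with `t`. -/
theorem fock_commutator (x y u : VB) :
    form ε y u • F.t x - (koszul ε x y * form ε x u) • F.t y +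
        (koszul ε x u * koszul ε y u) • (F.t u * (F.t x * F.t y - (form ε x y / 2) • 1)) =
      (F.t x * F.t y - (form ε x y / 2) • 1) * F.t u := by
  have h1 : koszul ε x y * form ε x u = koszul ε y u * form ε x u := by
    by_cases h : form ε x u = 0
    · simp [h]
    · rw [koszul_eq_of_form_ne_zero h y, koszul_comm]
  have h2 : koszul ε x u * koszul ε y u * (form ε x y / 2) = form ε x y / 2 := by
    by_cases h : form ε x y = 0
    · simp [h]
    · rw [koszul_eq_of_form_ne_zero h u, koszul_mul_self, one_mul]
  have c1 : F.t y * F.t u = form ε y u • 1 - koszul ε y u • (F.t u * F.t y) :=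
    eq_sub_of_add_eq (F.clifford y u)
  have c2 : F.t x * F.t u = form ε x u • 1 - koszul ε x u • (F.t u * F.t x) :=
    eq_sub_of_add_eq (F.clifford x u)
  have c3 : F.t x * F.t y * F.t u = form ε y u • F.t x - (koszul ε y u * form ε x u) • F.t y +
      (koszul ε x u * koszul ε y u) • (F.t u * (F.t x * F.t y)) := by
    rw [mul_assoc, c1, mul_sub, mul_smul_comm, mul_one, mul_smul_comm, ← mul_assoc, c2, sub_mul,
      smul_mul_assoc, one_mul, smul_mul_assoc, smul_sub, smul_smul, smul_smul, mul_assoc,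
      mul_comm (koszul ε x u)]
    abel
  rw [sub_mul, c3, mul_sub, smul_sub, h1, mul_smul_comm, smul_smul, h2, mul_one, smul_mul_assoc, one_mul]
  abel

theorem rawMap_wedgeList (D : BrauerDiagram L' L) (he : D.edges = 0)
    (hc : D.circ = [] ∨ ∃ i, D.circ = [i]) {l : List L'} (h : IsEnum l) (x y : VB) :
    rawMap F D ∘ₗ wedgeList F (l.map D.inj ++ D.circ.reverse) x y = wedgeList F l x y ∘ₗ rawMap F D := by
  refine ker_ext F fun c m => ?_
  set k : L → ℂ := fun j => koszul ε x (c j) * koszul ε y (c j) with hk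
  have hnot : ∀ i ∈ D.circ, ∀ a, D.inj a ≠ i := by
    rintro i hi a rfl
    have hn := D.nodup_exhaust
    rw [he, Multiset.zero_bind, add_zero, Multiset.nodup_add, Multiset.disjoint_left] at hn
    exact hn.2.2 (Multiset.mem_map_of_mem _ (Finset.mem_univ a)) hi
  have hidx (a : L') : (l.map D.inj ++ D.circ.reverse).idxOf (D.inj a) = l.idxOf a := by
    rw [List.idxOf_append, if_pos (List.mem_map_of_mem (h.mem a))]
    exact idxOf_map_of_injective D.inj_injective a l
  have hidx2 (i : L) (hi : i ∈ D.circ) (a : L') :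
      l.idxOf a < (l.map D.inj ++ D.circ.reverse).idxOf i := by
    rw [List.idxOf_append, if_neg, List.length_map]
    · exact (List.idxOf_lt_length_iff.2 (h.mem a)).trans_le (Nat.le_add_left _ _)
    · intro hm
      obtain ⟨b, -, hb⟩ := List.mem_map.1 hm
      exact hnot i hi b hb
  -- The sign in front of the term of a factor that is not contracted.
  have hpre (a : L') : (∏ j : L with (l.map D.inj ++ D.circ.reverse).idxOf j <
        (l.map D.inj ++ D.circ.reverse).idxOf (D.inj a), k j) =
      ∏ j : L' with l.idxOf j < l.idxOf a, k (D.inj j) := by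
    rw [Finset.prod_filter, Finset.prod_filter, prod_exhaust D he, List.prod_eq_one, mul_one]
    · simp only [hidx]
    · intro z hz
      obtain ⟨i, hi, rfl⟩ := List.mem_map.1 hz
      rw [if_neg]
      rw [hidx]
      exact (hidx2 i hi a).not_gt
  have hupd (a : L') (z : VB) : rawMap F D (Finsupp.single (Function.update c (D.inj a) z) m) =
      Finsupp.single (Function.update (c ∘ D.inj) a z) ((D.circ.map fun i => F.t (c i)).reverse.prod m) := by
    rw [rawMap_single, Function.update_comp_eq_of_injective _ D.inj_injective]
    congr 4
    refine List.map_congr_left fun i hi => ?_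
    rw [Function.update_of_ne (hnot i hi a).symm]
  rw [LinearMap.comp_apply, LinearMap.comp_apply, rawMap_single, wedgeList_single, wedgeList_single,
    sum_exhaust D he, prod_exhaust D he, map_add, map_add, map_sum, add_assoc]
  refine congrArg₂ _ (Finset.sum_congr rfl fun a _ => ?_) ?_
  · rw [map_smul, map_sub, map_smul, map_smul, hupd, hupd]
    exact congrArg (· • _) (hpre a)
  · rw [map_smul, rawMap_single]
    rcases hc with hc | ⟨i, hc⟩
    · simp [hc]
    · have hi : i ∈ D.circ := by simp [hc]
      have hupd2 (z : VB) : rawMap F D (Finsupp.single (Function.update c i z) m) =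
          Finsupp.single (c ∘ D.inj) (F.t z m) := by
        rw [rawMap_single, hc]
        have : Function.update c i z ∘ D.inj = c ∘ D.inj :=
          funext fun a => Function.update_of_ne (hnot i hi a) _ _
        simp [this]
      have hpre2 : (∏ j : L with (l.map D.inj ++ D.circ.reverse).idxOf j <
          (l.map D.inj ++ D.circ.reverse).idxOf i, k j) = ∏ j : L', k (D.inj j) := by
        rw [Finset.prod_filter, prod_exhaust D he, hc]
        rw [hc] at hidx hidx2
        simp only [List.map_cons, List.map_nil, List.prod_singleton, lt_irrefl, if_false, mul_one, hidx]
        exact Finset.prod_congr rfl fun a _ => if_pos (hidx2 i (by simp) a)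
      have hcomm := LinearMap.congr_fun (fock_commutator F x y (c i)) m
      simp only [LinearMap.add_apply, LinearMap.sub_apply, LinearMap.smul_apply, Module.End.mul_apply,
        Module.End.one_apply] at hcomm
      have hprod : (D.circ.map fun i => F.t (c i)).reverse.prod = F.t (c i) := by simp [hc]
      have hprod2 : (D.circ.map k).prod = koszul ε x (c i) * koszul ε y (c i) := by simp [hc, hk]
      have hsum : ∀ G : L → Ker F L, (D.circ.map G).sum = G i := fun G => by simp [hc]
      rw [hsum, map_smul, map_sub, map_smul, map_smul, hupd2, hupd2, hprod]
      refine Eq.trans (congrArg₂ _ (congrArg (· • _) hpre2) (congrArg (fun z => (_ * z) • _) hprod2)) ?_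
      change (∏ j, k (D.inj j)) • _ + ((∏ j, k (D.inj j)) * _) • _ = (∏ j, k (D.inj j)) • _
      rw [mul_smul (∏ j, k (D.inj j)), ← smul_add]
      refine congrArg ((∏ j : L', k (D.inj j)) • ·) ?_
      simp only [Finsupp.smul_single, ← Finsupp.single_sub, ← Finsupp.single_add]
      rw [← hcomm]

/-- Relabelling and contraction commute with the action of `x ∧ y`. -/
theorem kerMap_wedgeOp (D : BrauerDiagram L' L) (he : D.edges = 0)
    (hc : D.circ = [] ∨ ∃ i, D.circ = [i]) (x y : VB) :
    kerMap F D ∘ₗ wedgeOp F x y = wedgeOp F x y ∘ₗ kerMap F D := by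
  rw [kerMap_eq F D he, wedgeOp_eq, wedgeOp_eq, LinearMap.comp_assoc,
    reorderOp_wedgeList F isEnum_enum (word_isEnum D), ← LinearMap.comp_assoc,
    word_of_edges_eq_zero D he, rawMap_wedgeList F D he hc isEnum_enum, LinearMap.comp_assoc]

theorem kerMap_lieOp (D : BrauerDiagram L' L) (he : D.edges = 0)
    (hc : D.circ = [] ∨ ∃ i, D.circ = [i]) (a : Lie2 ε) (v : Ker F L) :
    kerMap F D (lieOp F L a v) = lieOp F L' a (kerMap F D v) := by
  suffices h : LinearMap.compRight ℂ (kerMap F D) ∘ₗ lieOp F L =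
      LinearMap.lcomp ℂ (Ker F L') (kerMap F D) ∘ₗ lieOp F L' from
    LinearMap.congr_fun (LinearMap.congr_fun h a) v
  refine Submodule.linearMap_qext _ (Finsupp.lhom_ext' fun p => LinearMap.ext_ring ?_)
  have h := kerMap_wedgeOp F D he hc p.1 p.2
  have h1 : ∀ L [Fintype L], lieOp F L (Submodule.Quotient.mk (Finsupp.single p 1)) = wedgeOp F p.1 p.2 :=
    fun L _ => by
      refine (Submodule.liftQ_apply _ _ _).trans ?_
      rw [Finsupp.linearCombination_single, one_smul]
  change kerMap F D ∘ₗ lieOp F L (Submodule.Quotient.mk (Finsupp.single p 1)) =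
    lieOp F L' (Submodule.Quotient.mk (Finsupp.single p 1)) ∘ₗ kerMap F D
  rw [h1, h1, h]

theorem parityOp_single (c : L → VB) (m : F.carrier) :
    parityOp F L (Finsupp.single c m) = (∏ i, par ε (c i)) • Finsupp.single c (F.parity m) := by
  rw [parityOp, Finsupp.lsum_single]
  rfl

theorem kerMap_parityOp (D : BrauerDiagram L' L) (he : D.edges = 0)
    (hc : D.circ = [] ∨ ∃ i, D.circ = [i]) (v : Ker F L) :
    kerMap F D (parityOp F L v) = parityOp F L' (kerMap F D v) := by
  suffices h : kerMap F D ∘ₗ parityOp F L = parityOp F L' ∘ₗ kerMap F D from LinearMap.congr_fun h v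
  refine ker_ext F fun c m => ?_
  rw [LinearMap.comp_apply, LinearMap.comp_apply, parityOp_single, map_smul, kerMap_single, kerMap_single,
    map_smul, parityOp_single, smul_comm, prod_exhaust D he]
  rcases hc with hc | ⟨i, hc⟩
  · simp [hc]
  · have hp : ∀ x, par ε x * par ε x = 1 := fun x => by cases x <;> simp [par, sg_mul_self]
    have h := LinearMap.congr_fun (F.parity_t (c i)) m
    simp only [Module.End.mul_apply, LinearMap.smul_apply] at h
    simp [hc, h, mul_smul]

end KernelMaps

/-! ### Diagrams that vanish on primitive elements -/

section Primitive

open Classical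

variable {ε : ℤˣ} (F : FockModule ε) {L L' : Type} [Fintype L] [Fintype L']

/-- A pair of factors of the same parity can be moved past other factors without a sign. -/
theorem reorderSign_move_pair (c : L → VB) {i j : L} (hij : ∀ z, koszul ε (c j) z = koszul ε (c i) z)
    (A X B : List L) (h : IsEnum (A ++ j :: i :: (X ++ B))) :
    reorderSign ε c (A ++ j :: i :: (X ++ B)) (A ++ (X ++ j :: i :: B)) = 1 := by
  induction X generalizing A with
  | nil => exact reorderSign_self _ _
  | cons x X ih =>
    have p1 : (A ++ j :: x :: i :: (X ++ B)).Perm (A ++ j :: i :: (x :: X ++ B)) :=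
      ((List.Perm.swap _ _ _).cons _).append_left _
    have p2 : (A ++ x :: j :: i :: (X ++ B)).Perm (A ++ j :: i :: (x :: X ++ B)) :=
      ((List.Perm.swap _ _ _).append_left _).trans p1
    have h1 := h.perm p1
    have h2 := h.perm p2
    have h3 : IsEnum ((A ++ [x]) ++ j :: i :: (X ++ B)) := by simpa using h2
    have e3 := ih (A ++ [x]) h3
    have p4 : ((A ++ [x]) ++ (X ++ j :: i :: B)).Perm ((A ++ [x]) ++ j :: i :: (X ++ B)) := by
      refine List.Perm.append_left _ ?_
      have : (X ++ ([j, i] ++ B)).Perm (([j, i] ++ X) ++ B) := by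
        rw [← List.append_assoc]
        exact List.perm_append_comm.append_right _
      simpa using this
    have h4 := h3.perm p4
    have e1 := reorderSign_swap (ε := ε) c (A ++ [j]) (X ++ B) i x (by simpa using h.nodup)
    have e2 := reorderSign_swap (ε := ε) c A (i :: (X ++ B)) j x h1.nodup
    simp only [List.append_assoc, List.cons_append, List.nil_append] at h e1 e2 e3 h4 ⊢
    rw [← reorderSign_mul c h h1 h4, ← reorderSign_mul c h1 h2 h4, e3, mul_one, e1, e2,
      swapSign, swapSign, ← hij, mul_mul_mul_comm, sg_mul_self, koszul_mul_self, one_mul]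

/-- The list of the end points of a list of edges. -/
def flatEdges {L : Type} (P : List (L × L)) : List L := P.flatMap fun p => [p.2, p.1]

/-- The order of the edges does not matter for the sign. -/
theorem reorderSign_perm_pairs (c : L → VB) {P P' : List (L × L)} (hP : P.Perm P')
    (hc : ∀ p ∈ P, ∀ z, koszul ε (c p.2) z = koszul ε (c p.1) z) (A B : List L)
    (h : IsEnum (A ++ (flatEdges P ++ B))) :
    reorderSign ε c (A ++ (flatEdges P ++ B)) (A ++ (flatEdges P' ++ B)) = 1 := by
  induction hP generalizing A with
  | nil => exact reorderSign_self _ _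
  | cons p _ ih =>
    have := ih (fun q hq => hc q (List.mem_cons_of_mem _ hq)) (A ++ [p.2, p.1])
      (by simpa [flatEdges] using h)
    simpa [flatEdges] using this
  | swap p q l =>
    exact reorderSign_move_pair c (hc q (by simp)) A [p.2, p.1] (flatEdges l ++ B) h
  | @trans P₁ P₂ P₃ h1 h2 ih1 ih2 =>
    have hperm : ∀ {P P' : List (L × L)}, P.Perm P' →
        (A ++ (flatEdges P' ++ B)).Perm (A ++ (flatEdges P ++ B)) := fun h =>
      ((List.Perm.flatMap_right _ h.symm).append_right _).append_left _
    rw [← reorderSign_mul c h (h.perm (hperm h1)) (h.perm (hperm (h1.trans h2))), ih1 hc A h,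
      ih2 (fun p hp => hc p (h1.mem_iff.2 hp)) A (h.perm (hperm h1)), one_mul]

/-- The maps given by diagrams satisfy the Clifford (respectively Weyl) relation. -/
theorem kerMap_cutEdge (D : BrauerDiagram L' L) (i j : L) (E : Multiset (L × L))
    (h : D.edges = (i, j) ::ₘ E) :
    kerMap F D = kerMap F (D.cutEdge i j E h) +
      sg ε • kerMap F ((D.cutEdge i j E h).permCirc (j :: i :: D.circ) (List.Perm.swap _ _ _)) := by
  refine ker_ext F fun c m => ?_
  set D₁ := D.cutEdge i j E h with hD₁
  set D₂ := D₁.permCirc (j :: i :: D.circ) (List.Perm.swap _ _ _) with hD₂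
  let A := (enum L').map D.inj ++ flatEdges E.toList ++ D.circ.reverse
  have w1 : D₁.word = A ++ [j, i] := by simp [BrauerDiagram.word, hD₁, BrauerDiagram.cutEdge, A, flatEdges]
  have w2 : D₂.word = A ++ [i, j] := by
    simp [BrauerDiagram.word, hD₂, hD₁, BrauerDiagram.cutEdge, BrauerDiagram.permCirc, A, flatEdges]
  have hi2 := word_isEnum D₂
  have hi1 := word_isEnum D₁
  have s2 : reorderSign ε c (enum L) D₂.word =
      reorderSign ε c (enum L) D₁.word * swapSign ε (c j) (c i) := by
    rw [← reorderSign_mul c isEnum_enum hi1 hi2, w1, w2, reorderSign_swap c A [] j i (w1 ▸ hi1.nodup)]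
  -- If the pairing of the edges is not zero, then the pair `j, i` can be moved to the end of the word.
  have s1 : form ε (c j) (c i) ≠ 0 → (E.map fun p => form ε (c p.2) (c p.1)).prod ≠ 0 →
      reorderSign ε c (enum L) D.word = reorderSign ε c (enum L) D₁.word := by
    intro hij hE
    have hE' : ∀ p ∈ E, ∀ z, koszul ε (c p.2) z = koszul ε (c p.1) z := fun p hp z =>
      koszul_eq_of_form_ne_zero (fun h0 => hE (Multiset.prod_eq_zero
        (Multiset.mem_map.2 ⟨p, hp, h0⟩))) z
    have hij' := fun z => koszul_eq_of_form_ne_zero hij z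
    have w0 : D.word = (enum L').map D.inj ++ (flatEdges D.edges.toList ++ D.circ.reverse) := by
      simp [BrauerDiagram.word, flatEdges]
    have hp : D.edges.toList.Perm ((i, j) :: E.toList) := by
      rw [← Multiset.coe_eq_coe, Multiset.coe_toList, ← Multiset.cons_coe, Multiset.coe_toList, h]
    have hi0 := word_isEnum D
    rw [w0] at hi0
    have r1 := reorderSign_perm_pairs (ε := ε) c hp (fun p hp' => by
      rcases List.mem_cons.1 (hp.mem_iff.1 hp') with rfl | hp''
      · exact hij'
      · exact hE' p (by simpa using hp'')) _ _ hi0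
    have hi3 := hi0.perm (l' := (enum L').map D.inj ++ (flatEdges ((i, j) :: E.toList) ++ D.circ.reverse))
      (((List.Perm.flatMap_right _ hp.symm).append_right _).append_left _)
    have r2 := reorderSign_move_pair (ε := ε) c hij' ((enum L').map D.inj)
      (flatEdges E.toList ++ D.circ.reverse) [] (by simpa [flatEdges] using hi3)
    have e3 : (enum L').map D.inj ++ j :: i :: (flatEdges E.toList ++ D.circ.reverse ++ []) =
        (enum L').map D.inj ++ (flatEdges ((i, j) :: E.toList) ++ D.circ.reverse) := by simp [flatEdges]
    have e4 : (enum L').map D.inj ++ (flatEdges E.toList ++ D.circ.reverse ++ [j, i]) = D₁.word := by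
      simp [w1, A]
    rw [e3, e4] at r2
    rw [← reorderSign_mul c isEnum_enum hi3 hi1, r2, mul_one,
      ← reorderSign_mul c isEnum_enum hi0 hi3, r1, mul_one, w0]
  have hcl := F.clifford (c j) (c i)
  have hop : ((D.circ.map fun i => F.t (c i)).reverse.prod (F.t (c j) (F.t (c i) m))) +
      koszul ε (c j) (c i) • ((D.circ.map fun i => F.t (c i)).reverse.prod (F.t (c i) (F.t (c j) m))) =
      form ε (c j) (c i) • ((D.circ.map fun i => F.t (c i)).reverse.prod m) := by
    have := congrArg (fun f => (D.circ.map fun i => F.t (c i)).reverse.prod (f m)) hcl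
    simpa using this
  have hE1 : D₁.edges = E := rfl
  have hE2 : D₂.edges = E := rfl
  have hinj1 : D₁.inj = D.inj := rfl
  have hinj2 : D₂.inj = D.inj := rfl
  have hc1 : D₁.circ = i :: j :: D.circ := rfl
  have hc2 : D₂.circ = j :: i :: D.circ := rfl
  rw [LinearMap.add_apply, LinearMap.smul_apply, kerMap_single, kerMap_single, kerMap_single, s2, h, hE1, hE2,
    hinj1, hinj2, hc1, hc2]
  simp only [List.map_cons, List.reverse_cons, List.prod_append, List.prod_singleton, Module.End.mul_apply,
    Multiset.map_cons, Multiset.prod_cons, smul_smul]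
  have hsg : ∀ r e : ℂ, sg ε * (r * swapSign ε (c j) (c i) * e) = r * e * koszul ε (c j) (c i) := by
    intro r e
    rw [swapSign]
    linear_combination (r * koszul ε (c j) (c i) * e) * sg_mul_self ε
  rw [hsg, mul_smul _ (koszul ε (c j) (c i)), ← smul_add, Finsupp.smul_single (koszul ε _ _),
    ← Finsupp.single_add, hop, ← Finsupp.smul_single, smul_smul]
  congr 1
  by_cases h1 : form ε (c j) (c i) = 0
  · simp [h1]
  by_cases h2 : (E.map fun p => form ε (c p.2) (c p.1)).prod = 0
  · simp [h2]
  rw [s1 h1 h2]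
  ring

/-- The elements that are killed by all `t_i` are killed by all diagrams that are not bijections. -/
theorem kerMap_eq_zero_of_mem_primitive (D : BrauerDiagram L' L) (hD : D.circ ≠ [] ∨ D.edges ≠ 0)
    {v : Ker F L} (hv : v ∈ primitive F L) : kerMap F D v = 0 := by
  induction D using BrauerDiagram.cutEdge_induction with
  | h0 D he =>
    obtain ⟨i, l, hl⟩ := List.exists_cons_of_ne_nil (hD.resolve_right (not_not.2 he))
    rw [← D.tailDiagram_comp i l hl he, kerMap_comp F _ _ rfl rfl, LinearMap.comp_apply,
      show kerMap F (BrauerDiagram.contract i) v = 0 from (Submodule.mem_iInf _).1 hv i, map_zero]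
  | h1 D i j E h ha hb =>
    rw [kerMap_cutEdge F D i j E h, LinearMap.add_apply, LinearMap.smul_apply,
      ha (Or.inl (List.cons_ne_nil _ _)), hb (Or.inl (List.cons_ne_nil _ _)), smul_zero, add_zero]

end Primitive

/-! ### Equivariant maps to a Schur functor -/

section Duality

variable {μ : YoungDiagram}

instance tensorHoms.addCommGroup {ι : Type} {V : Type} [AddCommGroup V] [Module ℂ V]
    (ρ : Representation ℂ GLinf V) : AddCommGroup (tensorHoms ι ρ) := inferInstance

/-- A numbering of the cells. -/
def cellIndex (μ : YoungDiagram) (a : Cell μ) : ℕ := Fintype.equivFin (Cell μ) a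

theorem cellIndex_injective : Function.Injective (cellIndex μ) := fun _ _ h =>
  (Fintype.equivFin (Cell μ)).injective (Fin.ext h)

/-- The element of the group algebra by which an equivariant map `(ℂ^∞)^{⊗ |μ|} → S_μ(ℂ^∞)` acts. -/
def homCoeff (μ : YoungDiagram) :
    tensorHoms (Cell μ) (schurRep μ) →ₗ[ℂ] MonoidAlgebra ℂ (Equiv.Perm (Cell μ)) :=
  ∑ σ : Equiv.Perm (Cell μ), MonoidAlgebra.lsingle σ ∘ₗ tcoord (cellIndex μ ∘ σ.symm) ∘ₗ
    (SchurFunctor μ).subtype ∘ₗ LinearMap.applyₗ (tbas (cellIndex μ)) ∘ₗ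
      (tensorHoms (Cell μ) (schurRep μ)).subtype

theorem asAlgebraHom_homCoeff (φ : tensorHoms (Cell μ) (schurRep μ)) (x : ⨂[ℂ] _ : Cell μ, Cinf) :
    (permRep (Cell μ)).asAlgebraHom (homCoeff μ φ) x = (φ.1 x).1 := by
  let ψ : tensorHoms (Cell μ) (tensorRep (Cell μ)) := ⟨(SchurFunctor μ).subtype ∘ₗ φ.1, fun g x => by
    rw [LinearMap.comp_apply, φ.2]; rfl⟩
  obtain ⟨a, ha⟩ := exists_asAlgebraHom_permRep ψ
  have h : homCoeff μ φ = a := by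
    refine MonoidAlgebra.coeff_injective (Finsupp.ext fun σ => ?_)
    rw [← tcoord_asAlgebraHom _ cellIndex_injective a σ, ← ha]
    simp only [homCoeff, LinearMap.sum_apply, MonoidAlgebra.coeff_sum, Finsupp.finsetSum_apply]
    rw [Finset.sum_eq_single σ]
    · exact Finsupp.single_eq_same
    · intro τ _ hτ
      exact Finsupp.single_eq_of_ne hτ.symm
    · simp
  rw [h, ← ha]
  rfl

theorem homCoeff_injective : Function.Injective (homCoeff μ) := fun φ ψ h =>
  Subtype.ext <| LinearMap.ext fun x => Subtype.ext <| by
    rw [← asAlgebraHom_homCoeff, h, asAlgebraHom_homCoeff]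

theorem youngSym_mul_homCoeff {m : ℂ} (hm : youngSym μ * youngSym μ = m • youngSym μ)
    (φ : tensorHoms (Cell μ) (schurRep μ)) : youngSym μ * homCoeff μ φ = m • homCoeff μ φ := by
  refine asAlgebraHom_permRep_injective (LinearMap.ext fun x => ?_)
  obtain ⟨y, hy⟩ := (φ.1 x).2
  rw [map_mul, map_smul, Module.End.mul_apply, LinearMap.smul_apply, asAlgebraHom_homCoeff, ← hy, youngOp,
    ← Module.End.mul_apply, ← map_mul, hm, map_smul, LinearMap.smul_apply]

theorem exists_homCoeff_eq (y : MonoidAlgebra ℂ (Equiv.Perm (Cell μ))) :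
    ∃ φ, homCoeff μ φ = youngSym μ * y := by
  refine ⟨⟨(youngOp μ).rangeRestrict ∘ₗ (permRep (Cell μ)).asAlgebraHom y, fun g x => Subtype.ext ?_⟩,
    asAlgebraHom_permRep_injective (LinearMap.ext fun x => ?_)⟩
  · change youngOp μ _ = tensorRep _ g (youngOp μ _)
    rw [asAlgebraHom_permRep_mem, youngOp_tensorRep]
  · rw [asAlgebraHom_homCoeff, map_mul]
    rfl

theorem coeff_one_mul_comm {G : Type} [Group G] (x y : MonoidAlgebra ℂ G) :
    (x * y).coeff 1 = (y * x).coeff 1 := by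
  induction x using MonoidAlgebra.induction_linear with
  | zero => simp
  | add x x' h h' => simp [add_mul, mul_add, h, h']
  | single g z => rw [MonoidAlgebra.coeff_mul_single_apply, MonoidAlgebra.coeff_single_mul_apply]; simp [mul_comm]

theorem eq_zero_of_coeff_one_mul {G : Type} [Group G] (x : MonoidAlgebra ℂ G)
    (h : ∀ y, (y * x).coeff 1 = 0) : x = 0 := by
  refine MonoidAlgebra.coeff_injective (Finsupp.ext fun g => ?_)
  simpa using h (MonoidAlgebra.single g⁻¹ 1)

/-- The pairing of the left ideal generated by the Young symmetrizer with the space of equivariant maps from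
`(ℂ^∞)^{⊗ |μ|}` to `S_μ(ℂ^∞)`. The latter is identified with a right ideal, and the pairing is the trace form. -/
def spechtPairing (μ : YoungDiagram) :
    Specht μ →ₗ[ℂ] tensorHoms (Cell μ) (schurRep μ) →ₗ[ℂ] ℂ :=
  LinearMap.mk₂ ℂ (fun x φ => (homCoeff μ φ * x.1).coeff 1)
    (fun x y φ => by simp [mul_add]) (fun c x φ => by simp)
    (fun x φ ψ => by simp [add_mul]) fun c x φ => by simp

theorem spechtPairing_isPerfPair (μ : YoungDiagram) : LinearMap.IsPerfPair (R := ℂ) (M := Specht μ)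
    (N := tensorHoms (Cell μ) (schurRep μ)) (spechtPairing μ) := by
  obtain ⟨m, hm0, hm⟩ := youngSym_mul_self (μ := μ)
  have : FiniteDimensional ℂ (tensorHoms (Cell μ) (schurRep μ)) :=
    FiniteDimensional.of_injective (homCoeff μ) homCoeff_injective
  refine LinearMap.IsPerfPair.of_injective' ?_ ?_
  · rw [injective_iff_map_eq_zero]
    intro x hx
    have h1 : x.1 * youngSym μ = 0 := by
      refine eq_zero_of_coeff_one_mul _ fun y => ?_
      obtain ⟨φ, hφ⟩ := exists_homCoeff_eq (μ := μ) y
      have := LinearMap.congr_fun hx φ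
      change (homCoeff μ φ * x.1).coeff 1 = 0 at this
      rw [hφ, mul_assoc, coeff_one_mul_comm] at this
      rw [← mul_assoc, this]
    obtain ⟨u, hu⟩ := Ideal.mem_span_singleton'.1 x.2
    rw [← hu, mul_assoc, hm, mul_smul_comm, hu] at h1
    exact Subtype.ext ((smul_eq_zero.1 h1).resolve_left hm0)
  · rw [injective_iff_map_eq_zero]
    intro φ hφ
    refine homCoeff_injective ?_
    rw [map_zero]
    refine eq_zero_of_coeff_one_mul _ fun u => ?_
    have := LinearMap.congr_fun hφ ⟨u * youngSym μ, Ideal.mem_span_singleton'.2 ⟨u, rfl⟩⟩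
    change (homCoeff μ φ * (u * youngSym μ)).coeff 1 = 0 at this
    rw [coeff_one_mul_comm, mul_assoc, youngSym_mul_homCoeff hm, mul_smul_comm] at this
    simpa [hm0] using this

/-- The dual of the space of equivariant maps from `(ℂ^∞)^{⊗ |μ|}` to `S_μ(ℂ^∞)` is the irreducible representation `M_μ`
of the symmetric group. -/
def spechtDual (μ : YoungDiagram) :
    Specht μ ≃ₗ[ℂ] Module.Dual ℂ (tensorHoms (Cell μ) (schurRep μ)) :=
  have := spechtPairing_isPerfPair μ
  LinearMap.toPerfPair (R := ℂ) (M := Specht μ) (N := tensorHoms (Cell μ) (schurRep μ)) (spechtPairing μ)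

theorem spechtDual_apply (x : Specht μ) (φ : tensorHoms (Cell μ) (schurRep μ)) :
    spechtDual μ x φ = (homCoeff μ φ * x.1).coeff 1 := rfl

theorem spechtDual_single (ε : ℤˣ) (σ : Equiv.Perm (Cell μ)) (x : Specht μ) :
    spechtDual μ (MonoidAlgebra.single σ (1 : ℂ) • x) =
      (diagramAct (simpleU ε μ) (.ofEquiv σ)).dualMap (spechtDual μ x) := by
  refine LinearMap.ext fun φ => ?_
  have h : homCoeff μ (diagramAct (simpleU ε μ) (.ofEquiv σ) φ) =
      homCoeff μ φ * MonoidAlgebra.single σ 1 := by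
    refine asAlgebraHom_permRep_injective (LinearMap.ext fun y => ?_)
    refine (asAlgebraHom_homCoeff _ _).trans ?_
    refine (congrArg Subtype.val (diagramAct_ofEquiv (simpleU ε μ) σ φ y)).trans ?_
    rw [map_mul, Module.End.mul_apply,
      Representation.asAlgebraHom_single, one_smul, asAlgebraHom_homCoeff]
    rfl
  refine Eq.trans ?_ (congrArg (fun a : MonoidAlgebra ℂ (Equiv.Perm (Cell μ)) => (a * x.1).coeff 1) h.symm)
  rw [spechtDual_apply, mul_assoc]
  rfl

end Duality

/-! ### The representations attached to the Schur functors -/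

section Specialization

variable {ε : ℤˣ} (F : FockModule ε) {μ : YoungDiagram}

theorem card_eq_of_diagram {L L' : Type} [Fintype L] [Fintype L'] (D : BrauerDiagram L' L) :
    Fintype.card L = Fintype.card L' + D.circ.length + 2 * Multiset.card D.edges := by
  have h := congrArg Multiset.card D.exhaust
  rw [Multiset.card_add, Multiset.card_add, Multiset.card_map, Multiset.coe_card, Multiset.card_bind] at h
  have h2 : (D.edges.map (Multiset.card ∘ fun p => ({p.1, p.2} : Multiset L))).sum = 2 * Multiset.card D.edges := by
    rw [show (Multiset.card ∘ fun p : L × L => ({p.1, p.2} : Multiset L)) = fun _ => 2 from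
      funext fun p => Multiset.card_pair _ _, Multiset.map_const', Multiset.sum_replicate, smul_eq_mul, mul_comm]
  rw [h2] at h
  exact h

/-- The space of equivariant maps `(ℂ^∞)^{⊗ L} → S_μ(ℂ^∞)`. -/
abbrev SchurHoms (μ : YoungDiagram) (L : Type) : Type := tensorHoms L (schurRep μ)

/-- The representation attached to `S_μ` is concentrated on the sets with `|μ|` elements. -/
theorem schurHoms_eq_zero {L : Type} [Fintype L] (hL : Fintype.card L ≠ Fintype.card (Cell μ))
    (φ : SchurHoms μ L) : φ = 0 := by
  let ψ : tensorHoms L (tensorRep (Cell μ)) := ⟨(SchurFunctor μ).subtype ∘ₗ φ.1, fun g x => by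
    rw [LinearMap.comp_apply, φ.2]; rfl⟩
  have h := eq_zero_of_mem_tensorHoms hL.symm ψ
  exact Subtype.ext <| LinearMap.ext fun x =>
    Subtype.ext (LinearMap.congr_fun (congrArg Subtype.val h) x)

theorem schurHoms_dual_eq_zero {L : Type} [Fintype L] (hL : Fintype.card L ≠ Fintype.card (Cell μ))
    (y : Module.Dual ℂ (SchurHoms μ L)) : y = 0 :=
  LinearMap.ext fun φ => by rw [schurHoms_eq_zero hL φ, map_zero, map_zero]

/-- The action of a diagram on the spaces of equivariant maps. -/
def schurMap (ε : ℤˣ) (μ : YoungDiagram) {L L' : Type} [Fintype L] [Fintype L'] (D : BrauerDiagram L' L) :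
    SchurHoms μ L' →ₗ[ℂ] SchurHoms μ L := diagramAct (simpleU ε μ) D

theorem schurMap_comp {L₁ L₂ L₃ : Type} [Fintype L₁] [Fintype L₂] [Fintype L₃] (D : BrauerDiagram L₁ L₂)
    (D' : BrauerDiagram L₂ L₃) : schurMap ε μ (D.comp D') = schurMap ε μ D' ∘ₗ schurMap ε μ D :=
  diagramAct_comp (simpleU ε μ) D D'

theorem schurMap_eq_zero {L L' : Type} [Fintype L] [Fintype L'] (D : BrauerDiagram L' L)
    (hD : D.circ ≠ [] ∨ D.edges ≠ 0) : schurMap ε μ D = 0 := by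
  refine LinearMap.ext fun φ => ?_
  by_cases h : Fintype.card L = Fintype.card (Cell μ)
  · rw [schurHoms_eq_zero (μ := μ) (L := L') _ φ, map_zero, map_zero]
    have h1 := card_eq_of_diagram D
    have h2 : 0 < D.circ.length ∨ 0 < Multiset.card D.edges :=
      hD.imp List.length_pos_iff.2 Multiset.card_pos.2
    omega
  · rw [schurHoms_eq_zero h (schurMap ε μ D φ), LinearMap.zero_apply]

/-- The defining condition of `N ⊗ 𝒦`, for the representation `N` of the upwards category that corresponds to `S_μ`. -/
theorem mem_specialize_iff (φ : Families F ((multiplicityFunctor ε).obj (simpleU ε μ))) :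
    φ ∈ specialize F ((multiplicityFunctor ε).obj (simpleU ε μ)) ↔
      ∀ (L' L : UpCat ε) (D : BrauerDiagram L'.carrier L.carrier) (y : Module.Dual ℂ (SchurHoms μ L.carrier)),
        kerMap F D (φ L y) = φ L' ((schurMap ε μ D).dualMap y) := by
  have key (L' L : UpCat ε) (D : BrauerDiagram L'.carrier L.carrier) :
      (((multiplicityFunctor ε).obj (simpleU ε μ)).obj.map (UpCat.diagram D)).hom = schurMap ε μ D :=
    upAct_mk (simpleU ε μ) D
  constructor
  · intro h L' L D y
    refine (LinearMap.congr_fun (h L' L D) y).trans ?_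
    rw [key]
    rfl
  · intro h L' L D
    refine LinearMap.ext fun y => (h L' L D y).trans ?_
    rw [key]
    rfl

open Classical in
theorem mem_primitive_of_mem_specialize {φ : Families F ((multiplicityFunctor ε).obj (simpleU ε μ))}
    (hφ : φ ∈ specialize F ((multiplicityFunctor ε).obj (simpleU ε μ))) (L : UpCat ε)
    (y : Module.Dual ℂ (SchurHoms μ L.carrier)) : φ L y ∈ primitive F L.carrier := by
  refine (Submodule.mem_iInf _).2 fun i => ?_
  refine ((mem_specialize_iff F φ).1 hφ (UpCat.mk {j : L.carrier // j ≠ i}) L (.contract i) y).trans ?_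
  rw [schurMap_eq_zero _ (Or.inl (List.cons_ne_nil _ _))]
  refine Eq.trans (congrArg _ ?_) (map_zero _)
  exact LinearMap.ext fun _ => map_zero y

open Classical in
theorem primitive_stable {T : ∀ L : UpCat ε, Module.End ℂ (Ker F L.carrier)}
    (hT : ∀ (L' L : UpCat ε) (D : BrauerDiagram L'.carrier L.carrier), D.edges = 0 →
      (D.circ = [] ∨ ∃ i, D.circ = [i]) → ∀ v, kerMap F D (T L v) = T L' (kerMap F D v))
    (L : UpCat ε) {v : Ker F L.carrier} (hv : v ∈ primitive F L.carrier) :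
    T L v ∈ primitive F L.carrier := by
  refine (Submodule.mem_iInf _).2 fun i => ?_
  refine (hT (UpCat.mk {j : L.carrier // j ≠ i}) L (.contract i) rfl (Or.inr ⟨i, rfl⟩) v).trans ?_
  rw [show kerMap F (.contract i) v = 0 from (Submodule.mem_iInf _).1 hv i, map_zero]

/-- Operators that commute with relabellings and with the maps `t_i` act on `N ⊗ 𝒦`. -/
theorem post_mem_specialize {T : ∀ L : UpCat ε, Module.End ℂ (Ker F L.carrier)}
    (hT : ∀ (L' L : UpCat ε) (D : BrauerDiagram L'.carrier L.carrier), D.edges = 0 →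
      (D.circ = [] ∨ ∃ i, D.circ = [i]) → ∀ v, kerMap F D (T L v) = T L' (kerMap F D v))
    {φ : Families F ((multiplicityFunctor ε).obj (simpleU ε μ))}
    (hφ : φ ∈ specialize F ((multiplicityFunctor ε).obj (simpleU ε μ))) :
    φ.post F T ∈ specialize F ((multiplicityFunctor ε).obj (simpleU ε μ)) := by
  refine (mem_specialize_iff F _).2 fun L' L D y => ?_
  change kerMap F D (T L (φ L y)) = T L' (φ L' _)
  by_cases hD : D.circ = [] ∧ D.edges = 0
  · rw [hT L' L D hD.2 (Or.inl hD.1)]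
    exact congrArg (T L') ((mem_specialize_iff F φ).1 hφ L' L D y)
  · rw [not_and_or] at hD
    rw [kerMap_eq_zero_of_mem_primitive F D hD
      (primitive_stable F hT L (mem_primitive_of_mem_specialize F hφ L y)), schurMap_eq_zero D hD]
    have : (LinearMap.dualMap (0 : SchurHoms μ L'.carrier →ₗ[ℂ] SchurHoms μ L.carrier)) y = 0 :=
      LinearMap.ext fun _ => map_zero y
    refine (congrArg (T L') ((congrArg (φ L') this).trans (map_zero _))).trans (map_zero _) |>.symm

variable (μ)

/-- The restriction of a natural transformation to the set of cells. -/
def restrictToCells : specialize F ((multiplicityFunctor ε).obj (simpleU ε μ)) →ₗ[ℂ] simpleSpin F μ where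
  toFun φ := ⟨φ.1 (UpCat.mk (Cell μ)) ∘ₗ (spechtDual μ).toLinearMap,
    fun x => mem_primitive_of_mem_specialize F φ.2 (UpCat.mk (Cell μ)) _, fun σ x => by
      refine (congrArg (φ.1 (UpCat.mk (Cell μ))) (spechtDual_single ε σ x)).trans ?_
      exact ((mem_specialize_iff F φ.1).1 φ.2 (UpCat.mk (Cell μ)) (UpCat.mk (Cell μ)) (.ofEquiv σ)
        (spechtDual μ x)).symm⟩
  map_add' _ _ := rfl
  map_smul' _ _ := rfl

theorem kerMap_ofEquiv_trans {L₁ L₂ L₃ : Type} [Fintype L₁] [Fintype L₂] [Fintype L₃] (e : L₂ ≃ L₁)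
    (e' : L₃ ≃ L₂) (v : Ker F L₃) :
    kerMap F (.ofEquiv e) (kerMap F (.ofEquiv e') v) = kerMap F (.ofEquiv (e'.trans e)) v := by
  rw [← BrauerDiagram.ofEquiv_comp, kerMap_comp F _ _ rfl rfl, LinearMap.comp_apply]

theorem schurMap_ofEquiv_trans {L₁ L₂ L₃ : Type} [Fintype L₁] [Fintype L₂] [Fintype L₃] (e : L₂ ≃ L₁)
    (e' : L₃ ≃ L₂) (y : Module.Dual ℂ (SchurHoms μ L₃)) :
    (schurMap ε μ (.ofEquiv (e'.trans e))).dualMap y =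
      (schurMap ε μ (.ofEquiv e)).dualMap ((schurMap ε μ (.ofEquiv e')).dualMap y) := by
  rw [← BrauerDiagram.ofEquiv_comp, schurMap_comp]
  rfl

theorem restrictToCells_injective : Function.Injective (restrictToCells F μ) := by
  rw [injective_iff_map_eq_zero]
  intro φ hφ
  have h0 : ∀ y, φ.1 (UpCat.mk (Cell μ)) y = 0 := fun y => by
    have := LinearMap.congr_fun (congrArg Subtype.val hφ) ((spechtDual μ).symm y)
    refine Eq.trans ?_ this
    exact congrArg (φ.1 (UpCat.mk (Cell μ))) ((spechtDual μ).apply_symm_apply y).symm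
  refine Subtype.ext (funext fun L => LinearMap.ext fun y => ?_)
  by_cases h : Fintype.card L.carrier = Fintype.card (Cell μ)
  · let e := Fintype.equivOfCardEq h
    have h1 := ((mem_specialize_iff F φ.1).1 φ.2 (UpCat.mk (Cell μ)) L (.ofEquiv e) y).trans (h0 _)
    have h2 := congrArg (kerMap F (.ofEquiv e.symm)) h1
    rw [kerMap_ofEquiv_trans, map_zero, Equiv.self_trans_symm, kerMap_refl] at h2
    exact h2
  · have := schurHoms_dual_eq_zero h y
    exact (congrArg (φ.1 L) this).trans (map_zero _)

open Classical in
theorem kerMap_ofEquiv_mem_primitive {L L' : Type} [Fintype L] [Fintype L'] (e : L ≃ L') {v : Ker F L}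
    (hv : v ∈ primitive F L) : kerMap F (.ofEquiv e) v ∈ primitive F L' := by
  refine (Submodule.mem_iInf _).2 fun i => ?_
  rw [LinearMap.mem_ker, ← LinearMap.comp_apply, ← kerMap_comp F _ _ rfl rfl]
  exact kerMap_eq_zero_of_mem_primitive F _ (Or.inl (by simp [BrauerDiagram.comp, BrauerDiagram.contract])) hv

open Classical in
/-- The extension of an element of `Δ_μ` to a natural transformation. -/
def extendFromCells (ψ : simpleSpin F μ) : Families F ((multiplicityFunctor ε).obj (simpleU ε μ)) := fun L =>
  if h : Fintype.card L.carrier = Fintype.card (Cell μ) then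
    kerMap F (.ofEquiv (Fintype.equivOfCardEq h).symm) ∘ₗ ψ.1 ∘ₗ (spechtDual μ).symm.toLinearMap ∘ₗ
      (schurMap ε μ (.ofEquiv (Fintype.equivOfCardEq h))).dualMap
  else 0

theorem simpleSpin_equivariant (ψ : simpleSpin F μ) (σ : Equiv.Perm (Cell μ))
    (y : Module.Dual ℂ (SchurHoms μ (Cell μ))) :
    ψ.1 ((spechtDual μ).symm ((schurMap ε μ (.ofEquiv σ)).dualMap y)) =
      kerMap F (.ofEquiv σ) (ψ.1 ((spechtDual μ).symm y)) := by
  obtain ⟨x, rfl⟩ := (spechtDual μ).surjective y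
  have h := spechtDual_single ε σ x
  rw [LinearEquiv.symm_apply_apply, ← ψ.2.2]
  refine congrArg ψ.1 ((LinearEquiv.symm_apply_eq _).2 h.symm)

theorem extendFromCells_apply (ψ : simpleSpin F μ) (L : UpCat ε) (e : L.carrier ≃ Cell μ)
    (y : Module.Dual ℂ (SchurHoms μ L.carrier)) :
    extendFromCells F μ ψ L y = kerMap F (.ofEquiv e.symm)
      (ψ.1 ((spechtDual μ).symm ((schurMap ε μ (.ofEquiv e)).dualMap y))) := by
  have h : Fintype.card L.carrier = Fintype.card (Cell μ) := Fintype.card_congr e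
  rw [extendFromCells, dif_pos h]
  set e' := Fintype.equivOfCardEq h
  have h1 : e' = e.trans (e.symm.trans e') := Equiv.ext fun x => by simp
  change kerMap F (.ofEquiv e'.symm)
    (ψ.1 ((spechtDual μ).symm ((schurMap ε μ (.ofEquiv e')).dualMap y))) = _
  have h2 : (schurMap ε μ (.ofEquiv e')).dualMap y =
      (schurMap ε μ (.ofEquiv (e.symm.trans e'))).dualMap ((schurMap ε μ (.ofEquiv e)).dualMap y) := by
    rw [← schurMap_ofEquiv_trans, ← h1]
  rw [h2, simpleSpin_equivariant, kerMap_ofEquiv_trans]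
  congr 3
  exact Equiv.ext fun x => by simp

theorem extendFromCells_mem (ψ : simpleSpin F μ) :
    extendFromCells F μ ψ ∈ specialize F ((multiplicityFunctor ε).obj (simpleU ε μ)) := by
  refine (mem_specialize_iff F _).2 fun L' L D y => ?_
  by_cases h : Fintype.card L.carrier = Fintype.card (Cell μ)
  swap
  · rw [schurHoms_dual_eq_zero h y]
    exact (congrArg (kerMap F D) (map_zero _)).trans (map_zero _) |>.trans (map_zero _).symm
  let e := Fintype.equivOfCardEq h
  rw [extendFromCells_apply F μ ψ L e]
  by_cases hD : D.circ = [] ∧ D.edges = 0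
  · obtain ⟨f, rfl⟩ := D.exists_eq_ofEquiv hD.1 hD.2
    have h3 : f.trans (f.symm.trans e) = e := Equiv.ext fun x => by simp
    rw [extendFromCells_apply F μ ψ L' (f.symm.trans e), kerMap_ofEquiv_trans, ← schurMap_ofEquiv_trans, h3]
    rfl
  · rw [not_and_or] at hD
    have h1 : schurMap ε μ D = 0 := schurMap_eq_zero D hD
    rw [h1]
    have h2 : (LinearMap.dualMap (0 : SchurHoms μ L'.carrier →ₗ[ℂ] SchurHoms μ L.carrier)) y = 0 :=
      LinearMap.ext fun _ => map_zero y
    refine Eq.trans ?_ ((congrArg (extendFromCells F μ ψ L') h2).trans (map_zero _)).symm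
    exact kerMap_eq_zero_of_mem_primitive F D hD (kerMap_ofEquiv_mem_primitive F _ (ψ.2.1 _))

theorem restrictToCells_surjective : Function.Surjective (restrictToCells F μ) := by
  intro ψ
  refine ⟨⟨extendFromCells F μ ψ, extendFromCells_mem F μ ψ⟩, Subtype.ext (LinearMap.ext fun x => ?_)⟩
  refine (extendFromCells_apply F μ ψ (UpCat.mk (Cell μ)) (Equiv.refl _) (spechtDual μ x)).trans ?_
  rw [simpleSpin_equivariant, LinearEquiv.symm_apply_apply, kerMap_ofEquiv_trans]
  exact LinearMap.congr_fun (kerMap_refl F) _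

/-- Natural transformations from the representation attached to `S_μ` to the kernel are determined by
their value at the set of cells of `μ`, which can be any element of `Δ_μ` (respectively `∇_μ`). -/
def superIso : SuperIso F ((multiplicityFunctor ε).obj (simpleU ε μ)) μ where
  toEquiv := LinearEquiv.ofBijective (restrictToCells F μ)
    ⟨restrictToCells_injective F μ, restrictToCells_surjective F μ⟩
  lie a φ := ⟨post_mem_specialize F (T := fun L => lieOp F L.carrier a)
    (fun _ _ D he hc v => kerMap_lieOp F D he hc a v) φ.2, rfl⟩
  parity φ := ⟨post_mem_specialize F (T := fun L => parityOp F L.carrier)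
    (fun _ _ D he hc v => kerMap_parityOp F D he hc v) φ.2, rfl⟩

end Specialization

end

end SpinOsc

theorem mainTheorem5 :
    ((∃ A : Abelian (UMod 1), A.toPreadditive = UMod.preadditive 1) ∧
      (∃ B : Abelian (UpMod 1), B.toPreadditive = Preadditive.fullSubcategory _) ∧
      ∃ E : UMod 1 ≌ UpMod 1, E.functor.Additive ∧ E.functor.Linear ℂ ∧
        ∀ μ : YoungDiagram, Simple (simpleU 1 μ) ∧
          Nonempty (SuperIso spinFock (E.functor.obj (simpleU 1 μ)) μ)) ∧
    ((∃ A : Abelian (UMod (-1)), A.toPreadditive = UMod.preadditive (-1)) ∧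
      (∃ B : Abelian (UpMod (-1)), B.toPreadditive = Preadditive.fullSubcategory _) ∧
      ∃ E : UMod (-1) ≌ UpMod (-1), E.functor.Additive ∧ E.functor.Linear ℂ ∧
        ∀ μ : YoungDiagram, Simple (simpleU (-1) μ) ∧
          Nonempty (SuperIso oscFock (E.functor.obj (simpleU (-1) μ)) μ)) :=
  ⟨⟨uMod_abelian 1, upMod_abelian 1, (multiplicityFunctor 1).asEquivalence,
      inferInstanceAs (multiplicityFunctor 1).Additive, inferInstanceAs ((multiplicityFunctor 1).Linear ℂ),
      fun μ => ⟨simpleU_simple 1 μ, ⟨superIso spinFock μ⟩⟩⟩,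
    ⟨uMod_abelian (-1), upMod_abelian (-1), (multiplicityFunctor (-1)).asEquivalence,
      inferInstanceAs (multiplicityFunctor (-1)).Additive, inferInstanceAs ((multiplicityFunctor (-1)).Linear ℂ),
      fun μ => ⟨simpleU_simple (-1) μ, ⟨superIso oscFock μ⟩⟩⟩⟩
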